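/- Let $0<c_0<1<c_1$ and $c_2$ be real constants, and let $\mathcal M^*$ be the set of i.i.d. laws $P^*$ of $X_1,X_2,\dots$ on $[0,1]$ whose common density $p^*$ is differentiable on $[0,1]$ with $c_0\le p^*(x)\le c_1$ and $|\frac{d}{dx}p^*(x)|\le c_2$ for all $x\in[0,1]$. For $k\ge 1$ let $\bar p_k$ be the histogram estimator with the $k$ bins $[0,\frac1k],(\frac1k,\frac2k],\dots,(\frac{k-1}k,1]$ and Laplace smoothing, $$\bar p_k(x_{n+1}\mid x^n)=\frac{n_{x_{n+1}}(x^n)+1}{n+k}\cdot k,$$ where $n_{x_{n+1}}(x^n)$ is the number of outcomes among $x^n=(x_1,\dots,x_n)$ that lie in the same bin as $x_{n+1}$. Let $\mathbb S$ be the set of all $\mathbf s=((t_1,k_1),\dots,(t_m,k_m))$ with $m\ge1$, integers $0=t_1<\dots<t_m$ and $k_i\ge1$. Let $q_{\mathbf s}$ be the strategy that predicts $x_{n+1}$ from $x^n$ by $\bar p_{k_i}$ with $i$ the largest index such that $t_i\le n$, and let $q_{\mathbf s}(x^n)$ be its joint density. Let $\pi_M,\pi_K,\pi_T$ be probability mass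 functions on $\{1,2,\dots\}$ with full support such that $-\log\pi_M(m)=O(m)$, $-\log\pi_K(k)=O(\log k)$ and $-\log\pi_T(t)=O(\log t)$, and put $$\pi(\mathbf s)=\pi_M(m)\,\pi_K(k_1)\prod_{i=2}^m\pi_T(t_i\mid t_i>t_{i-1})\,\pi_K(k_i).$$ The switch distribution $P_{\rm sw}$ has joint densities $p_{\rm sw}(x^n)=\sum_{\mathbf s\in\mathbb S}q_{\mathbf s}(x^n)\pi(\mathbf s)$ and predictive densities $p_{\rm sw}(x^{n+1})/p_{\rm sw}(x^n)$. For a prediction strategy $\bar P$ (a measurable family of conditional densities) let $r_i(P^*,\bar P)=E_{X^{i-1}\sim P^*}\big[D\big(P^*(X_i=\cdot)\,\|\,\bar P(X_i=\cdot\mid X^{i-1})\big)\big]$ be its Kullback–Leibler risk, and let $$G_{\rm sw}(n)=\sup_{P^*\in\mathcal M^*}\sum_{i=1}^n r_i(P^*,P_{\rm sw}),\quad G_{\rm hist}(n)=\sup_{P^*\in\mathcal M^*}\sum_{i=1}^n r_i(P^*,\bar P_{\lceil i^{1/3}\rceil}),\quad G_{\rm mm}(n)=\inf_{\bar P}\sup_{P^*\in\mathcal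 M^*}\sum_{i=1}^n r_i(P^*,\bar P),$$ the infimum being over all prediction strategies. For nonnegative functions and $c\ge0$ write $g\preceq_c h$ if for every $\epsilon>0$ we have $g(n)\le(1+\epsilon)\,c\,h(n)$ for all large $n$; write $g\preceq h$ if $g\preceq_c h$ for some $c>0$, and $g\asymp h$ if $g\preceq h$ and $h\preceq g$. Then: 1. $G_{\rm sw}(n)\preceq n^{1/3}$. 2. If $c_2>0$, then $G_{\rm mm}(n)\asymp n^{1/3}$ and $G_{\rm sw}(n)\preceq G_{\rm mm}(n)$; that is, the switch distribution attains the minimax rate in Cesàro mean, which is $n^{-2/3}$. 3. $G_{\rm hist}(n)\preceq n^{1/3}$, and for every $A\ge0$, if $G_{\rm hist}(n)\preceq_A n^{1/3}$ then $G_{\rm sw}(n)\preceq_A n^{1/3}$; that is, the switch distribution attains the same multiplicative constant as the estimator that predicts $X_i$ by the histogram estimator with $\lceil i^{1/3}\rceil$ bins. -/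

import Mathlib

open MeasureTheory Filter Asymptotics
open scoped ENNReal NNReal unitInterval

noncomputable section

namespace SwitchHist

/-- A sequential family of conditional densities (w.r.t. Lebesgue measure) on `[0,1]`:
`p n x y` is the density, at the next outcome `y`, given the `n` past outcomes `x`. -/
abbrev CondDensity : Type := (n : ℕ) → (Fin n → I) → I → ℝ≥0∞

/-- The family is a prediction strategy: for all past data it is a probability density for the
next outcome, and it depends measurably on the data. -/
structure IsStrategy (p : CondDensity) : Prop where
  measurable : ∀ n, Measurable (Function.uncurry (p n))
  lintegral_eq_one : ∀ n x, ∫⁻ y, p n x y = 1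

/-- The joint density `p(x₁,…,xₙ) = p(x₁) p(x₂ ∣ x₁) ⋯ p(xₙ ∣ xⁿ⁻¹)`. -/
def jointDensity (p : CondDensity) (n : ℕ) (x : Fin n → I) : ℝ≥0∞ :=
  ∏ i : Fin n, p i (fun j : Fin i => x (Fin.castLE i.is_lt.le j)) (x i)

/-! ### Kullback–Leibler risk -/

/-- The KL risk of `p` when predicting outcome number `n + 1` from the first `n`, the outcomes being
i.i.d. with law `P`; this is `r_{n+1}(P, p)`. -/
def klRisk (P : Measure I) (p : CondDensity) (n : ℕ) : ℝ≥0∞ :=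
  ∫⁻ x : Fin n → I, InformationTheory.klDiv P (volume.withDensity (p n x))
    ∂(Measure.pi fun _ => P)

/-- The cumulative risk `∑_{i=1}^n r_i(P, p)`. -/
def cumRisk (P : Measure I) (p : CondDensity) (n : ℕ) : ℝ≥0∞ :=
  ∑ i ∈ Finset.range n, klRisk P p i

/-- The worst-case cumulative risk of `p` over a class `M` of laws. -/
def worstCumRisk (M : Set (Measure I)) (p : CondDensity) (n : ℕ) : ℝ≥0∞ :=
  ⨆ P ∈ M, cumRisk P p n

/-- The minimax cumulative risk over a class `M`: the infimum, over all prediction strategies, of the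
worst-case cumulative risk. -/
def minimaxCumRisk (M : Set (Measure I)) (n : ℕ) : ℝ≥0∞ :=
  ⨅ (p : CondDensity) (_ : IsStrategy p), worstCumRisk M p n

/-- The laws on `[0,1]` having a density with values in `[c₀, c₁]` that is differentiable on `[0,1]`
(one-sidedly at the end points) with derivative bounded by `c₂` in absolute value. -/
def smoothClass (c₀ c₁ c₂ : ℝ) : Set (Measure I) :=
  {P | IsProbabilityMeasure P ∧ ∃ f : ℝ → ℝ,
    P = volume.withDensity (fun x : I => ENNReal.ofReal (f x)) ∧
    ∀ x ∈ Set.Icc (0 : ℝ) 1, c₀ ≤ f x ∧ f x ≤ c₁ ∧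
      DifferentiableWithinAt ℝ f (Set.Icc 0 1) x ∧ |derivWithin f (Set.Icc 0 1) x| ≤ c₂}

/-! ### Asymptotic ordering -/

/-- `g ≼_c h`: for all `ε > 0`, eventually `g n ≤ (1 + ε) c h n`. -/
def AsympLEWith (c : ℝ≥0) (g h : ℕ → ℝ≥0∞) : Prop :=
  ∀ ε : ℝ≥0, 0 < ε → ∃ n₀ : ℕ, ∀ n ≥ n₀, g n ≤ (1 + ε) * c * h n

/-- `g ≼ h`: `g ≼_c h` for some `c > 0`. -/
def AsympLE (g h : ℕ → ℝ≥0∞) : Prop := ∃ c : ℝ≥0, 0 < c ∧ AsympLEWith c g h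

/-- `g ≍ h`. -/
def AsympEq (g h : ℕ → ℝ≥0∞) : Prop := AsympLE g h ∧ AsympLE h g

/-- The function `n ↦ n^{1/3}`. -/
def cubeRoot (n : ℕ) : ℝ≥0∞ := ENNReal.ofReal ((n : ℝ) ^ (1 / 3 : ℝ))

/-! ### Histogram estimators -/

/-- The number, in `{1, …, k}`, of the bin of `x`, the bins being
`[0, 1/k], (1/k, 2/k], …, ((k-1)/k, 1]`. -/
def bin (k : ℕ) (x : I) : ℕ := max 1 ⌈(k : ℝ) * (x : ℝ)⌉₊

/-- The number of outcomes among `x` that fall into the same one of `k` bins as `y`. -/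
def binCount (k : ℕ) {n : ℕ} (x : Fin n → I) (y : I) : ℕ :=
  (Finset.univ.filter fun i => bin k (x i) = bin k y).card

/-- The histogram estimator with `k ≥ 1` equal-width bins and Laplace smoothing. -/
def histogram (k : ℕ) : CondDensity := fun n x y =>
  ((binCount k x y : ℝ≥0∞) + 1) / ((n : ℝ≥0∞) + k) * k

/-- The estimator that predicts outcome number `i` (from the first `i - 1`) by the histogram
estimator with `⌈i^{1/3}⌉` bins. -/
def cubeRootHistogram : CondDensity := fun n =>
  histogram ⌈((n : ℝ) + 1) ^ (1 / 3 : ℝ)⌉₊ n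

/-! ### The switch distribution -/

/-- A switching parameter `((t₁,k₁), …, (tₘ,kₘ))` with `0 = t₁ < ⋯ < tₘ`, where `m = j + 1 ≥ 1`;
entries are indexed from `0`. -/
structure SwitchParam where
  j : ℕ
  t : Fin (j + 1) → ℕ
  k : Fin (j + 1) → ℕ+
  t_zero : t 0 = 0
  t_strictMono : StrictMono t

namespace SwitchParam

theorem t_succ_pos (s : SwitchParam) (i : Fin s.j) : 0 < s.t i.succ :=
  s.t_zero ▸ s.t_strictMono i.succ_pos

theorem active_nonempty (s : SwitchParam) (n : ℕ) :
    (Finset.univ.filter fun i => s.t i ≤ n).Nonempty :=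
  ⟨0, by simp [s.t_zero]⟩

/-- The index of the strategy that `s` uses after `n` outcomes: `kᵢ` for the last `i` such that
`tᵢ ≤ n`. -/
def active (s : SwitchParam) (n : ℕ) : ℕ+ :=
  s.k ((Finset.univ.filter fun i => s.t i ≤ n).max' (s.active_nonempty n))

/-- The strategy that switches between `p₁, p₂, …` as prescribed by `s`. -/
def strategy (s : SwitchParam) (p : ℕ+ → CondDensity) : CondDensity := fun n =>
  p (s.active n) n

end SwitchParam

/-- The joint density `∑_s q_s(xⁿ) π(s)` of the switch distribution with prior `π`. -/
def switchJoint (π : SwitchParam → ℝ≥0∞) (p : ℕ+ → CondDensity) (n : ℕ) (x : Fin n → I) : ℝ≥0∞ :=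
  ∑' s : SwitchParam, jointDensity (s.strategy p) n x * π s

/-- The predictive density `p_sw(xⁿ⁺¹) / p_sw(xⁿ)` of the switch distribution. -/
def switchDensity (π : SwitchParam → ℝ≥0∞) (p : ℕ+ → CondDensity) : CondDensity := fun n x y =>
  switchJoint π p (n + 1) (Fin.snoc x y) / switchJoint π p n x

/-- The conditional probability `π(t ∣ t > u)`. -/
def condTail (π : PMF ℕ+) (t : ℕ+) (u : ℕ) : ℝ≥0∞ :=
  (if u < t then π t else 0) / ∑' v : ℕ+, if u < v then π v else 0

/-- The prior
`π(s) = π_m(m) π_k(k₁) ∏_{i=2}^m π_t(tᵢ ∣ tᵢ > tᵢ₋₁) π_k(kᵢ)` on switching parameters. -/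
def switchPrior (πm πk πt : PMF ℕ+) (s : SwitchParam) : ℝ≥0∞ :=
  πm s.j.succPNat * πk (s.k 0) *
    ∏ i : Fin s.j,
      (condTail πt ⟨s.t i.succ, s.t_succ_pos i⟩ (s.t i.castSucc) * πk (s.k i.succ))

end SwitchHist

end

open SwitchHist

/-!
# The switch distribution attains the minimax rate for histogram density estimation

*Oracle inequality.* All predictive densities after `n` outcomes, of histograms with any number of
bins and of their mixtures, lie between `1 / (n + 1)` and `n + 1`. So the cumulative risk is the
expected excess log-loss of the joint density (`IsBoundedStrategy.sum_realRisk_eq`), and since the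
joint density of the switch distribution is at least `π(s)` times that of the switching strategy
`s`, its cumulative risk exceeds that of `s` by at most `log (1 / π(s))`
(`sum_realRisk_switchDensity_le`). The parameter `s` may depend on the law and on the horizon.

*The same constant as `⌈n^{1/3}⌉` bins.* Imitating `⌈n^{1/3}⌉` bins exactly takes `n^{1/3}` switches
at a price of order `log n` each, which is too much. Instead, after a first segment with a fixed
number of bins, time is cut into `o(n^{1/3} / log n)` blocks, and on each block one of the numbers
of bins occurring there is kept. The risk of a histogram with `k` bins changes by only `O(k / n²)`
from one outcome to the next (`HasBoundedDensity.abs_realRisk_succ_sub_le`), hence hardly at all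
within a block, so the average over these constant choices is nearly the loss of the varying
choice, for every single law; the best of them does no worse (`exists_constant_choice`). No
comparison of the approximation errors of different numbers of bins is needed. The total extra loss
is `o(n^{1/3})` (`worstCumRisk_switch_le`).

*The upper bound.* The risk of a histogram splits into an approximation error `O(1 / k²)` and an
estimation error of at most `k / n` (`HasLipDensity.realRisk_histogram_le`), and summing over `n`
with `k = ⌈n^{1/3}⌉` gives `O(n^{1/3})`. Both estimates of the risk rest on the size-bias identity
of the binomial distribution, `binomMean_mul_self`.

*The lower bound.* This is Assouad's lemma (`le_sum_klRisk`) for perturbations of the uniform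
density by `± (a / m) bump` on each of `m = ⌈n^{1/3}⌉` cells. The Kullback–Leibler divergence is at
least the squared Hellinger distance, which is a sum over cells, and `n ≤ m³` outcomes do not reveal
the sign on a given cell (`half_le_lintegral_min`); so each prediction costs at least a constant
times `1 / m²`.
-/

noncomputable section

namespace SwitchHist

/-! ### Bins and the histogram estimator -/

theorem measurable_bin (k : ℕ) : Measurable (bin k) := by
  unfold bin
  have h : Measurable fun x : I => ⌈(k : ℝ) * (x : ℝ)⌉₊ :=
    Nat.measurable_ceil.comp (measurable_const.mul measurable_subtype_coe)
  exact measurable_const.max h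

theorem bin_le {k : ℕ} (hk : 1 ≤ k) (x : I) : bin k x ≤ k := by
  refine max_le hk (Nat.ceil_le.2 ?_)
  exact mul_le_of_le_one_right (Nat.cast_nonneg _) x.2.2

theorem mul_le_bin (k : ℕ) (x : I) : (k : ℝ) * x ≤ bin k x :=
  (Nat.le_ceil _).trans (by exact_mod_cast le_max_right _ _)

theorem bin_sub_one_le_mul (k : ℕ) (x : I) : (bin k x : ℝ) - 1 ≤ (k : ℝ) * x := by
  have h0 : (0 : ℝ) ≤ (k : ℝ) * x := mul_nonneg (Nat.cast_nonneg _) x.2.1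
  have := Nat.ceil_lt_add_one h0
  rw [bin, Nat.cast_max]
  rcases max_cases ((1 : ℕ) : ℝ) ((⌈(k : ℝ) * (x : ℝ)⌉₊ : ℕ) : ℝ) with h | h <;> rw [h.1]
  · simpa using h0
  · linarith

/-- Points of the same bin are at distance at most the bin width. -/
theorem abs_sub_le_of_bin_eq {k : ℕ} (hk : 1 ≤ k) {x y : I} (h : bin k x = bin k y) :
    |(x : ℝ) - y| ≤ 1 / k := by
  have hk' : (0 : ℝ) < k := by exact_mod_cast hk
  have h1 := mul_le_bin k x
  have h2 := mul_le_bin k y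
  have h3 := bin_sub_one_le_mul k x
  have h4 := bin_sub_one_le_mul k y
  rw [h] at h1 h3
  rw [abs_le, le_div_iff₀ hk', neg_le, neg_sub, le_div_iff₀ hk']
  constructor <;> nlinarith

theorem measurableSet_bin_eq (k : ℕ) (x : I) : MeasurableSet {y : I | bin k y = bin k x} :=
  measurable_bin k (measurableSet_singleton _)

theorem measurableSet_bin_eq_bin (k : ℕ) : MeasurableSet {p : I × I | bin k p.1 = bin k p.2} :=
  measurableSet_eq_fun ((measurable_bin k).comp measurable_fst)
    ((measurable_bin k).comp measurable_snd)

theorem volume_bin_eq {k : ℕ} (hk : 1 ≤ k) (x : I) :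
    volume {y : I | bin k y = bin k x} = ENNReal.ofReal (1 / k) := by
  have hk' : (0 : ℝ) < k := by exact_mod_cast hk
  have hb1 : 1 ≤ bin k x := le_max_left _ _
  have hb1' : (1 : ℝ) ≤ bin k x := by exact_mod_cast hb1
  have hbk : (bin k x : ℝ) ≤ k := by exact_mod_cast bin_le hk x
  let p : I := ⟨((bin k x : ℝ) - 1) / k, div_nonneg (by linarith) hk'.le,
    (div_le_one hk').2 (by linarith)⟩
  let q : I := ⟨(bin k x : ℝ) / k, div_nonneg (by linarith) hk'.le, (div_le_one hk').2 hbk⟩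
  have hpq : (q : ℝ) - p = 1 / k := by simp only [p, q]; ring
  have hsub : {y : I | bin k y = bin k x} ⊆ Set.Icc p q := by
    intro y hy
    have hy' : bin k y = bin k x := hy
    have h2 := mul_le_bin k y
    have h4 := bin_sub_one_le_mul k y
    rw [hy'] at h2 h4
    constructor
    · change ((bin k x : ℝ) - 1) / k ≤ y
      rw [div_le_iff₀ hk']; linarith
    · change (y : ℝ) ≤ (bin k x : ℝ) / k
      rw [le_div_iff₀ hk']; linarith
  have hsup : Set.Ioc p q ⊆ {y : I | bin k y = bin k x} := by
    intro y hy
    have h1 : ((bin k x : ℝ) - 1) / k < y := hy.1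
    have h2 : (y : ℝ) ≤ (bin k x : ℝ) / k := hy.2
    rw [div_lt_iff₀ hk'] at h1
    rw [le_div_iff₀ hk'] at h2
    have hc : ⌈(k : ℝ) * (y : ℝ)⌉₊ = bin k x := by
      rw [Nat.ceil_eq_iff (by omega)]
      push_cast [hb1]
      constructor <;> linarith
    change max 1 ⌈(k : ℝ) * (y : ℝ)⌉₊ = bin k x
    rw [hc]; exact max_eq_right hb1
  apply le_antisymm
  · refine (measure_mono hsub).trans_eq ?_
    rw [unitInterval.volume_Icc, hpq]
  · refine le_trans (le_of_eq ?_) (measure_mono hsup)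
    rw [unitInterval.volume_Ioc, hpq]

theorem binCount_le (k : ℕ) {n : ℕ} (x : Fin n → I) (y : I) : binCount k x y ≤ n := by
  simpa [binCount] using Finset.card_filter_le (Finset.univ : Finset (Fin n)) _

theorem binCount_eq_sum (k : ℕ) {n : ℕ} (x : Fin n → I) (y : I) :
    binCount k x y = ∑ i, if bin k (x i) = bin k y then 1 else 0 := by
  simp [binCount]

theorem measurable_binCount (k n : ℕ) :
    Measurable fun p : (Fin n → I) × I => binCount k p.1 p.2 := by
  simp only [binCount_eq_sum]
  refine Finset.measurable_sum _ fun i _ => Measurable.ite ?_ measurable_const measurable_const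
  exact measurableSet_eq_fun ((measurable_bin k).comp ((measurable_pi_apply i).comp measurable_fst))
    ((measurable_bin k).comp measurable_snd)

theorem binCount_snoc (k : ℕ) {n : ℕ} (x : Fin n → I) (z y : I) :
    binCount k (Fin.snoc x z : Fin (n + 1) → I) y =
      binCount k x y + if bin k z = bin k y then 1 else 0 := by
  rw [binCount_eq_sum, binCount_eq_sum, Fin.sum_univ_castSucc]
  simp

theorem histogram_eq_ofReal {k : ℕ} (hk : 1 ≤ k) (n : ℕ) (x : Fin n → I) (y : I) :
    histogram k n x y = ENNReal.ofReal (((binCount k x y : ℝ) + 1) / (n + k) * k) := by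
  have hk' : (0 : ℝ) < k := by exact_mod_cast hk
  rw [ENNReal.ofReal_mul (by positivity), ENNReal.ofReal_div_of_pos (by positivity),
    ENNReal.ofReal_add (by positivity) (by positivity),
    ENNReal.ofReal_add (by positivity) (by positivity)]
  simp [histogram]

/-- A prediction strategy whose predictive densities after `n` outcomes lie between `1 / (n + 1)`
and `n + 1`; the histogram estimators and their mixtures are of this kind, whatever the numbers of
bins. -/
structure IsBoundedStrategy (p : CondDensity) : Prop extends IsStrategy p where
  lower : ∀ (n : ℕ) x y, ENNReal.ofReal (1 / ((n : ℝ) + 1)) ≤ p n x y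
  upper : ∀ (n : ℕ) x y, p n x y ≤ ENNReal.ofReal ((n : ℝ) + 1)

theorem measurable_histogram {k : ℕ} (hk : 1 ≤ k) (n : ℕ) :
    Measurable (Function.uncurry (histogram k n)) := by
  have h : Function.uncurry (histogram k n) = fun p : (Fin n → I) × I =>
      ENNReal.ofReal (((binCount k p.1 p.2 : ℝ) + 1) / (n + k) * k) := by
    ext p; exact histogram_eq_ofReal hk n p.1 p.2
  rw [h]
  have : Measurable fun m : ℕ => ENNReal.ofReal (((m : ℝ) + 1) / (n + k) * k) :=
    measurable_from_nat
  exact this.comp (measurable_binCount k n)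

theorem lintegral_histogram {k : ℕ} (hk : 1 ≤ k) (n : ℕ) (x : Fin n → I) :
    ∫⁻ y, histogram k n x y = 1 := by
  have hk0 : (k : ℝ≥0∞) ≠ 0 := by exact_mod_cast (by omega : k ≠ 0)
  have hkt : (k : ℝ≥0∞) ≠ ∞ := ENNReal.natCast_ne_top k
  have hm : ∀ i : Fin n, Measurable fun y : I =>
      if bin k (x i) = bin k y then (1 : ℝ≥0∞) else 0 := fun i =>
    Measurable.ite (measurableSet_eq_fun measurable_const (measurable_bin k)) measurable_const
      measurable_const
  have hvol : ∀ i : Fin n, ∫⁻ y : I, (if bin k (x i) = bin k y then (1 : ℝ≥0∞) else 0) =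
      (k : ℝ≥0∞)⁻¹ := by
    intro i
    have : (fun y : I => if bin k (x i) = bin k y then (1 : ℝ≥0∞) else 0) =
        {y : I | bin k y = bin k (x i)}.indicator 1 := by
      ext y; simp [Set.indicator, eq_comm]
    rw [this, lintegral_indicator_one (measurableSet_bin_eq k (x i)), volume_bin_eq hk,
      one_div, ENNReal.ofReal_inv_of_pos (by exact_mod_cast hk), ENNReal.ofReal_natCast]
  have h1 : ∀ y, histogram k n x y =
      (∑ i, (if bin k (x i) = bin k y then (1 : ℝ≥0∞) else 0) + 1) *
        (((n : ℝ≥0∞) + k)⁻¹ * k) := by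
    intro y
    simp [histogram, binCount_eq_sum, div_eq_mul_inv, mul_assoc]
  have hS : Measurable fun y : I =>
      ∑ i, (if bin k (x i) = bin k y then (1 : ℝ≥0∞) else 0) + 1 :=
    (Finset.measurable_fun_sum _ fun i _ => hm i).add measurable_const
  simp_rw [h1]
  rw [lintegral_mul_const _ hS, lintegral_add_right _ measurable_const, lintegral_finsetSum _ fun i _ => hm i]
  simp only [hvol, Finset.sum_const, Finset.card_univ, Fintype.card_fin, nsmul_eq_mul,
    lintegral_const, measure_univ, mul_one]
  have h2 : ((n : ℝ≥0∞) * (k : ℝ≥0∞)⁻¹ + 1) * (((n : ℝ≥0∞) + k)⁻¹ * k) =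
      ((n : ℝ≥0∞) + k) * ((n : ℝ≥0∞) + k)⁻¹ := by
    calc _ = ((n : ℝ≥0∞) * ((k : ℝ≥0∞)⁻¹ * k) + k) * ((n : ℝ≥0∞) + k)⁻¹ := by ring
      _ = _ := by rw [ENNReal.inv_mul_cancel hk0 hkt, mul_one]
  rw [h2, ENNReal.mul_inv_cancel (by simp [hk0]) (by simp)]

theorem histogram_lower {k : ℕ} (hk : 1 ≤ k) (n : ℕ) (x : Fin n → I) (y : I) :
    ENNReal.ofReal (1 / (n + 1)) ≤ histogram k n x y := by
  rw [histogram_eq_ofReal hk]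
  apply ENNReal.ofReal_le_ofReal
  have hk' : (1 : ℝ) ≤ k := by exact_mod_cast hk
  have hn : (0 : ℝ) ≤ n := Nat.cast_nonneg n
  have hb : (0 : ℝ) ≤ binCount k x y := Nat.cast_nonneg _
  rw [div_mul_eq_mul_div, div_le_div_iff₀ (by positivity) (by positivity)]
  nlinarith [mul_nonneg hb (mul_nonneg (by linarith : (0 : ℝ) ≤ k) (by linarith : (0 : ℝ) ≤ n + 1)),
    mul_nonneg hn (by linarith : (0 : ℝ) ≤ k - 1)]

theorem histogram_upper {k : ℕ} (hk : 1 ≤ k) (n : ℕ) (x : Fin n → I) (y : I) :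
    histogram k n x y ≤ ENNReal.ofReal (n + 1) := by
  rw [histogram_eq_ofReal hk]
  apply ENNReal.ofReal_le_ofReal
  have hk' : (1 : ℝ) ≤ k := by exact_mod_cast hk
  have hn : (0 : ℝ) ≤ n := Nat.cast_nonneg n
  have hb : (binCount k x y : ℝ) ≤ n := by exact_mod_cast binCount_le k x y
  rw [div_mul_eq_mul_div, div_le_iff₀ (by positivity)]
  nlinarith [mul_le_mul_of_nonneg_right hb (by linarith : (0 : ℝ) ≤ k)]

theorem isBoundedStrategy_of_histogram {κ : ℕ → ℕ} (hκ : ∀ n, 1 ≤ κ n) :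
    IsBoundedStrategy fun n => histogram (κ n) n where
  measurable n := measurable_histogram (hκ n) n
  lintegral_eq_one n := lintegral_histogram (hκ n) n
  lower n := histogram_lower (hκ n) n
  upper n := histogram_upper (hκ n) n

/-! ### Kullback–Leibler risk of bounded strategies -/

/-- `P` is a probability measure on `[0,1]` whose density `f` takes values in `[c₀, c₁]`,
where `c₀ > 0`. -/
structure HasBoundedDensity (P : Measure I) (f : I → ℝ) (c₀ c₁ : ℝ) : Prop where
  prob : IsProbabilityMeasure P
  eq_withDensity : P = volume.withDensity fun x => ENNReal.ofReal (f x)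
  measurable : Measurable f
  pos : 0 < c₀
  lower : ∀ x, c₀ ≤ f x
  upper : ∀ x, f x ≤ c₁

theorem eq_withDensity_div {f : I → ℝ} (hf : Measurable f) {q : I → ℝ≥0∞}
    (hq : Measurable q) (hq0 : ∀ᵐ x, q x ≠ 0) (hqt : ∀ᵐ x, q x ≠ ∞) :
    (volume : Measure I).withDensity (fun x => ENNReal.ofReal (f x)) =
      (volume.withDensity q).withDensity fun x => ENNReal.ofReal (f x) / q x := by
  have hm : Measurable fun x => ENNReal.ofReal (f x) / q x := hf.ennreal_ofReal.div hq
  rw [← withDensity_mul _ hq hm]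
  refine withDensity_congr_ae ?_
  filter_upwards [hq0, hqt] with x h0 ht
  rw [Pi.mul_apply, ENNReal.mul_div_cancel h0 ht]

theorem isProbabilityMeasure_withDensity_of_lintegral_eq_one {q : I → ℝ≥0∞} (h : ∫⁻ x, q x = 1) :
    IsProbabilityMeasure ((volume : Measure I).withDensity q) :=
  ⟨by rw [withDensity_apply _ MeasurableSet.univ, setLIntegral_univ, h]⟩

theorem rnDeriv_withDensity_div {P : Measure I} {f : I → ℝ} {c₀ c₁ : ℝ}
    (hP : HasBoundedDensity P f c₀ c₁) {q : I → ℝ≥0∞}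
    (hq : Measurable q) (hq1 : ∫⁻ x, q x = 1) (hq0 : ∀ᵐ x, q x ≠ 0) (hqt : ∀ᵐ x, q x ≠ ∞) :
    P.rnDeriv (volume.withDensity q) =ᵐ[volume.withDensity q]
      fun x => ENNReal.ofReal (f x) / q x := by
  have := isProbabilityMeasure_withDensity_of_lintegral_eq_one hq1
  rw [hP.eq_withDensity, eq_withDensity_div hP.measurable hq hq0 hqt]
  exact Measure.rnDeriv_withDensity _ (hP.measurable.ennreal_ofReal.div hq)

theorem absolutelyContinuous_withDensity {P : Measure I} {f : I → ℝ} {c₀ c₁ : ℝ}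
    (hP : HasBoundedDensity P f c₀ c₁) {q : I → ℝ≥0∞}
    (hq : Measurable q) (hq0 : ∀ᵐ x, q x ≠ 0) (hqt : ∀ᵐ x, q x ≠ ∞) :
    P ≪ volume.withDensity q := by
  rw [hP.eq_withDensity, eq_withDensity_div hP.measurable hq hq0 hqt]
  exact withDensity_absolutelyContinuous _ _

namespace HasBoundedDensity

variable {P : Measure I} {f : I → ℝ} {c₀ c₁ : ℝ}

theorem f_pos (hP : HasBoundedDensity P f c₀ c₁) (x : I) : 0 < f x := hP.pos.trans_le (hP.lower x)

theorem abs_log_le (hP : HasBoundedDensity P f c₀ c₁) (x : I) :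
    |Real.log (f x)| ≤ |Real.log c₀| + |Real.log c₁| := by
  have h1 := Real.log_le_log hP.pos (hP.lower x)
  have h2 := Real.log_le_log (hP.f_pos x) (hP.upper x)
  rw [abs_le]
  constructor
  · linarith [neg_abs_le (Real.log c₀), abs_nonneg (Real.log c₁)]
  · linarith [le_abs_self (Real.log c₁), abs_nonneg (Real.log c₀)]

end HasBoundedDensity

theorem klDiv_withDensity_eq {P : Measure I} {f : I → ℝ} {c₀ c₁ : ℝ}
    (hP : HasBoundedDensity P f c₀ c₁) {q : I → ℝ≥0∞}
    (hq : Measurable q) (hq1 : ∫⁻ x, q x = 1) (hq0 : ∀ x, q x ≠ 0) (hqt : ∀ x, q x ≠ ∞)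
    (hint : Integrable (fun y => Real.log (f y) - Real.log (q y).toReal) P) :
    0 ≤ ∫ y, (Real.log (f y) - Real.log (q y).toReal) ∂P ∧
    InformationTheory.klDiv P (volume.withDensity q) =
      ENNReal.ofReal (∫ y, (Real.log (f y) - Real.log (q y).toReal) ∂P) := by
  have := hP.prob
  have := isProbabilityMeasure_withDensity_of_lintegral_eq_one hq1
  have hac := absolutelyContinuous_withDensity hP hq (ae_of_all _ hq0) (ae_of_all _ hqt)
  have hllr : llr P (volume.withDensity q) =ᵐ[P]
      fun y => Real.log (f y) - Real.log (q y).toReal := by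
    have h := hac.ae_le (rnDeriv_withDensity_div hP hq hq1 (ae_of_all _ hq0) (ae_of_all _ hqt))
    filter_upwards [h] with y hy
    rw [llr, hy, ENNReal.toReal_div, ENNReal.toReal_ofReal (hP.f_pos y).le, Real.log_div
      (hP.f_pos y).ne' (ENNReal.toReal_ne_zero.2 ⟨hq0 y, hqt y⟩)]
  have hi : Integrable (llr P (volume.withDensity q)) P := hint.congr hllr.symm
  constructor
  · have := InformationTheory.integral_llr_add_sub_measure_univ_nonneg hac hi
    simpa [integral_congr_ae hllr] using this
  · rw [InformationTheory.klDiv_of_ac_of_integrable hac hi, integral_congr_ae hllr]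
    simp

theorem IsStrategy.measurable_right {p : CondDensity} (hp : IsStrategy p) (n : ℕ)
    (x : Fin n → I) : Measurable (p n x) :=
  (hp.measurable n).comp measurable_prodMk_left

/-- The expected log-loss excess `E[log f(Y) - log p(Y ∣ Xⁿ)]`, a real-valued version of the
Kullback–Leibler risk for laws with a bounded density `f`. -/
def realRisk (P : Measure I) (f : I → ℝ) (p : CondDensity) (n : ℕ) : ℝ :=
  ∫ x : Fin n → I, ∫ y, (Real.log (f y) - Real.log (p n x y).toReal) ∂P ∂(Measure.pi fun _ => P)

namespace IsBoundedStrategy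

variable {p : CondDensity}

theorem ne_zero (hp : IsBoundedStrategy p) (n : ℕ) (x : Fin n → I) (y : I) : p n x y ≠ 0 := by
  have h := hp.lower n x y
  have h1 : (0 : ℝ) < 1 / ((n : ℝ) + 1) := by positivity
  exact ((ENNReal.ofReal_pos.2 h1).trans_le h).ne'

theorem ne_top (hp : IsBoundedStrategy p) (n : ℕ) (x : Fin n → I) (y : I) : p n x y ≠ ∞ :=
  ne_top_of_le_ne_top ENNReal.ofReal_ne_top (hp.upper n x y)

theorem toReal_pos (hp : IsBoundedStrategy p) (n : ℕ) (x : Fin n → I) (y : I) :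
    0 < (p n x y).toReal :=
  ENNReal.toReal_pos (hp.ne_zero n x y) (hp.ne_top n x y)

theorem abs_log_le (hp : IsBoundedStrategy p) (n : ℕ) (x : Fin n → I) (y : I) :
    |Real.log (p n x y).toReal| ≤ Real.log ((n : ℝ) + 1) := by
  have h1 : 1 / ((n : ℝ) + 1) ≤ (p n x y).toReal :=
    (ENNReal.ofReal_le_iff_le_toReal (hp.ne_top n x y)).1 (hp.lower n x y)
  have h2 : (p n x y).toReal ≤ (n : ℝ) + 1 :=
    ENNReal.toReal_le_of_le_ofReal (by positivity) (hp.upper n x y)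
  rw [abs_le]
  constructor
  · rw [← Real.log_inv, ← one_div]
    exact Real.log_le_log (by positivity) h1
  · exact Real.log_le_log (hp.toReal_pos n x y) h2

theorem measurable_log (hp : IsBoundedStrategy p) (n : ℕ) :
    Measurable fun z : (Fin n → I) × I => Real.log (p n z.1 z.2).toReal :=
  (hp.measurable n).ennreal_toReal.log

variable {P : Measure I} {f : I → ℝ} {c₀ c₁ : ℝ}

theorem abs_loss_le (hp : IsBoundedStrategy p) (hP : HasBoundedDensity P f c₀ c₁) (n : ℕ)
    (x : Fin n → I) (y : I) :
    |Real.log (f y) - Real.log (p n x y).toReal| ≤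
      |Real.log c₀| + |Real.log c₁| + Real.log ((n : ℝ) + 1) :=
  (abs_sub _ _).trans (add_le_add (hP.abs_log_le y) (hp.abs_log_le n x y))

theorem measurable_loss (hp : IsBoundedStrategy p) (hf : Measurable f) (n : ℕ) :
    Measurable fun z : (Fin n → I) × I => Real.log (f z.2) - Real.log (p n z.1 z.2).toReal :=
  (hf.log.comp measurable_snd).sub (hp.measurable_log n)

theorem integrable_loss (hp : IsBoundedStrategy p) (hP : HasBoundedDensity P f c₀ c₁) (n : ℕ) :
    Integrable (fun z : (Fin n → I) × I => Real.log (f z.2) - Real.log (p n z.1 z.2).toReal)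
      ((Measure.pi fun _ => P).prod P) := by
  have := hP.prob
  exact Integrable.of_bound (hp.measurable_loss hP.measurable n).aestronglyMeasurable _
    (ae_of_all _ fun z => hp.abs_loss_le hP n z.1 z.2)

theorem klRisk_eq (hp : IsBoundedStrategy p) (hP : HasBoundedDensity P f c₀ c₁) (n : ℕ) :
    0 ≤ realRisk P f p n ∧ klRisk P p n = ENNReal.ofReal (realRisk P f p n) := by
  have := hP.prob
  have h : ∀ x : Fin n → I, 0 ≤ ∫ y, (Real.log (f y) - Real.log (p n x y).toReal) ∂P ∧
      InformationTheory.klDiv P (volume.withDensity (p n x)) =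
      ENNReal.ofReal (∫ y, (Real.log (f y) - Real.log (p n x y).toReal) ∂P) := by
    intro x
    refine klDiv_withDensity_eq hP (hp.measurable_right n x)
      (hp.lintegral_eq_one n x) (hp.ne_zero n x) (hp.ne_top n x) ?_
    exact Integrable.of_bound
      ((hp.measurable_loss hP.measurable n).comp measurable_prodMk_left).aestronglyMeasurable _
      (ae_of_all _ fun y => hp.abs_loss_le hP n x y)
  refine ⟨integral_nonneg fun x => (h x).1, ?_⟩
  rw [klRisk, realRisk, ofReal_integral_eq_lintegral_ofReal
    (hp.integrable_loss hP n).integral_prod_left (ae_of_all _ fun x => (h x).1)]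
  exact lintegral_congr fun x => (h x).2

theorem cumRisk_eq (hp : IsBoundedStrategy p) (hP : HasBoundedDensity P f c₀ c₁) (n : ℕ) :
    cumRisk P p n = ENNReal.ofReal (∑ i ∈ Finset.range n, realRisk P f p i) := by
  rw [ENNReal.ofReal_sum_of_nonneg fun i _ => (hp.klRisk_eq hP i).1]
  exact Finset.sum_congr rfl fun i _ => (hp.klRisk_eq hP i).2

end IsBoundedStrategy

/-! ### The chain rule for the cumulative risk -/

theorem measurePreserving_snoc (P : Measure I) [IsProbabilityMeasure P] (n : ℕ) :
    MeasurePreserving (fun z : (Fin n → I) × I => (Fin.snoc z.1 z.2 : Fin (n + 1) → I))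
      ((Measure.pi fun _ => P).prod P) (Measure.pi fun _ => P) := by
  have h1 := (measurePreserving_piFinSuccAbove (fun _ : Fin (n + 1) => P) (Fin.last n)).symm
  have h2 : MeasurePreserving (Prod.swap : (Fin n → I) × I → I × (Fin n → I))
    ((Measure.pi fun _ => P).prod P) (P.prod (Measure.pi fun _ => P)) :=
    Measure.measurePreserving_swap
  have h3 := h1.comp h2
  convert h3 using 1
  ext z i
  simp [MeasurableEquiv.piFinSuccAbove, Fin.insertNthEquiv, Fin.insertNth_last']

theorem integral_pi_succ {P : Measure I} [IsProbabilityMeasure P] {n : ℕ}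
    {G : (Fin (n + 1) → I) → ℝ} (hG : Integrable G (Measure.pi fun _ => P)) :
    ∫ x, G x ∂(Measure.pi fun _ => P) =
      ∫ x : Fin n → I, ∫ y, G (Fin.snoc x y) ∂P ∂(Measure.pi fun _ => P) := by
  have h := measurePreserving_snoc P n
  have hG' := hG
  rw [← h.map_eq] at hG ⊢
  rw [integral_map h.measurable.aemeasurable hG.aestronglyMeasurable,
    integral_prod (fun z : (Fin n → I) × I => G (Fin.snoc z.1 z.2))
      ((h.integrable_comp hG'.aestronglyMeasurable).2 hG')]

theorem IsStrategy.measurable_jointDensity {p : CondDensity} (hp : IsStrategy p) (n : ℕ) :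
    Measurable (jointDensity p n) := by
  refine Finset.measurable_fun_prod _ fun i _ => ?_
  have hx : Measurable fun x : Fin n → I =>
      ((fun j : Fin i => x (Fin.castLE i.is_lt.le j)), x i) := by fun_prop
  exact (hp.measurable i).comp hx

theorem jointDensity_snoc (p : CondDensity) (n : ℕ) (x : Fin n → I) (y : I) :
    jointDensity p (n + 1) (Fin.snoc x y) = jointDensity p n x * p n x y := by
  rw [jointDensity, Fin.prod_univ_castSucc, jointDensity]
  congr 1
  · refine Finset.prod_congr rfl fun i _ => ?_
    rw [Fin.snoc_castSucc]
    congr 1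
    ext j
    have : (Fin.castLE (Fin.castSucc i).is_lt.le j : Fin (n + 1)) =
      Fin.castSucc (Fin.castLE i.is_lt.le j) := rfl
    rw [this, Fin.snoc_castSucc]
  · rw [Fin.snoc_last]
    congr 1
    ext j
    have : (Fin.castLE (Fin.last n).is_lt.le j : Fin (n + 1)) = Fin.castSucc j := rfl
    rw [this, Fin.snoc_castSucc]

namespace IsBoundedStrategy

variable {p q : CondDensity} {P : Measure I} {f : I → ℝ} {c₀ c₁ : ℝ}

theorem jointDensity_toReal_pos (hp : IsBoundedStrategy p) (n : ℕ) (x : Fin n → I) :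
    0 < (jointDensity p n x).toReal := by
  rw [jointDensity, ENNReal.toReal_prod]
  exact Finset.prod_pos fun i _ => hp.toReal_pos _ _ _

/-- The cumulative risk is the expected excess of the log-loss of the joint density. -/
theorem sum_realRisk_eq (hp : IsBoundedStrategy p) (hP : HasBoundedDensity P f c₀ c₁) (n : ℕ) :
    Integrable (fun x : Fin n → I => ∑ j, Real.log (f (x j)) -
        Real.log (jointDensity p n x).toReal) (Measure.pi fun _ => P) ∧
    ∑ i ∈ Finset.range n, realRisk P f p i =
      ∫ x : Fin n → I, (∑ j, Real.log (f (x j)) - Real.log (jointDensity p n x).toReal)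
        ∂(Measure.pi fun _ => P) := by
  have := hP.prob
  have hstep : ∀ (n : ℕ) (x : Fin n → I) (y : I),
      ∑ j, Real.log (f ((Fin.snoc x y : Fin (n + 1) → I) j)) -
        Real.log (jointDensity p (n + 1) (Fin.snoc x y)).toReal =
      (∑ j, Real.log (f (x j)) - Real.log (jointDensity p n x).toReal) +
        (Real.log (f y) - Real.log (p n x y).toReal) := by
    intro n x y
    rw [Fin.sum_univ_castSucc, jointDensity_snoc, ENNReal.toReal_mul, Real.log_mul
      (hp.jointDensity_toReal_pos n x).ne' (hp.toReal_pos n x y).ne']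
    simp only [Fin.snoc_castSucc, Fin.snoc_last]
    ring
  induction n with
  | zero => simp [jointDensity]
  | succ n ih =>
    have hA : Integrable (fun z : (Fin n → I) × I =>
        (∑ j, Real.log (f (z.1 j)) - Real.log (jointDensity p n z.1).toReal) +
          (Real.log (f z.2) - Real.log (p n z.1 z.2).toReal))
        ((Measure.pi fun _ => P).prod P) :=
      (ih.1.comp_fst P).add (hp.integrable_loss hP n)
    have hm : Measurable fun x : Fin (n + 1) → I => ∑ j, Real.log (f (x j)) -
        Real.log (jointDensity p (n + 1) x).toReal :=
      (Finset.measurable_fun_sum _ fun j _ => hP.measurable.log.comp (measurable_pi_apply j)).sub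
        (hp.measurable_jointDensity (n + 1)).ennreal_toReal.log
    have hI : Integrable (fun x : Fin (n + 1) → I => ∑ j, Real.log (f (x j)) -
        Real.log (jointDensity p (n + 1) x).toReal) (Measure.pi fun _ => P) := by
      rw [← (measurePreserving_snoc P n).integrable_comp hm.aestronglyMeasurable]
      refine hA.congr (ae_of_all _ fun z => ?_)
      exact (hstep n z.1 z.2).symm
    refine ⟨hI, ?_⟩
    rw [integral_pi_succ hI, Finset.sum_range_succ, ih.2, realRisk]
    simp_rw [hstep]
    rw [← integral_add ih.1 (hp.integrable_loss hP n).integral_prod_left]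
    refine integral_congr_ae (ae_of_all _ fun x => ?_)
    have hy : Integrable (fun y => Real.log (f y) - Real.log (p n x y).toReal) P :=
      Integrable.of_bound
        ((hp.measurable_loss hP.measurable n).comp measurable_prodMk_left).aestronglyMeasurable _
        (ae_of_all _ fun y => hp.abs_loss_le hP n x y)
    simp only
    rw [integral_add (integrable_const _) hy]
    simp

/-- If the joint density of `p` is at least `w` times that of `q`, then its cumulative risk exceeds
that of `q` by at most `log (1 / w)`. -/
theorem sum_realRisk_le (hp : IsBoundedStrategy p) (hq : IsBoundedStrategy q)
    (hP : HasBoundedDensity P f c₀ c₁) (n : ℕ) {w : ℝ} (hw : 0 < w)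
    (h : ∀ x, ENNReal.ofReal w * jointDensity q n x ≤ jointDensity p n x) :
    ∑ i ∈ Finset.range n, realRisk P f p i ≤
      ∑ i ∈ Finset.range n, realRisk P f q i + -Real.log w := by
  have := hP.prob
  obtain ⟨hpi, hpe⟩ := hp.sum_realRisk_eq hP n
  obtain ⟨hqi, hqe⟩ := hq.sum_realRisk_eq hP n
  rw [hpe, hqe]
  have hc : ∫ x : Fin n → I, (-Real.log w) ∂(Measure.pi fun _ => P) = -Real.log w := by simp
  rw [← hc, ← integral_add hqi (integrable_const _)]
  refine integral_mono hpi (hqi.add (integrable_const _)) fun x => ?_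
  have hpt : jointDensity p n x ≠ ∞ := fun h => by
    simpa [h] using hp.jointDensity_toReal_pos n x
  have h1 : w * (jointDensity q n x).toReal ≤ (jointDensity p n x).toReal := by
    have := ENNReal.toReal_mono hpt (h x)
    rwa [ENNReal.toReal_mul, ENNReal.toReal_ofReal hw.le] at this
  have h2 := Real.log_le_log (mul_pos hw (hq.jointDensity_toReal_pos n x)) h1
  rw [Real.log_mul hw.ne' (hq.jointDensity_toReal_pos n x).ne'] at h2
  simp only
  linarith

end IsBoundedStrategy

/-! ### The prior of the switch distribution -/

theorem tsum_condTail_le_one (π : PMF ℕ+) (u : ℕ) : ∑' t, condTail π t u ≤ 1 := by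
  simp only [condTail, div_eq_mul_inv]
  rw [ENNReal.tsum_mul_right, ← div_eq_mul_inv]
  exact ENNReal.div_self_le_one

theorem le_condTail (π : PMF ℕ+) {t : ℕ+} {u : ℕ} (h : u < t) : π t ≤ condTail π t u := by
  rw [condTail, if_pos h]
  have hle : ∑' v : ℕ+, (if u < v then π v else 0) ≤ 1 := by
    rw [← π.tsum_coe]
    exact ENNReal.tsum_le_tsum fun v => by split_ifs <;> simp
  simpa using ENNReal.div_le_div_left hle (π t)

/-- The path weights of a sub-Markov kernel whose transitions depend on the previous state `b` only
through `g b` sum to at most one. -/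
theorem tsum_prod_kernel_le_one {α β : Type*} (K : β → α → ℝ≥0∞) (g : α → β)
    (hK : ∀ u, ∑' a, K u a ≤ 1) (j : ℕ) (u : β) :
    ∑' b : Fin j → α, ∏ i, K ((Fin.cons u (fun i => g (b i)) : Fin (j + 1) → β) i.castSucc) (b i)
      ≤ 1 := by
  induction j generalizing u with
  | zero =>
    rw [tsum_fintype]
    simp
  | succ j ih =>
    rw [← (Fin.consEquiv fun _ : Fin (j + 1) => α).tsum_eq, ENNReal.tsum_prod']
    refine le_trans (ENNReal.tsum_le_tsum fun a => ?_) (hK u)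
    have : ∀ b : Fin j → α,
        ∏ i, K ((Fin.cons u (fun i => g ((Fin.consEquiv fun _ : Fin (j + 1) => α) (a, b) i)) :
          Fin (j + 1 + 1) → β) i.castSucc) ((Fin.consEquiv fun _ : Fin (j + 1) => α) (a, b) i) =
        K u a * ∏ i, K ((Fin.cons (g a) (fun i => g (b i)) : Fin (j + 1) → β) i.castSucc)
          (b i) := by
      intro b
      rw [Fin.prod_univ_succ]
      congr 1
      refine Finset.prod_congr rfl fun i _ => ?_
      rw [← Fin.succ_castSucc, Fin.cons_succ]
      congr 1
      refine Fin.cases ?_ (fun l => ?_) i.castSucc <;> simp [Fin.consEquiv]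
    simp_rw [this]
    rw [ENNReal.tsum_mul_left]
    exact mul_le_of_le_one_right' (ih (g a))

namespace SwitchParam

/-- The data of a switching parameter without the constraint on the switching times. -/
def toPath (s : SwitchParam) : Σ j : ℕ, ℕ+ × (Fin j → ℕ+ × ℕ+) :=
  ⟨s.j, s.k 0, fun i => (⟨s.t i.succ, s.t_succ_pos i⟩, s.k i.succ)⟩

theorem toPath_injective : Function.Injective toPath := by
  rintro ⟨j, t, k, ht, hm⟩ ⟨j', t', k', ht', hm'⟩ h
  simp only [toPath, Sigma.mk.injEq] at h
  obtain ⟨rfl, h⟩ := h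
  have h := eq_of_heq h
  simp only [Prod.mk.injEq] at h
  obtain ⟨h0, h⟩ := h
  have h1 : t = t' := by
    funext i
    refine Fin.cases (by rw [ht, ht']) (fun l => ?_) i
    exact congrArg (fun a : ℕ+ × ℕ+ => (a.1 : ℕ)) (congrFun h l)
  have h2 : k = k' := by
    funext i
    refine Fin.cases h0 (fun l => ?_) i
    exact congrArg Prod.snd (congrFun h l)
  subst h1 h2
  rfl

instance : Countable SwitchParam := toPath_injective.countable

end SwitchParam

theorem tsum_switchPrior_le_one (πm πk πt : PMF ℕ+) :
    ∑' s, switchPrior πm πk πt s ≤ 1 := by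
  let K : ℕ → ℕ+ × ℕ+ → ℝ≥0∞ := fun u a => condTail πt a.1 u * πk a.2
  have hK : ∀ u, ∑' a, K u a ≤ 1 := by
    intro u
    rw [ENNReal.tsum_prod']
    simp only [K, ENNReal.tsum_mul_left, πk.tsum_coe, mul_one]
    exact tsum_condTail_le_one πt u
  let F : (Σ j : ℕ, ℕ+ × (Fin j → ℕ+ × ℕ+)) → ℝ≥0∞ := fun w =>
    πm w.1.succPNat * πk w.2.1 *
      ∏ i, K ((Fin.cons 0 (fun i => ((w.2.2 i).1 : ℕ)) : Fin (w.1 + 1) → ℕ) i.castSucc) (w.2.2 i)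
  have hF : ∀ s, switchPrior πm πk πt s = F s.toPath := by
    intro s
    simp only [switchPrior, F, SwitchParam.toPath, K]
    congr 1
    refine Finset.prod_congr rfl fun i _ => ?_
    have : s.t i.castSucc =
        (Fin.cons 0 (fun i => s.t i.succ) : Fin (s.j + 1) → ℕ) i.castSucc := by
      refine Fin.cases ?_ (fun l => ?_) i.castSucc
      · simp [s.t_zero]
      · simp
    rw [this]
    rfl
  simp_rw [hF]
  refine (ENNReal.tsum_comp_le_tsum_of_injective SwitchParam.toPath_injective F).trans ?_
  rw [ENNReal.tsum_sigma']
  have h1 : ∀ j : ℕ, ∑' w : ℕ+ × (Fin j → ℕ+ × ℕ+), F ⟨j, w⟩ ≤ πm j.succPNat := by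
    intro j
    rw [ENNReal.tsum_prod']
    simp only [F]
    simp_rw [ENNReal.tsum_mul_left]
    calc _ ≤ ∑' k : ℕ+, πm j.succPNat * πk k := ENNReal.tsum_le_tsum fun k =>
          mul_le_of_le_one_right' (tsum_prod_kernel_le_one K (fun a => (a.1 : ℕ)) hK j 0)
      _ = _ := by rw [ENNReal.tsum_mul_left, πk.tsum_coe, mul_one]
  calc _ ≤ ∑' j : ℕ, πm j.succPNat := ENNReal.tsum_le_tsum h1
    _ ≤ ∑' m, πm m := ENNReal.tsum_comp_le_tsum_of_injective Nat.succPNat_injective _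
    _ = 1 := πm.tsum_coe

/-! ### Mixtures of switching strategies -/

theorem isBoundedStrategy_switchParam (s : SwitchParam) :
    IsBoundedStrategy (s.strategy fun k => histogram k) :=
  isBoundedStrategy_of_histogram (κ := fun n => s.active n) fun n => (s.active n).pos

section Mixture

variable {π : SwitchParam → ℝ≥0∞}

theorem switchJoint_snoc (n : ℕ) (x : Fin n → I) (y : I) :
    switchJoint π (fun k => histogram k) (n + 1) (Fin.snoc x y) =
      ∑' s : SwitchParam, jointDensity (s.strategy fun k => histogram k) n x * π s *
        s.strategy (fun k => histogram k) n x y := by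
  simp only [switchJoint, jointDensity_snoc]
  exact tsum_congr fun s => by ring

theorem le_switchJoint_snoc (n : ℕ) (x : Fin n → I) (y : I) :
    ENNReal.ofReal (1 / ((n : ℝ) + 1)) * switchJoint π (fun k => histogram k) n x ≤
      switchJoint π (fun k => histogram k) (n + 1) (Fin.snoc x y) := by
  rw [switchJoint_snoc, switchJoint, mul_comm, ← ENNReal.tsum_mul_right]
  exact ENNReal.tsum_le_tsum fun s =>
    mul_le_mul_right ((isBoundedStrategy_switchParam s).lower n x y) _

theorem switchJoint_snoc_le (n : ℕ) (x : Fin n → I) (y : I) :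
    switchJoint π (fun k => histogram k) (n + 1) (Fin.snoc x y) ≤
      ENNReal.ofReal ((n : ℝ) + 1) * switchJoint π (fun k => histogram k) n x := by
  rw [switchJoint_snoc, switchJoint, mul_comm (ENNReal.ofReal _), ← ENNReal.tsum_mul_right]
  exact ENNReal.tsum_le_tsum fun s =>
    mul_le_mul_right ((isBoundedStrategy_switchParam s).upper n x y) _

theorem switchJoint_ne (h1 : ∑' s, π s ≤ 1) (h0 : ∑' s, π s ≠ 0) (n : ℕ) (x : Fin n → I) :
    switchJoint π (fun k => histogram k) n x ≠ 0 ∧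
      switchJoint π (fun k => histogram k) n x ≠ ∞ := by
  induction n with
  | zero =>
    simp only [switchJoint, jointDensity, Finset.univ_eq_empty, Finset.prod_empty, one_mul]
    exact ⟨h0, ne_top_of_le_ne_top ENNReal.one_ne_top h1⟩
  | succ n ih =>
    rw [← Fin.snoc_init_self x]
    obtain ⟨ih0, iht⟩ := ih (Fin.init x)
    constructor
    · refine ((pos_iff_ne_zero.2 ?_).trans_le (le_switchJoint_snoc n _ _)).ne'
      exact mul_ne_zero (ENNReal.ofReal_pos.2 (by positivity)).ne' ih0
    · exact ne_top_of_le_ne_top (ENNReal.mul_ne_top ENNReal.ofReal_ne_top iht)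
        (switchJoint_snoc_le n _ _)

theorem measurable_switchJoint (n : ℕ) :
    Measurable (switchJoint π (fun k => histogram k) n) :=
  Measurable.tsum fun s =>
    ((isBoundedStrategy_switchParam s).measurable_jointDensity n).mul_const _

theorem measurable_switchDensity (n : ℕ) :
    Measurable (Function.uncurry (switchDensity π (fun k => histogram k) n)) := by
  have hs : Measurable fun z : (Fin n → I) × I => (Fin.snoc z.1 z.2 : Fin (n + 1) → I) :=
    (measurePreserving_snoc volume n).measurable
  have h1 := (measurable_switchJoint (π := π) (n + 1)).comp hs
  have h2 : Measurable fun z : (Fin n → I) × I => switchJoint π (fun k => histogram k) n z.1 :=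
    (measurable_switchJoint (π := π) n).comp measurable_fst
  have h := h1.div h2
  exact h

theorem lintegral_switchJoint_snoc (n : ℕ) (x : Fin n → I) :
    ∫⁻ y, switchJoint π (fun k => histogram k) (n + 1) (Fin.snoc x y) =
      switchJoint π (fun k => histogram k) n x := by
  have hm : ∀ s : SwitchParam, Measurable (s.strategy (fun k => histogram k) n x) := fun s =>
    (isBoundedStrategy_switchParam s).measurable_right n x
  simp only [switchJoint_snoc]
  rw [lintegral_tsum fun s => ((hm s).const_mul _).aemeasurable, switchJoint]
  refine tsum_congr fun s => ?_
  rw [lintegral_const_mul _ (hm s), (isBoundedStrategy_switchParam s).lintegral_eq_one, mul_one]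

theorem lintegral_switchDensity (h1 : ∑' s, π s ≤ 1) (h0 : ∑' s, π s ≠ 0) (n : ℕ)
    (x : Fin n → I) : ∫⁻ y, switchDensity π (fun k => histogram k) n x y = 1 := by
  obtain ⟨hj0, hjt⟩ := switchJoint_ne h1 h0 n x
  simp only [switchDensity, div_eq_mul_inv]
  rw [lintegral_mul_const' _ _ (ENNReal.inv_ne_top.2 hj0), lintegral_switchJoint_snoc,
    ENNReal.mul_inv_cancel hj0 hjt]

theorem isBoundedStrategy_switchDensity (h1 : ∑' s, π s ≤ 1) (h0 : ∑' s, π s ≠ 0) :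
    IsBoundedStrategy (switchDensity π fun k => histogram k) where
  measurable n := measurable_switchDensity n
  lintegral_eq_one n x := lintegral_switchDensity h1 h0 n x
  lower n x y := by
    obtain ⟨hj0, hjt⟩ := switchJoint_ne h1 h0 n x
    rw [switchDensity, ENNReal.le_div_iff_mul_le (Or.inl hj0) (Or.inl hjt)]
    exact le_switchJoint_snoc n x y
  upper n x y := by
    obtain ⟨hj0, hjt⟩ := switchJoint_ne h1 h0 n x
    rw [switchDensity, ENNReal.div_le_iff_le_mul (Or.inl hj0) (Or.inl hjt)]
    exact switchJoint_snoc_le n x y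

theorem switchJoint_eq (h1 : ∑' s, π s ≤ 1) (h0 : ∑' s, π s ≠ 0) (n : ℕ) (x : Fin n → I) :
    switchJoint π (fun k => histogram k) n x =
      (∑' s, π s) * jointDensity (switchDensity π fun k => histogram k) n x := by
  induction n with
  | zero => simp [switchJoint, jointDensity]
  | succ n ih =>
    rw [← Fin.snoc_init_self x, jointDensity_snoc, ← mul_assoc, ← ih, switchDensity]
    obtain ⟨hj0, hjt⟩ := switchJoint_ne h1 h0 n (Fin.init x)
    rw [ENNReal.mul_div_cancel hj0 hjt]

/-- The oracle inequality for the switch distribution: up to `log (1 / π s)`, it predicts as well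
as the switching strategy `s`. -/
theorem sum_realRisk_switchDensity_le (h1 : ∑' s, π s ≤ 1) {P : Measure I} {f : I → ℝ}
    {c₀ c₁ : ℝ} (hP : HasBoundedDensity P f c₀ c₁) (n : ℕ) (s : SwitchParam) (hs : π s ≠ 0) :
    ∑ i ∈ Finset.range n, realRisk P f (switchDensity π fun k => histogram k) i ≤
      ∑ i ∈ Finset.range n, realRisk P f (histogram (s.active i)) i +
        -Real.log (π s).toReal := by
  have h0 : ∑' s, π s ≠ 0 := fun h => hs (ENNReal.tsum_eq_zero.1 h s)
  have hst : π s ≠ ∞ := ne_top_of_le_ne_top ENNReal.one_ne_top ((ENNReal.le_tsum s).trans h1)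
  refine (isBoundedStrategy_switchDensity h1 h0).sum_realRisk_le
    (isBoundedStrategy_switchParam s) hP n (ENNReal.toReal_pos hs hst) fun x => ?_
  rw [ENNReal.ofReal_toReal hst, mul_comm]
  calc _ ≤ switchJoint π (fun k => histogram k) n x :=
        ENNReal.le_tsum (f := fun s : SwitchParam =>
          jointDensity (s.strategy fun k => histogram k) n x * π s) s
    _ = _ := switchJoint_eq h1 h0 n x
    _ ≤ _ := mul_le_of_le_one_left' h1

end Mixture

/-! ### Binomial expectations -/

/-- The expectation `E[g N]` of a function of a binomial variable `N` with `n` trials and success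
probability `θ`, defined by conditioning on the last trial. -/
def binomMean (θ : ℝ) : ℕ → (ℕ → ℝ) → ℝ
  | 0, g => g 0
  | n + 1, g => θ * binomMean θ n (fun j => g (j + 1)) + (1 - θ) * binomMean θ n g

theorem binomMean_add (θ : ℝ) (n : ℕ) (g h : ℕ → ℝ) :
    binomMean θ n (fun j => g j + h j) = binomMean θ n g + binomMean θ n h := by
  induction n generalizing g h with
  | zero => rfl
  | succ n ih =>
    simp only [binomMean]
    rw [ih, ih g h]; ring

theorem binomMean_const_mul (θ : ℝ) (n : ℕ) (a : ℝ) (g : ℕ → ℝ) :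
    binomMean θ n (fun j => a * g j) = a * binomMean θ n g := by
  induction n generalizing g with
  | zero => rfl
  | succ n ih =>
    simp only [binomMean]
    rw [ih, ih g]; ring

theorem binomMean_const (θ : ℝ) (n : ℕ) (a : ℝ) : binomMean θ n (fun _ => a) = a := by
  induction n with
  | zero => rfl
  | succ n ih =>
    simp only [binomMean, ih]; ring

theorem binomMean_mono {θ : ℝ} (h0 : 0 ≤ θ) (h1 : θ ≤ 1) (n : ℕ) {g h : ℕ → ℝ}
    (hgh : ∀ j, g j ≤ h j) : binomMean θ n g ≤ binomMean θ n h := by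
  induction n generalizing g h with
  | zero => exact hgh 0
  | succ n ih =>
    simp only [binomMean]
    exact add_le_add (mul_le_mul_of_nonneg_left (ih fun j => hgh (j + 1)) h0)
      (mul_le_mul_of_nonneg_left (ih hgh) (by linarith))

/-- The size-bias identity of the binomial distribution. -/
theorem binomMean_mul_self (θ : ℝ) (n : ℕ) (h : ℕ → ℝ) :
    binomMean θ (n + 1) (fun j => j * h j) = (n + 1) * θ * binomMean θ n (fun j => h (j + 1)) := by
  induction n generalizing h with
  | zero => simp [binomMean]
  | succ n ih =>
    rw [binomMean, ih h]
    have h1 : (fun j : ℕ => ((j + 1 : ℕ) : ℝ) * h (j + 1)) =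
        fun j : ℕ => (j : ℝ) * h (j + 1) + h (j + 1) := by
      funext j; push_cast; ring
    rw [h1, binomMean_add, ih fun j => h (j + 1), binomMean]
    push_cast
    ring

theorem binomMean_inv_succ_le {θ : ℝ} (h0 : 0 ≤ θ) (h1 : θ ≤ 1) (n : ℕ) :
    (n + 1) * θ * binomMean θ n (fun j => 1 / ((j : ℝ) + 1)) ≤ 1 := by
  have h := binomMean_mul_self θ n fun j => 1 / (j : ℝ)
  push_cast at h
  rw [← h]
  refine (binomMean_mono h0 h1 _ fun j => ?_).trans_eq (binomMean_const θ (n + 1) 1)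
  rw [mul_one_div]
  exact div_self_le_one _

theorem binomMean_id (θ : ℝ) (n : ℕ) : binomMean θ n (fun j => (j : ℝ)) = n * θ := by
  cases n with
  | zero => simp [binomMean]
  | succ n =>
    have h := binomMean_mul_self θ n fun _ => 1
    simpa [binomMean_const] using h

theorem le_binomMean_inv_add_two {θ : ℝ} (h0 : 0 ≤ θ) (h1 : θ ≤ 1) (n : ℕ) :
    1 / (n * θ + 2) ≤ binomMean θ n (fun j => 1 / ((j : ℝ) + 2)) := by
  have hc : 0 < (n : ℝ) * θ + 2 := by positivity
  set c := (n : ℝ) * θ + 2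
  -- the tangent of the convex function `1 / u` at the mean `c` of `N + 2`
  have htan : ∀ j : ℕ, (2 / c - 2 / c ^ 2) + -(1 / c ^ 2) * (j : ℝ) ≤ 1 / ((j : ℝ) + 2) := by
    intro j
    have hj : (0 : ℝ) < (j : ℝ) + 2 := by positivity
    have : 1 / ((j : ℝ) + 2) - ((2 / c - 2 / c ^ 2) + -(1 / c ^ 2) * (j : ℝ)) =
        ((j : ℝ) + 2 - c) ^ 2 / (((j : ℝ) + 2) * c ^ 2) := by
      field_simp; ring
    have h2 : 0 ≤ ((j : ℝ) + 2 - c) ^ 2 / (((j : ℝ) + 2) * c ^ 2) := by positivity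
    linarith
  refine le_trans (le_of_eq ?_) (binomMean_mono h0 h1 n htan)
  rw [binomMean_add, binomMean_const, binomMean_const_mul, binomMean_id]
  have : (n : ℝ) * θ = c - 2 := by simp [c]
  rw [this]; field_simp; ring

/-- The expectation of `log (N + 1)` for binomial `N`. -/
def binomLog (θ : ℝ) (n : ℕ) : ℝ := binomMean θ n fun j => Real.log ((j : ℝ) + 1)

theorem binomLog_succ_sub (θ : ℝ) (n : ℕ) : binomLog θ (n + 1) - binomLog θ n =
    θ * binomMean θ n (fun j => Real.log ((j : ℝ) + 2) + -1 * Real.log ((j : ℝ) + 1)) := by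
  rw [binomMean_add, binomMean_const_mul, binomLog, binomMean, binomLog]
  have : (fun j : ℕ => Real.log (((j + 1 : ℕ) : ℝ) + 1)) = fun j : ℕ => Real.log ((j : ℝ) + 2) := by
    funext j; push_cast; ring_nf
  rw [this]; ring

theorem binomLog_succ_sub_le {θ : ℝ} (h0 : 0 ≤ θ) (h1 : θ ≤ 1) (n : ℕ) :
    binomLog θ (n + 1) - binomLog θ n ≤ 1 / ((n : ℝ) + 1) := by
  rw [binomLog_succ_sub]
  have hn : (0 : ℝ) < (n : ℝ) + 1 := by positivity
  rw [le_div_iff₀ hn]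
  refine le_trans ?_ (binomMean_inv_succ_le h0 h1 n)
  have : binomMean θ n (fun j => Real.log ((j : ℝ) + 2) + -1 * Real.log ((j : ℝ) + 1)) ≤
      binomMean θ n (fun j => 1 / ((j : ℝ) + 1)) := by
    refine binomMean_mono h0 h1 n fun j => ?_
    have hj : (0 : ℝ) < (j : ℝ) + 1 := by positivity
    have := Real.log_le_sub_one_of_pos (x := ((j : ℝ) + 2) / ((j : ℝ) + 1)) (by positivity)
    rw [Real.log_div (by positivity) hj.ne'] at this
    have h2 : ((j : ℝ) + 2) / ((j : ℝ) + 1) - 1 = 1 / ((j : ℝ) + 1) := by field_simp; ring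
    linarith
  calc _ = (n + 1) * θ * binomMean θ n
        (fun j => Real.log ((j : ℝ) + 2) + -1 * Real.log ((j : ℝ) + 1)) := by ring
    _ ≤ _ := mul_le_mul_of_nonneg_left this (by positivity)

theorem le_binomLog_succ_sub {θ : ℝ} (h0 : 0 < θ) (h1 : θ ≤ 1) {n : ℕ} (hn : 1 ≤ n) :
    1 / (n : ℝ) - 2 / (n ^ 2 * θ) ≤ binomLog θ (n + 1) - binomLog θ n := by
  rw [binomLog_succ_sub]
  have hn' : (0 : ℝ) < (n : ℝ) := by exact_mod_cast hn
  have h2 : 1 / (n * θ + 2) ≤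
      binomMean θ n (fun j => Real.log ((j : ℝ) + 2) + -1 * Real.log ((j : ℝ) + 1)) := by
    refine (le_binomMean_inv_add_two h0.le h1 n).trans (binomMean_mono h0.le h1 n fun j => ?_)
    have hj : (0 : ℝ) < (j : ℝ) + 1 := by positivity
    have := Real.log_le_sub_one_of_pos (x := ((j : ℝ) + 1) / ((j : ℝ) + 2)) (by positivity)
    rw [Real.log_div hj.ne' (by positivity)] at this
    have h2 : ((j : ℝ) + 1) / ((j : ℝ) + 2) - 1 = -(1 / ((j : ℝ) + 2)) := by field_simp; ring
    linarith
  refine le_trans ?_ (mul_le_mul_of_nonneg_left h2 h0.le)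
  have h3 : θ * (1 / (n * θ + 2)) - (1 / (n : ℝ) - 2 / (n ^ 2 * θ)) =
      4 / (n ^ 2 * θ * (n * θ + 2)) := by
    have : (n : ℝ) * θ + 2 ≠ 0 := by positivity
    field_simp; ring
  have h4 : 0 ≤ 4 / ((n : ℝ) ^ 2 * θ * (n * θ + 2)) := by positivity
  linarith

theorem le_binomLog {θ : ℝ} (h0 : 0 < θ) (h1 : θ ≤ 1) (n : ℕ) :
    Real.log ((n + 1) * θ) ≤ binomLog θ n := by
  have hc : 0 < ((n : ℝ) + 1) * θ := by positivity
  have h2 := binomMean_inv_succ_le h0.le h1 n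
  set c := ((n : ℝ) + 1) * θ
  have h3 : binomMean θ n (fun j => (Real.log c + 1) + -c * (1 / ((j : ℝ) + 1))) ≤ binomLog θ n := by
    refine binomMean_mono h0.le h1 n fun j => ?_
    have hj : (0 : ℝ) < (j : ℝ) + 1 := by positivity
    have := Real.log_le_sub_one_of_pos (x := c / ((j : ℝ) + 1)) (by positivity)
    rw [Real.log_div hc.ne' hj.ne'] at this
    rw [neg_mul, mul_one_div]
    linarith
  rw [binomMean_add, binomMean_const, binomMean_const_mul] at h3
  linarith

/-! ### The risk of a histogram estimator -/

/-- The probability of the bin of `y`. -/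
def binProb (P : Measure I) (k : ℕ) (y : I) : ℝ := P.real {z | bin k z = bin k y}

theorem binProb_nonneg (P : Measure I) (k : ℕ) (y : I) : 0 ≤ binProb P k y := measureReal_nonneg

theorem binProb_le_one (P : Measure I) [IsProbabilityMeasure P] (k : ℕ) (y : I) :
    binProb P k y ≤ 1 := measureReal_le_one

theorem measurable_binProb (P : Measure I) [IsProbabilityMeasure P] (k : ℕ) :
    Measurable (binProb P k) :=
  (measurable_measure_prodMk_right (μ := P) (measurableSet_bin_eq_bin k)).ennreal_toReal

theorem integrable_comp_binCount (P : Measure I) [IsProbabilityMeasure P] (k n : ℕ) (g : ℕ → ℝ) :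
    Integrable (fun z : (Fin n → I) × I => g (binCount k z.1 z.2))
      ((Measure.pi fun _ => P).prod P) := by
  have hm : Measurable g := measurable_from_nat
  refine Integrable.of_bound (hm.comp (measurable_binCount k n)).aestronglyMeasurable
    (∑ j ∈ Finset.range (n + 1), |g j|) (ae_of_all _ fun z => ?_)
  exact Finset.single_le_sum (f := fun j => |g j|) (fun j _ => abs_nonneg _)
    (Finset.mem_range.2 (Nat.lt_succ_of_le (binCount_le k z.1 z.2)))

theorem integrable_comp_binCount_left (P : Measure I) [IsProbabilityMeasure P] (k n : ℕ)
    (g : ℕ → ℝ) (y : I) :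
    Integrable (fun x : Fin n → I => g (binCount k x y)) (Measure.pi fun _ => P) := by
  have hm : Measurable g := measurable_from_nat
  have h0 : Measurable fun x : Fin n → I => (x, y) := measurable_prodMk_right
  have h1 := (measurable_binCount k n).comp h0
  refine Integrable.of_bound (hm.comp h1).aestronglyMeasurable
    (∑ j ∈ Finset.range (n + 1), |g j|) (ae_of_all _ fun x => ?_)
  exact Finset.single_le_sum (f := fun j => |g j|) (fun j _ => abs_nonneg _)
    (Finset.mem_range.2 (Nat.lt_succ_of_le (binCount_le k x y)))

/-- The number of outcomes in a given bin is binomially distributed. -/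
theorem integral_comp_binCount (P : Measure I) [IsProbabilityMeasure P] (k n : ℕ) (g : ℕ → ℝ)
    (y : I) : ∫ x : Fin n → I, g (binCount k x y) ∂(Measure.pi fun _ => P) =
      binomMean (binProb P k y) n g := by
  induction n generalizing g with
  | zero => simp [binCount, binomMean]
  | succ n ih =>
    rw [integral_pi_succ (integrable_comp_binCount_left P k (n + 1) g y), binomMean,
      ← ih, ← ih g, ← integral_const_mul, ← integral_const_mul, ← integral_add
        ((integrable_comp_binCount_left P k n (fun j => g (j + 1)) y).const_mul _)
        ((integrable_comp_binCount_left P k n g y).const_mul _)]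
    congr 1
    funext x
    have h : ∀ z, g (binCount k (Fin.snoc x z : Fin (n + 1) → I) y) =
        g (binCount k x y) + {z | bin k z = bin k y}.indicator
          (fun _ => g (binCount k x y + 1) - g (binCount k x y)) z := by
      intro z
      rw [binCount_snoc]
      by_cases hz : bin k z = bin k y <;> simp [hz]
    simp_rw [h]
    rw [integral_add (integrable_const _)
      ((integrable_const _).indicator (measurableSet_bin_eq k y)),
      integral_indicator (measurableSet_bin_eq k y)]
    simp only [integral_const, probReal_univ, smul_eq_mul, measureReal_restrict_apply_univ]
    rw [← binProb]
    ring

theorem integrable_binomLog (P : Measure I) [IsProbabilityMeasure P] (k n : ℕ) :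
    Integrable (fun y => binomLog (binProb P k y) n) P := by
  have h := (integrable_comp_binCount P k n fun j => Real.log ((j : ℝ) + 1)).integral_prod_right
  refine h.congr (ae_of_all _ fun y => ?_)
  exact integral_comp_binCount P k n (fun j => Real.log ((j : ℝ) + 1)) y

theorem integrable_log {P : Measure I} {f : I → ℝ} {c₀ c₁ : ℝ}
    (hP : HasBoundedDensity P f c₀ c₁) : Integrable (fun y => Real.log (f y)) P := by
  have := hP.prob
  exact Integrable.of_bound hP.measurable.log.aestronglyMeasurable _
    (ae_of_all _ fun y => hP.abs_log_le y)

theorem realRisk_histogram {P : Measure I} {f : I → ℝ} {c₀ c₁ : ℝ}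
    (hP : HasBoundedDensity P f c₀ c₁) {k : ℕ} (hk : 1 ≤ k) (n : ℕ) :
    realRisk P f (histogram k) n = ∫ y, Real.log (f y) ∂P + (Real.log (n + k) - Real.log k) -
      ∫ y, binomLog (binProb P k y) n ∂P := by
  have := hP.prob
  have hk' : (0 : ℝ) < k := by exact_mod_cast hk
  have hg := integrable_comp_binCount P k n fun j => Real.log ((j : ℝ) + 1)
  have h : ∀ (x : Fin n → I) (y : I), Real.log (f y) - Real.log (histogram k n x y).toReal =
      (Real.log (f y) + (Real.log (n + k) - Real.log k)) -
        Real.log ((binCount k x y : ℝ) + 1) := by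
    intro x y
    have hb : (0 : ℝ) < (binCount k x y : ℝ) + 1 := by positivity
    have hn : (0 : ℝ) < (n : ℝ) + k := by positivity
    rw [histogram_eq_ofReal hk, ENNReal.toReal_ofReal (by positivity),
      Real.log_mul (by positivity) hk'.ne', Real.log_div hb.ne' hn.ne']
    ring
  simp only [realRisk, h]
  have hi : Integrable (fun y => Real.log (f y) + (Real.log (n + k) - Real.log k)) P :=
    (integrable_log hP).add (integrable_const _)
  rw [integral_integral_swap (f := fun (x : Fin n → I) (y : I) =>
      (Real.log (f y) + (Real.log (n + k) - Real.log k)) - Real.log ((binCount k x y : ℝ) + 1))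
      ((hi.comp_snd _).sub hg)]
  have h2 : ∀ y, ∫ x : Fin n → I, ((Real.log (f y) + (Real.log (n + k) - Real.log k)) -
      Real.log ((binCount k x y : ℝ) + 1)) ∂(Measure.pi fun _ => P) =
      (Real.log (f y) + (Real.log (n + k) - Real.log k)) - binomLog (binProb P k y) n := by
    intro y
    rw [integral_sub (integrable_const _)
      (integrable_comp_binCount_left P k n (fun j => Real.log ((j : ℝ) + 1)) y),
      integral_comp_binCount P k n (fun j => Real.log ((j : ℝ) + 1)) y, ← binomLog]
    simp
  simp only [h2]
  rw [integral_sub hi (integrable_binomLog P k n), integral_add (integrable_log hP)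
    (integrable_const _)]
  simp

/-! ### Laws with a Lipschitz density -/

/-- `P` has a density `f` with values in `[c₀, c₁]` that is `c₂`-Lipschitz. -/
structure HasLipDensity (P : Measure I) (f : I → ℝ) (c₀ c₁ c₂ : ℝ) : Prop
    extends HasBoundedDensity P f c₀ c₁ where
  lip : ∀ x y : I, |f x - f y| ≤ c₂ * |(x : ℝ) - y|

theorem exists_hasLipDensity {P : Measure I} {c₀ c₁ c₂ : ℝ} (hc₀ : 0 < c₀)
    (hP : P ∈ smoothClass c₀ c₁ c₂) : ∃ f : I → ℝ, HasLipDensity P f c₀ c₁ c₂ := by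
  obtain ⟨hprob, f, hf, h⟩ := hP
  have hd : DifferentiableOn ℝ f (Set.Icc 0 1) := fun x hx => (h x hx).2.2.1
  refine ⟨fun x => f x, ⟨hprob, hf, ?_, hc₀, fun x => (h x x.2).1, fun x => (h x x.2).2.1⟩,
    fun x y => ?_⟩
  · exact (continuousOn_iff_continuous_domRestrict.1 hd.continuousOn).measurable
  · exact (convex_Icc (0 : ℝ) 1).norm_image_sub_le_of_norm_derivWithin_le hd
      (fun z hz => (h z hz).2.2.2) y.2 x.2

theorem nonneg_of_mem_smoothClass {P : Measure I} {c₀ c₁ c₂ : ℝ}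
    (hP : P ∈ smoothClass c₀ c₁ c₂) : 0 ≤ c₂ := by
  obtain ⟨-, f, -, h⟩ := hP
  exact (abs_nonneg _).trans (h 0 (by simp)).2.2.2

section Approximation

variable {P : Measure I} {f : I → ℝ} {c₀ c₁ c₂ : ℝ}

theorem HasBoundedDensity.integrable (hP : HasBoundedDensity P f c₀ c₁) :
    Integrable f (volume : Measure I) := by
  refine Integrable.of_bound hP.measurable.aestronglyMeasurable c₁ (ae_of_all _ fun x => ?_)
  rw [Real.norm_eq_abs, abs_of_pos (hP.f_pos x)]
  exact hP.upper x

theorem HasBoundedDensity.measureReal_eq (hP : HasBoundedDensity P f c₀ c₁) {s : Set I}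
    (hs : MeasurableSet s) : P.real s = ∫ x in s, f x := by
  rw [measureReal_def, hP.eq_withDensity, withDensity_apply _ hs,
    ← ofReal_integral_eq_lintegral_ofReal hP.integrable.integrableOn
      (ae_of_all _ fun x => (hP.f_pos x).le),
    ENNReal.toReal_ofReal (setIntegral_nonneg hs fun x _ => (hP.f_pos x).le)]

theorem HasBoundedDensity.integral_eq_one (hP : HasBoundedDensity P f c₀ c₁) :
    ∫ x, f x = 1 := by
  have := hP.prob
  rw [← setIntegral_univ, ← hP.measureReal_eq MeasurableSet.univ, probReal_univ]

theorem HasBoundedDensity.integral_eq (hP : HasBoundedDensity P f c₀ c₁) (g : I → ℝ) :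
    ∫ x, g x ∂P = ∫ x, f x * g x := by
  rw [hP.eq_withDensity, integral_withDensity_eq_integral_toReal_smul
    hP.measurable.ennreal_ofReal (ae_of_all _ fun _ => ENNReal.ofReal_lt_top)]
  refine integral_congr_ae (ae_of_all _ fun x => ?_)
  simp [ENNReal.toReal_ofReal (hP.f_pos x).le]

theorem volume_real_bin_eq {k : ℕ} (hk : 1 ≤ k) (x : I) :
    (volume : Measure I).real {y : I | bin k y = bin k x} = 1 / k := by
  rw [measureReal_def, volume_bin_eq hk, ENNReal.toReal_ofReal (by positivity)]

theorem HasBoundedDensity.le_binProb (hP : HasBoundedDensity P f c₀ c₁) {k : ℕ} (hk : 1 ≤ k)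
    (y : I) : c₀ / k ≤ binProb P k y := by
  rw [binProb, hP.measureReal_eq (measurableSet_bin_eq k y)]
  calc c₀ / k = ∫ _ in {z | bin k z = bin k y}, c₀ := by
        rw [setIntegral_const, volume_real_bin_eq hk, smul_eq_mul]; ring
    _ ≤ _ := setIntegral_mono_on (integrable_const _).integrableOn hP.integrable.integrableOn
        (measurableSet_bin_eq k y) fun x _ => hP.lower x

theorem HasBoundedDensity.binProb_pos (hP : HasBoundedDensity P f c₀ c₁) {k : ℕ} (hk : 1 ≤ k)
    (y : I) : 0 < binProb P k y :=
  (div_pos hP.pos (by exact_mod_cast hk)).trans_le (hP.le_binProb hk y)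

/-- The bin averages of a Lipschitz density approximate it up to the order of the bin width. -/
theorem HasLipDensity.abs_sub_binProb_le (hP : HasLipDensity P f c₀ c₁ c₂) (hc₂ : 0 ≤ c₂)
    {k : ℕ} (hk : 1 ≤ k) (y : I) : |f y - k * binProb P k y| ≤ c₂ / k := by
  have hk' : (0 : ℝ) < k := by exact_mod_cast hk
  have hm := measurableSet_bin_eq k y
  have h1 : f y - k * binProb P k y = k * ∫ z in {z | bin k z = bin k y}, (f y - f z) := by
    rw [integral_sub (integrable_const _) hP.integrable.integrableOn, setIntegral_const,
      volume_real_bin_eq hk, binProb, hP.measureReal_eq hm, smul_eq_mul]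
    field_simp
  have h2 : ‖∫ z in {z | bin k z = bin k y}, (f y - f z)‖ ≤
      c₂ / k * (volume : Measure I).real {z | bin k z = bin k y} := by
    refine norm_setIntegral_le_of_norm_le_const (measure_lt_top _ _) fun z hz => ?_
    refine (hP.lip y z).trans ?_
    rw [div_eq_mul_one_div]
    exact mul_le_mul_of_nonneg_left (abs_sub_le_of_bin_eq hk (Eq.symm hz)) hc₂
  rw [volume_real_bin_eq hk, Real.norm_eq_abs] at h2
  rw [h1, abs_mul, abs_of_pos hk']
  calc _ ≤ (k : ℝ) * (c₂ / k * (1 / k)) := mul_le_mul_of_nonneg_left h2 hk'.le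
    _ = _ := by field_simp

theorem integral_binProb [IsProbabilityMeasure P] {k : ℕ} (hk : 1 ≤ k) :
    ∫ y, binProb P k y = 1 / k := by
  have hS := measurableSet_bin_eq_bin k
  have h1 : ∫⁻ y : I, P {z | bin k z = bin k y} = ENNReal.ofReal (1 / k) := by
    have h2 := Measure.prod_apply (μ := P) (ν := (volume : Measure I)) hS
    have h3 := Measure.prod_apply_symm (μ := P) (ν := (volume : Measure I)) hS
    rw [h2] at h3
    refine h3.symm.trans ?_
    have : ∀ x : I, volume (Prod.mk x ⁻¹' {p : I × I | bin k p.1 = bin k p.2}) =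
        ENNReal.ofReal (1 / k) := by
      intro x
      rw [← volume_bin_eq hk x]
      congr 1
      ext y
      exact eq_comm
    simp only [this, lintegral_const, measure_univ, mul_one]
  rw [← ENNReal.toReal_ofReal (by positivity : (0 : ℝ) ≤ 1 / k), ← h1]
  exact integral_toReal (measurable_measure_prodMk_right hS).aemeasurable
    (ae_of_all _ fun _ => measure_lt_top _ _)

/-- The Kullback–Leibler divergence from the bin averages of the density is quadratic in the bin
width: the linear term vanishes since both densities have integral one. -/
theorem HasLipDensity.integral_log_sub_log_le (hP : HasLipDensity P f c₀ c₁ c₂)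
    (hc₂ : 0 ≤ c₂) {k : ℕ} (hk : 1 ≤ k) :
    Integrable (fun y => Real.log (f y) - Real.log (k * binProb P k y)) P ∧
    ∫ y, (Real.log (f y) - Real.log (k * binProb P k y)) ∂P ≤ c₂ ^ 2 / c₀ / k ^ 2 := by
  have := hP.prob
  have hk' : (0 : ℝ) < k := by exact_mod_cast hk
  set g : I → ℝ := fun y => k * binProb P k y with hg
  have hgm : Measurable g := (measurable_binProb P k).const_mul _
  have hgl : ∀ y, c₀ ≤ g y := fun y => by
    have := hP.le_binProb hk y
    rw [div_le_iff₀ hk'] at this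
    simp only [hg]; linarith
  have hgp : ∀ y, 0 < g y := fun y => hP.pos.trans_le (hgl y)
  have hgu : ∀ y, g y ≤ k := fun y =>
    mul_le_of_le_one_right hk'.le (binProb_le_one P k y)
  have hgi : Integrable g volume := Integrable.of_bound hgm.aestronglyMeasurable k
    (ae_of_all _ fun y => by rw [Real.norm_eq_abs, abs_of_pos (hgp y)]; exact hgu y)
  have hfg : Integrable (fun y => f y - g y) volume := hP.integrable.sub hgi
  have hlg : ∀ y, |Real.log (g y)| ≤ |Real.log c₀| + |Real.log k| := fun y => by
    have h1 := Real.log_le_log hP.pos (hgl y)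
    have h2 := Real.log_le_log (hgp y) (hgu y)
    rw [abs_le]
    constructor
    · linarith [neg_abs_le (Real.log c₀), abs_nonneg (Real.log k)]
    · linarith [le_abs_self (Real.log k), abs_nonneg (Real.log c₀)]
  have hli : Integrable (fun y => Real.log (g y)) P :=
    Integrable.of_bound hgm.log.aestronglyMeasurable _ (ae_of_all _ hlg)
  have hint := (integrable_log hP.toHasBoundedDensity).sub hli
  refine ⟨hint, ?_⟩
  rw [hP.integral_eq]
  have hgint : ∫ y, g y = 1 := by
    rw [hg, integral_const_mul, integral_binProb hk]; field_simp
  have hpt : ∀ y, f y * (Real.log (f y) - Real.log (g y)) ≤ (f y - g y) + c₂ ^ 2 / c₀ / k ^ 2 := by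
    intro y
    have hfy := hP.f_pos y
    have h1 := Real.log_le_sub_one_of_pos (div_pos hfy (hgp y))
    rw [Real.log_div hfy.ne' (hgp y).ne'] at h1
    have h2 : f y * (f y / g y - 1) = (f y - g y) + (f y - g y) ^ 2 / g y := by
      have := (hgp y).ne'
      field_simp; ring
    have h3 : (f y - g y) ^ 2 ≤ (c₂ / k) ^ 2 := by
      rw [← sq_abs]
      exact pow_le_pow_left₀ (abs_nonneg _) (hP.abs_sub_binProb_le hc₂ hk y) 2
    have h4 : (f y - g y) ^ 2 / g y ≤ (c₂ / k) ^ 2 / c₀ :=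
      div_le_div₀ (by positivity) h3 hP.pos (hgl y)
    have h5 : (c₂ / k) ^ 2 / c₀ = c₂ ^ 2 / c₀ / k ^ 2 := by ring
    have h6 := mul_le_mul_of_nonneg_left h1 hfy.le
    linarith
  calc ∫ y, f y * (Real.log (f y) - Real.log (g y))
      ≤ ∫ y, ((f y - g y) + c₂ ^ 2 / c₀ / k ^ 2) := by
        refine integral_mono ?_ (hfg.add (integrable_const _)) hpt
        refine Integrable.of_bound
          (hP.measurable.mul (hP.measurable.log.sub hgm.log)).aestronglyMeasurable
          (c₁ * ((|Real.log c₀| + |Real.log c₁|) + (|Real.log c₀| + |Real.log k|)))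
          (ae_of_all _ fun y => ?_)
        rw [Real.norm_eq_abs, abs_mul, abs_of_pos (hP.f_pos y)]
        exact mul_le_mul (hP.upper y) ((abs_sub _ _).trans (add_le_add (hP.abs_log_le y) (hlg y)))
          (abs_nonneg _) ((hP.f_pos y).le.trans (hP.upper y))
    _ = c₂ ^ 2 / c₀ / k ^ 2 := by
        rw [integral_add hfg (integrable_const _), integral_sub hP.integrable hgi,
          hP.integral_eq_one, hgint]
        simp

/-- The risk of the histogram with `k` bins: an approximation error of order `1 / k²` and an
estimation error of order `k / n`. -/
theorem HasLipDensity.realRisk_histogram_le (hP : HasLipDensity P f c₀ c₁ c₂) (hc₂ : 0 ≤ c₂)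
    {k : ℕ} (hk : 1 ≤ k) (n : ℕ) :
    realRisk P f (histogram k) n ≤ c₂ ^ 2 / c₀ / k ^ 2 + ((k : ℝ) - 1) / (n + 1) := by
  have := hP.prob
  have hk' : (0 : ℝ) < k := by exact_mod_cast hk
  have hn : (0 : ℝ) < (n : ℝ) + 1 := by positivity
  obtain ⟨hi, hle⟩ := hP.integral_log_sub_log_le hc₂ hk
  have h1 : ∫ y, Real.log (f y) ∂P - ∫ y, binomLog (binProb P k y) n ∂P ≤
      ∫ y, ((Real.log (f y) - Real.log (k * binProb P k y)) +
        (Real.log k - Real.log (n + 1))) ∂P := by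
    rw [← integral_sub (integrable_log hP.toHasBoundedDensity) (integrable_binomLog P k n)]
    refine integral_mono ((integrable_log hP.toHasBoundedDensity).sub (integrable_binomLog P k n))
      (hi.add (integrable_const _)) fun y => ?_
    have h0 := hP.binProb_pos hk y
    have h2 := le_binomLog h0 (binProb_le_one P k y) n
    rw [Real.log_mul hn.ne' h0.ne'] at h2
    simp only
    rw [Real.log_mul hk'.ne' h0.ne']
    linarith
  rw [integral_add hi (integrable_const _)] at h1
  simp only [integral_const, probReal_univ, smul_eq_mul, one_mul] at h1
  have h3 := Real.log_le_sub_one_of_pos (x := ((n : ℝ) + k) / (n + 1)) (by positivity)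
  rw [Real.log_div (by positivity) hn.ne'] at h3
  have h4 : ((n : ℝ) + k) / (n + 1) - 1 = ((k : ℝ) - 1) / (n + 1) := by field_simp; ring
  rw [realRisk_histogram hP.toHasBoundedDensity hk]
  linarith

/-- For a fixed number `k` of bins the risk varies slowly with the number `n` of outcomes. -/
theorem HasBoundedDensity.abs_realRisk_succ_sub_le (hP : HasBoundedDensity P f c₀ c₁)
    {k : ℕ} (hk : 1 ≤ k) {n : ℕ} (hn : 1 ≤ n) :
    |realRisk P f (histogram k) (n + 1) - realRisk P f (histogram k) n| ≤
      (2 / c₀ + 1) * (k / n ^ 2) := by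
  have := hP.prob
  have hc := hP.pos
  have hk' : (0 : ℝ) < k := by exact_mod_cast hk
  have hn' : (0 : ℝ) < n := by exact_mod_cast hn
  have hi1 := integrable_binomLog P k (n + 1)
  have hi0 := integrable_binomLog P k n
  have heq : realRisk P f (histogram k) (n + 1) - realRisk P f (histogram k) n =
      (Real.log (n + 1 + k) - Real.log (n + k)) -
      ∫ y, (binomLog (binProb P k y) (n + 1) - binomLog (binProb P k y) n) ∂P := by
    rw [integral_sub hi1 hi0, realRisk_histogram hP hk, realRisk_histogram hP hk]
    push_cast
    ring
  have hup : ∫ y, (binomLog (binProb P k y) (n + 1) - binomLog (binProb P k y) n) ∂P ≤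
      1 / ((n : ℝ) + 1) := by
    have := integral_mono (hi1.sub hi0) (integrable_const (1 / ((n : ℝ) + 1))) fun y =>
      binomLog_succ_sub_le (binProb_nonneg P k y) (binProb_le_one P k y) n
    simpa using this
  have hlo : 1 / (n : ℝ) - 2 / c₀ * (k / n ^ 2) ≤
      ∫ y, (binomLog (binProb P k y) (n + 1) - binomLog (binProb P k y) n) ∂P := by
    have := integral_mono (integrable_const (1 / (n : ℝ) - 2 / c₀ * (k / n ^ 2)))
      (hi1.sub hi0) fun y => by
        have h0 := hP.binProb_pos hk y
        refine le_trans ?_ (le_binomLog_succ_sub h0 (binProb_le_one P k y) hn)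
        have h1 : 2 / ((n : ℝ) ^ 2 * binProb P k y) ≤ 2 / ((n : ℝ) ^ 2 * (c₀ / k)) :=
          div_le_div_of_nonneg_left (by norm_num) (by positivity)
            (mul_le_mul_of_nonneg_left (hP.le_binProb hk y) (by positivity))
        have h2 : 2 / ((n : ℝ) ^ 2 * (c₀ / k)) = 2 / c₀ * (k / n ^ 2) := by field_simp
        linarith
    simpa using this
  have hl1 : Real.log (n + 1 + k) - Real.log (n + k) ≤ 1 / n := by
    have h := Real.log_le_sub_one_of_pos (x := ((n : ℝ) + 1 + k) / (n + k)) (by positivity)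
    rw [Real.log_div (by positivity) (by positivity)] at h
    have h2 : ((n : ℝ) + 1 + k) / (n + k) - 1 = 1 / (n + k) := by field_simp; ring
    have h3 : 1 / ((n : ℝ) + k) ≤ 1 / n := one_div_le_one_div_of_le hn' (by linarith)
    linarith
  have hl2 : 1 / ((n : ℝ) + 1) - k / n ^ 2 ≤ Real.log (n + 1 + k) - Real.log (n + k) := by
    have h := Real.log_le_sub_one_of_pos (x := ((n : ℝ) + k) / (n + 1 + k)) (by positivity)
    rw [Real.log_div (by positivity) (by positivity)] at h
    have h2 : ((n : ℝ) + k) / (n + 1 + k) - 1 =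
        -(1 / ((n : ℝ) + 1) - k / ((n + 1) * (n + 1 + k))) := by field_simp; ring
    have h3 : (k : ℝ) / ((n + 1) * (n + 1 + k)) ≤ k / n ^ 2 :=
      div_le_div_of_nonneg_left hk'.le (by positivity) (by nlinarith)
    linarith
  have hpos : 0 ≤ (k : ℝ) / n ^ 2 := by positivity
  have hpos2 : 0 ≤ 2 / c₀ * ((k : ℝ) / n ^ 2) := by positivity
  rw [heq, abs_le]
  constructor <;> linarith

theorem HasBoundedDensity.abs_realRisk_sub_le (hP : HasBoundedDensity P f c₀ c₁)
    {k T B : ℕ} (hk : 1 ≤ k) (hT : 1 ≤ T) {i j : ℕ} (hi : T ≤ i) (hij : i ≤ j) (hj : j ≤ i + B) :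
    |realRisk P f (histogram k) j - realRisk P f (histogram k) i| ≤
      (2 / c₀ + 1) * (k / T ^ 2) * B := by
  have hc := hP.pos
  have hT' : (0 : ℝ) < T := by exact_mod_cast hT
  have hC : 0 ≤ (2 / c₀ + 1) * ((k : ℝ) / T ^ 2) := by positivity
  have key : ∀ d : ℕ, |realRisk P f (histogram k) (i + d) - realRisk P f (histogram k) i| ≤
      (2 / c₀ + 1) * (k / T ^ 2) * d := by
    intro d
    induction d with
    | zero => simp
    | succ d ih =>
      have h1 := hP.abs_realRisk_succ_sub_le hk (n := i + d) (by omega)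
      have h2 : (k : ℝ) / ((i + d : ℕ) : ℝ) ^ 2 ≤ k / T ^ 2 := by
        refine div_le_div_of_nonneg_left (by positivity) (by positivity) ?_
        exact pow_le_pow_left₀ hT'.le (by exact_mod_cast (by omega : T ≤ i + d)) 2
      have h3 := h1.trans (mul_le_mul_of_nonneg_left h2 (by positivity))
      have h4 := abs_sub_le (realRisk P f (histogram k) (i + (d + 1)))
        (realRisk P f (histogram k) (i + d)) (realRisk P f (histogram k) i)
      rw [← add_assoc] at h4 ⊢
      push_cast
      linarith
  obtain ⟨d, rfl⟩ := Nat.exists_eq_add_of_le hij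
  exact (key d).trans (mul_le_mul_of_nonneg_left (by exact_mod_cast (by omega : d ≤ B)) hC)

end Approximation

/-! ### The histogram with `⌈n^{1/3}⌉` bins -/

/-- The number of bins that `cubeRootHistogram` uses after `n` outcomes. -/
def cubeRootBins (n : ℕ) : ℕ := ⌈((n : ℝ) + 1) ^ (1 / 3 : ℝ)⌉₊

theorem one_le_cubeRootBins (n : ℕ) : 1 ≤ cubeRootBins n :=
  Nat.one_le_ceil_iff.2 (by positivity)

theorem isBoundedStrategy_cubeRootHistogram : IsBoundedStrategy cubeRootHistogram :=
  isBoundedStrategy_of_histogram one_le_cubeRootBins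

theorem rpow_one_third_pow {x : ℝ} (hx : 0 ≤ x) : (x ^ (1 / 3 : ℝ)) ^ 3 = x := by
  rw [← Real.rpow_natCast, ← Real.rpow_mul hx]
  norm_num

theorem cubeRootBins_le {n b : ℕ} (h : n < b ^ 3) : cubeRootBins n ≤ b := by
  refine Nat.ceil_le.2 ?_
  refine le_of_pow_le_pow_left₀ (n := 3) (by norm_num) (Nat.cast_nonneg b) ?_
  rw [rpow_one_third_pow (by positivity)]
  exact_mod_cast h

section CubeRoot

variable {P : Measure I} {f : I → ℝ} {c₀ c₁ c₂ : ℝ}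

theorem HasLipDensity.sum_realRisk_cubeRootHistogram_le (hP : HasLipDensity P f c₀ c₁ c₂)
    (hc₂ : 0 ≤ c₂) (n : ℕ) : ∑ i ∈ Finset.range n, realRisk P f cubeRootHistogram i ≤
      3 * (c₂ ^ 2 / c₀ + 1) * (n : ℝ) ^ (1 / 3 : ℝ) := by
  have hc₀ := hP.pos
  induction n with
  | zero => simp
  | succ n ih =>
    rw [Finset.sum_range_succ]
    have h1 := hP.realRisk_histogram_le hc₂ (one_le_cubeRootBins n) n
    have hu3 : (((n : ℝ) + 1) ^ (1 / 3 : ℝ)) ^ 3 = (n : ℝ) + 1 :=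
      rpow_one_third_pow (by positivity)
    have hb3 : ((n : ℝ) ^ (1 / 3 : ℝ)) ^ 3 = (n : ℝ) := rpow_one_third_pow (by positivity)
    have hk1 : ((n : ℝ) + 1) ^ (1 / 3 : ℝ) ≤ cubeRootBins n := Nat.le_ceil _
    have hk2 : (cubeRootBins n : ℝ) < ((n : ℝ) + 1) ^ (1 / 3 : ℝ) + 1 :=
      Nat.ceil_lt_add_one (by positivity)
    have hu : 0 < ((n : ℝ) + 1) ^ (1 / 3 : ℝ) := by positivity
    have hb : 0 ≤ (n : ℝ) ^ (1 / 3 : ℝ) := by positivity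
    have hbu : (n : ℝ) ^ (1 / 3 : ℝ) ≤ ((n : ℝ) + 1) ^ (1 / 3 : ℝ) :=
      Real.rpow_le_rpow (by positivity) (by linarith) (by norm_num)
    change realRisk P f cubeRootHistogram n ≤ _ at h1
    push_cast
    set u := ((n : ℝ) + 1) ^ (1 / 3 : ℝ)
    set b := (n : ℝ) ^ (1 / 3 : ℝ)
    set κ := (cubeRootBins n : ℝ)
    -- the increment of `3 n^{1/3}` is at least `1 / (n + 1)^{2/3}`
    have h2 : 1 / u ^ 2 ≤ 3 * (u - b) := by
      rw [div_le_iff₀ (by positivity)]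
      have : (u - b) * (u ^ 2 + u * b + b ^ 2) = 1 := by linear_combination hu3 - hb3
      nlinarith [mul_nonneg (sub_nonneg.2 hbu)
        (by nlinarith : 0 ≤ 3 * u ^ 2 - (u ^ 2 + u * b + b ^ 2))]
    have h3 : c₂ ^ 2 / c₀ / κ ^ 2 ≤ c₂ ^ 2 / c₀ * (1 / u ^ 2) := by
      rw [mul_one_div]
      exact div_le_div_of_nonneg_left (by positivity) (by positivity)
        (pow_le_pow_left₀ hu.le hk1 2)
    have h4 : (κ - 1) / ((n : ℝ) + 1) ≤ 1 / u ^ 2 := by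
      rw [← hu3, div_le_div_iff₀ (by positivity) (by positivity)]
      nlinarith [pow_pos hu 2]
    have h5 : 0 ≤ c₂ ^ 2 / c₀ := by positivity
    nlinarith [mul_le_mul_of_nonneg_left h2 (by linarith : 0 ≤ c₂ ^ 2 / c₀ + 1)]

end CubeRoot

/-! ### Switching strategies with few switches -/

theorem SwitchParam.active_eq (s : SwitchParam) {n : ℕ} (i : Fin (s.j + 1)) (h1 : s.t i ≤ n)
    (h2 : ∀ i', i < i' → n < s.t i') : s.active n = s.k i := by
  rw [SwitchParam.active]
  congr 1
  refine le_antisymm (Finset.max'_le _ _ _ fun i' hi' => ?_)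
    (Finset.le_max' _ _ (by simpa using h1))
  by_contra h
  have := h2 i' (not_le.1 h)
  simp only [Finset.mem_filter, Finset.mem_univ, true_and] at hi'
  omega

/-- The switching parameter that uses `k₀` bins for the first `T` predictions, and then `κ 0`,
`κ 1`, … bins on `J` consecutive blocks of length `B`. -/
def blockParam (T B J : ℕ) (hT : 0 < T) (hB : 0 < B) (k₀ : ℕ+) (κ : ℕ → ℕ+) : SwitchParam where
  j := J
  t := Fin.cons 0 fun i => T + i * B
  k := Fin.cons k₀ fun i => κ i
  t_zero := rfl
  t_strictMono := by
    rw [Fin.strictMono_iff_lt_succ]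
    intro i
    rw [Fin.cons_succ]
    rcases i with ⟨_ | l, hl⟩
    · exact Nat.add_pos_left hT _
    · change T + l * B < T + (l + 1) * B
      exact Nat.add_lt_add_left (Nat.mul_lt_mul_of_pos_right (Nat.lt_succ_self l) hB) T

section Block

variable {T B J : ℕ} (hT : 0 < T) (hB : 0 < B) (k₀ : ℕ+) (κ : ℕ → ℕ+)

theorem blockParam_active_of_lt {n : ℕ} (hn : n < T) :
    (blockParam T B J hT hB k₀ κ).active n = k₀ := by
  refine SwitchParam.active_eq (blockParam T B J hT hB k₀ κ) (0 : Fin (J + 1)) (Nat.zero_le _)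
    fun i' => ?_
  refine Fin.cases (fun h => absurd h (lt_irrefl _)) (fun l _ => ?_) i'
  change n < T + l * B
  exact hn.trans_le (Nat.le_add_right _ _)

theorem blockParam_active {n j : ℕ} (hj : j < J) (h1 : T + j * B ≤ n) (h2 : n < T + (j + 1) * B) :
    (blockParam T B J hT hB k₀ κ).active n = κ j := by
  refine SwitchParam.active_eq (blockParam T B J hT hB k₀ κ) (Fin.succ (⟨j, hj⟩ : Fin J)) h1
    fun i' => ?_
  refine Fin.cases (fun h => absurd h (Fin.not_lt_zero _)) (fun l hl => ?_) i'
  change n < T + l * B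
  have hl' : j + 1 ≤ (l : ℕ) := by
    have := Fin.succ_lt_succ_iff.1 hl
    exact this
  exact h2.trans_le (Nat.add_le_add_left (Nat.mul_le_mul_right _ hl') _)

end Block

theorem sum_range_min_eq_sum_blocks (g : ℕ → ℝ) (n T B J : ℕ) :
    ∑ i ∈ Finset.range (min n (T + J * B)), g i = ∑ i ∈ Finset.range (min n T), g i +
      ∑ j ∈ Finset.range J,
        ∑ i ∈ Finset.Ico (min n (T + j * B)) (min n (T + (j + 1) * B)), g i := by
  induction J with
  | zero => simp
  | succ J ih =>
    rw [Finset.sum_range_succ, ← add_assoc, ← ih]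
    simp only [Finset.range_eq_Ico]
    rw [Finset.sum_Ico_consecutive _ (Nat.zero_le _)]
    exact min_le_min_left n (Nat.add_le_add_left (Nat.mul_le_mul_right _ (Nat.le_succ J)) T)

/-- If the losses `ρ (κ a) i` vary by at most `δ` for `i` in a block, then some constant choice
among the `κ a` does on the block about as well as the varying choice `κ i`: the average over `a`
of the constant choices does. -/
theorem exists_constant_choice {ρ : ℕ → ℕ → ℝ} {κ : ℕ → ℕ} {S : Finset ℕ} {δ : ℝ}
    (h : ∀ a ∈ S, ∀ i ∈ S, ρ (κ a) i ≤ ρ (κ a) a + δ) (hS : S.Nonempty) :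
    ∃ a ∈ S, ∑ i ∈ S, ρ (κ a) i ≤ ∑ i ∈ S, ρ (κ i) i + S.card * δ := by
  refine Finset.exists_le_of_sum_le hS ?_
  calc ∑ a ∈ S, ∑ i ∈ S, ρ (κ a) i ≤ ∑ a ∈ S, ∑ _i ∈ S, (ρ (κ a) a + δ) :=
        Finset.sum_le_sum fun a ha => Finset.sum_le_sum fun i hi => h a ha i hi
    _ = ∑ _a ∈ S, (∑ i ∈ S, ρ (κ i) i + S.card * δ) := by
        simp only [Finset.sum_const, nsmul_eq_mul, ← Finset.mul_sum, Finset.sum_add_distrib]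

theorem exists_pnat_choice {ρ : ℕ → ℕ → ℝ} {κ : ℕ → ℕ} {S : Finset ℕ} {δ : ℝ} {K : ℕ}
    (hδ : 0 ≤ δ) (hκ : ∀ i, 1 ≤ κ i) (hK : ∀ i ∈ S, κ i ≤ K) (hK1 : 1 ≤ K) {B : ℕ}
    (hB : S.card ≤ B) (h : ∀ a ∈ S, ∀ i ∈ S, ρ (κ a) i ≤ ρ (κ a) a + δ) :
    ∃ k : ℕ+, (k : ℕ) ≤ K ∧ ∑ i ∈ S, ρ k i ≤ ∑ i ∈ S, ρ (κ i) i + B * δ := by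
  rcases S.eq_empty_or_nonempty with rfl | hS
  · exact ⟨1, by simpa using hK1, by simpa using by positivity⟩
  · obtain ⟨a, ha, hle⟩ := exists_constant_choice h hS
    refine ⟨⟨κ a, hκ a⟩, hK a ha, hle.trans ?_⟩
    have : (S.card : ℝ) ≤ B := by exact_mod_cast hB
    have := mul_le_mul_of_nonneg_right this hδ
    linarith

/-! ### Lower bounds on the prior -/

theorem exists_bound_of_isBigO {g h : ℕ+ → ℝ} (hh : ∀ k, 0 ≤ h k) (hgh : g =O[atTop] h) :
    ∃ D : ℝ, 0 ≤ D ∧ ∀ k, g k ≤ D * (1 + h k) := by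
  obtain ⟨c, hc⟩ := hgh.bound
  obtain ⟨N, hN⟩ := eventually_atTop.1 hc
  have hS : 0 ≤ ∑ j ∈ Finset.range N, |g j.succPNat| :=
    Finset.sum_nonneg fun _ _ => abs_nonneg _
  refine ⟨max c 0 + ∑ j ∈ Finset.range N, |g j.succPNat|,
    add_nonneg (le_max_right _ _) hS, fun k => ?_⟩
  have hk := hh k
  have hc0 : 0 ≤ max c 0 := le_max_right _ _
  by_cases hkN : N ≤ k
  · have h1 := hN k hkN
    rw [Real.norm_eq_abs, Real.norm_of_nonneg hk] at h1
    have h2 := (le_abs_self _).trans (h1.trans (mul_le_mul_of_nonneg_right (le_max_left c 0) hk))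
    nlinarith [mul_nonneg hS (by linarith : 0 ≤ 1 + h k)]
  · have h1 : k.natPred ∈ Finset.range N := by
      have h2 : (k : ℕ) < N := not_le.1 hkN
      have h3 := PNat.natPred_add_one k
      exact Finset.mem_range.2 (by omega)
    have h2 := Finset.single_le_sum (f := fun j : ℕ => |g j.succPNat|)
      (fun j _ => abs_nonneg _) h1
    simp only [PNat.succPNat_natPred] at h2
    nlinarith [le_abs_self (g k), mul_nonneg hS hk, mul_nonneg hc0 (by linarith : 0 ≤ 1 + h k)]

theorem ofReal_exp_neg_le {x : ℝ≥0∞} (hx0 : 0 < x) (hxt : x ≠ ∞) {b : ℝ}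
    (h : -Real.log x.toReal ≤ b) : ENNReal.ofReal (Real.exp (-b)) ≤ x := by
  refine ENNReal.ofReal_le_of_le_toReal ?_
  rw [← Real.le_log_iff_exp_le (ENNReal.toReal_pos hx0.ne' hxt)]
  linarith

theorem switchPrior_ge {πm πk πt : PMF ℕ+} (hπm : ∀ m, 0 < πm m) (hπk : ∀ k, 0 < πk k)
    (hπt : ∀ t, 0 < πt t) (s : SwitchParam) {a b : ℝ}
    (ha : -Real.log (πm s.j.succPNat).toReal ≤ a) (hk : ∀ i, -Real.log (πk (s.k i)).toReal ≤ b)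
    (ht : ∀ t : ℕ+, (∃ i, s.t i = t) → -Real.log (πt t).toReal ≤ b) :
    ENNReal.ofReal (Real.exp (-(a + b + s.j * (b + b)))) ≤ switchPrior πm πk πt s := by
  have h1 := ofReal_exp_neg_le (hπm _) (πm.apply_ne_top _) ha
  have h2 := ofReal_exp_neg_le (hπk _) (πk.apply_ne_top _) (hk 0)
  have h3 : ∀ i : Fin s.j, ENNReal.ofReal (Real.exp (-b)) * ENNReal.ofReal (Real.exp (-b)) ≤
      condTail πt ⟨s.t i.succ, s.t_succ_pos i⟩ (s.t i.castSucc) * πk (s.k i.succ) := fun i =>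
    mul_le_mul' ((ofReal_exp_neg_le (hπt _) (πt.apply_ne_top _)
      (ht ⟨s.t i.succ, s.t_succ_pos i⟩ ⟨i.succ, rfl⟩)).trans
        (le_condTail πt (s.t_strictMono i.castSucc_lt_succ)))
      (ofReal_exp_neg_le (hπk _) (πk.apply_ne_top _) (hk _))
  refine le_trans (le_of_eq ?_) (mul_le_mul' (mul_le_mul' h1 h2)
    (Finset.prod_le_prod' fun i (_ : i ∈ Finset.univ) => h3 i))
  rw [Finset.prod_const, Finset.card_univ, Fintype.card_fin,
    ← ENNReal.ofReal_mul (Real.exp_nonneg _), ← ENNReal.ofReal_mul (Real.exp_nonneg _),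
    ← ENNReal.ofReal_pow (by positivity), ← ENNReal.ofReal_mul (by positivity),
    ← Real.exp_add, ← Real.exp_add, ← Real.exp_nat_mul, ← Real.exp_add]
  congr 2
  ring

/-! ### The switch distribution against the histogram with `⌈n^{1/3}⌉` bins -/

section Comparison

variable {P : Measure I} {f : I → ℝ} {c₀ c₁ c₂ : ℝ}

theorem sum_inv_succ_le (T : ℕ) :
    ∑ i ∈ Finset.range T, 1 / ((i : ℝ) + 1) ≤ 1 + Real.log T := by
  refine le_trans (le_of_eq ?_) (harmonic_le_one_add_log T)
  simp [harmonic]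

theorem HasLipDensity.sum_realRisk_histogram_le (hP : HasLipDensity P f c₀ c₁ c₂) (hc₂ : 0 ≤ c₂)
    {k : ℕ} (hk : 1 ≤ k) (T : ℕ) :
    ∑ i ∈ Finset.range T, realRisk P f (histogram k) i ≤
      T * (c₂ ^ 2 / c₀ / k ^ 2) + k * (1 + Real.log T) := by
  calc ∑ i ∈ Finset.range T, realRisk P f (histogram k) i
      ≤ ∑ i ∈ Finset.range T, (c₂ ^ 2 / c₀ / k ^ 2 + k * (1 / ((i : ℝ) + 1))) := by
        refine Finset.sum_le_sum fun i _ => (hP.realRisk_histogram_le hc₂ hk i).trans ?_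
        rw [mul_one_div]
        gcongr
        linarith
    _ = T * (c₂ ^ 2 / c₀ / k ^ 2) + k * ∑ i ∈ Finset.range T, 1 / ((i : ℝ) + 1) := by
        rw [Finset.sum_add_distrib, ← Finset.mul_sum]
        simp
    _ ≤ _ := by gcongr; exact sum_inv_succ_le T

/-- Comparison of a block strategy with the histogram that uses `⌈n^{1/3}⌉` bins: for a suitable
choice of the numbers of bins, depending on the law, the loss is that of the first segment, plus the
variation of the risks within the blocks. -/
theorem HasLipDensity.exists_blockParam (hP : HasLipDensity P f c₀ c₁ c₂)
    {T B J n K : ℕ} (hT : 0 < T) (hB : 0 < B) (k₀ : ℕ+) (hTn : T ≤ n) (hJ : n ≤ T + J * B)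
    (hK : n ≤ K ^ 3) (hK1 : 1 ≤ K) :
    ∃ κ : ℕ → ℕ+, (∀ j, (κ j : ℕ) ≤ K) ∧
      ∑ i ∈ Finset.range n, realRisk P f
        (histogram ((blockParam T B J hT hB k₀ κ).active i)) i ≤
      ∑ i ∈ Finset.range n, realRisk P f cubeRootHistogram i +
        ∑ i ∈ Finset.range T, realRisk P f (histogram k₀) i +
        J * (B * ((2 / c₀ + 1) * (K / T ^ 2) * B)) := by
  have hc₀ := hP.pos
  set ρ : ℕ → ℕ → ℝ := fun k i => realRisk P f (histogram k) i with hρ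
  set S : ℕ → Finset ℕ := fun j =>
    Finset.Ico (min n (T + j * B)) (min n (T + (j + 1) * B)) with hS
  have hmem : ∀ j i, i ∈ S j → i < n ∧ T + j * B ≤ i ∧ i < T + (j + 1) * B := by
    intro j i hi
    have h := Finset.mem_Ico.1 hi
    generalize T + j * B = u at h ⊢
    generalize T + (j + 1) * B = v at h ⊢
    omega
  have hκK : ∀ j, ∀ i ∈ S j, cubeRootBins i ≤ K := fun j i hi =>
    cubeRootBins_le ((hmem j i hi).1.trans_le hK)
  have hδ : 0 ≤ (2 / c₀ + 1) * ((K : ℝ) / T ^ 2) * B := by positivity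
  have hchoice : ∀ j, ∃ k : ℕ+, (k : ℕ) ≤ K ∧ ∑ i ∈ S j, ρ k i ≤
      ∑ i ∈ S j, ρ (cubeRootBins i) i + B * ((2 / c₀ + 1) * (K / T ^ 2) * B) := by
    intro j
    refine exists_pnat_choice hδ one_le_cubeRootBins (hκK j) hK1 ?_ fun a ha i hi => ?_
    · rw [Nat.card_Ico, add_mul, one_mul]
      generalize j * B = u
      omega
    · obtain ⟨-, ha1, ha2⟩ := hmem j a ha
      obtain ⟨-, hi1, hi2⟩ := hmem j i hi
      rw [add_mul, one_mul] at ha2 hi2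
      have hka : (2 / c₀ + 1) * ((cubeRootBins a : ℝ) / T ^ 2) * B ≤
          (2 / c₀ + 1) * (K / T ^ 2) * B := by
        have : (cubeRootBins a : ℝ) ≤ K := by exact_mod_cast hκK j a ha
        gcongr
      have hTi : T ≤ i := le_trans (Nat.le_add_right _ _) hi1
      have hTa : T ≤ a := le_trans (Nat.le_add_right _ _) ha1
      rcases le_total a i with hai | hai
      · have := hP.abs_realRisk_sub_le (one_le_cubeRootBins a) hT hTa hai
          (B := B) (by omega)
        linarith [le_abs_self (ρ (cubeRootBins a) i - ρ (cubeRootBins a) a)]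
      · have := hP.abs_realRisk_sub_le (one_le_cubeRootBins a) hT hTi hai
          (B := B) (by omega)
        linarith [neg_abs_le (ρ (cubeRootBins a) a - ρ (cubeRootBins a) i)]
  choose κ hκ1 hκ2 using hchoice
  refine ⟨κ, hκ1, ?_⟩
  have hmin : min n (T + J * B) = n := min_eq_left hJ
  have hminT : min n T = T := min_eq_right hTn
  have hsplit := sum_range_min_eq_sum_blocks (fun i => realRisk P f
    (histogram ((blockParam T B J hT hB k₀ κ).active i)) i) n T B J
  have hsplit' := sum_range_min_eq_sum_blocks (fun i => realRisk P f cubeRootHistogram i) n T B J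
  rw [hmin, hminT] at hsplit hsplit'
  rw [hsplit, hsplit']
  have h1 : ∑ i ∈ Finset.range T, realRisk P f
      (histogram ((blockParam T B J hT hB k₀ κ).active i)) i =
      ∑ i ∈ Finset.range T, realRisk P f (histogram k₀) i := by
    refine Finset.sum_congr rfl fun i hi => ?_
    rw [blockParam_active_of_lt hT hB k₀ κ (Finset.mem_range.1 hi)]
  have h2 : 0 ≤ ∑ i ∈ Finset.range T, realRisk P f cubeRootHistogram i :=
    Finset.sum_nonneg fun i _ =>
      (isBoundedStrategy_cubeRootHistogram.klRisk_eq hP.toHasBoundedDensity i).1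
  have h3 : ∑ j ∈ Finset.range J, ∑ i ∈ S j, realRisk P f
      (histogram ((blockParam T B J hT hB k₀ κ).active i)) i ≤
      ∑ j ∈ Finset.range J, (∑ i ∈ S j, realRisk P f cubeRootHistogram i +
        B * ((2 / c₀ + 1) * (K / T ^ 2) * B)) := by
    refine Finset.sum_le_sum fun j hj => ?_
    refine le_trans (le_of_eq ?_) (hκ2 j)
    refine Finset.sum_congr rfl fun i hi => ?_
    obtain ⟨-, hi1, hi2⟩ := hmem j i hi
    rw [blockParam_active hT hB k₀ κ (Finset.mem_range.1 hj) hi1 hi2]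
  rw [Finset.sum_add_distrib, Finset.sum_const, Finset.card_range, nsmul_eq_mul] at h3
  linarith

/-- The cumulative risk of the switch distribution exceeds that of the histogram with `⌈n^{1/3}⌉`
bins by at most `O(M^7 log M)`, where `M` is of the order `n^{1/24}`; the block strategies
used for this have a first segment of length `M^{21}` and `O(M^7)` blocks of length `M^{17}`. -/
theorem HasLipDensity.sum_realRisk_switch_le {πm πk πt : PMF ℕ+} {D : ℝ} (hD : 0 ≤ D)
    (hπm : ∀ m, 0 < πm m) (hπk : ∀ k, 0 < πk k) (hπt : ∀ t, 0 < πt t)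
    (hm : ∀ m : ℕ+, -Real.log (πm m).toReal ≤ D * (1 + m))
    (hk : ∀ k : ℕ+, -Real.log (πk k).toReal ≤ D * (1 + Real.log k))
    (ht : ∀ t : ℕ+, -Real.log (πt t).toReal ≤ D * (1 + Real.log t))
    (hP : HasLipDensity P f c₀ c₁ c₂) (hc₂ : 0 ≤ c₂) {M n : ℕ} (hM : 1 ≤ M)
    (hn1 : M ^ 24 ≤ n) (hn2 : n ≤ (2 * M) ^ 24) :
    ∑ i ∈ Finset.range n,
      realRisk P f (switchDensity (switchPrior πm πk πt) fun k => histogram k) i ≤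
    ∑ i ∈ Finset.range n, realRisk P f cubeRootHistogram i +
      (c₂ ^ 2 / c₀ + 21 + 2 ^ 32 * (2 / c₀ + 1) + 2 ^ 31 * D) *
        ((M : ℝ) ^ 7 * (1 + Real.log M)) := by
  have hc₀ := hP.pos
  have hM0 : 0 < M := hM
  have hMr : (0 : ℝ) < M := by exact_mod_cast hM
  have hM1 : (1 : ℝ) ≤ M := by exact_mod_cast hM
  have hℓ : 0 ≤ Real.log M := Real.log_nonneg hM1
  obtain ⟨κ, hκ, hsum⟩ := hP.exists_blockParam (T := M ^ 21) (B := M ^ 17) (J := 2 ^ 24 * M ^ 7)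
    (n := n) (K := 256 * M ^ 8) (by positivity) (by positivity) ⟨M ^ 7, by positivity⟩
    ((Nat.pow_le_pow_right hM0 (by norm_num)).trans hn1)
    (by calc n ≤ (2 * M) ^ 24 := hn2
          _ = 2 ^ 24 * M ^ 7 * M ^ 17 := by ring
          _ ≤ _ := Nat.le_add_left _ _)
    (by calc n ≤ (2 * M) ^ 24 := hn2
          _ = _ := by ring)
    (by have : 0 < 256 * M ^ 8 := by positivity
        omega)
  set s := blockParam (M ^ 21) (M ^ 17) (2 ^ 24 * M ^ 7) (by positivity) (by positivity)
    ⟨M ^ 7, by positivity⟩ κ with hs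
  -- all numbers of bins and switching times are at most `2 ^ 25 * M ^ 24`
  have hlogX : ∀ x : ℕ, 1 ≤ x → x ≤ 2 ^ 25 * M ^ 24 →
      D * (1 + Real.log x) ≤ D * (26 * (1 + Real.log M)) := by
    intro x hx1 hx
    have h1 : (x : ℝ) ≤ 2 ^ 25 * (M : ℝ) ^ 24 := by exact_mod_cast hx
    have h2 := Real.log_le_log (by exact_mod_cast hx1) h1
    rw [Real.log_mul (by positivity) (by positivity), Real.log_pow, Real.log_pow] at h2
    have h3 := Real.log_two_lt_d9
    push_cast at h2
    exact mul_le_mul_of_nonneg_left (by linarith) hD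
  have hprior := switchPrior_ge hπm hπk hπt s (a := D * (2 ^ 26 * (M : ℝ) ^ 7))
    (b := D * (26 * (1 + Real.log M))) ?_ ?_ ?_
  rotate_left
  · refine (hm _).trans (mul_le_mul_of_nonneg_left ?_ hD)
    have h1 : ((s.j.succPNat : ℕ+) : ℝ) = 2 ^ 24 * (M : ℝ) ^ 7 + 1 := by
      have : ((s.j.succPNat : ℕ+) : ℕ) = 2 ^ 24 * M ^ 7 + 1 := rfl
      rw [this]; push_cast; ring
    rw [h1]
    nlinarith [one_le_pow₀ hM1 (n := 7)]
  · intro i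
    refine (hk _).trans (hlogX _ (s.k i).pos ?_)
    refine Fin.cases ?_ (fun l => ?_) i
    · change M ^ 7 ≤ _
      calc M ^ 7 ≤ M ^ 24 := Nat.pow_le_pow_right hM0 (by norm_num)
        _ ≤ _ := Nat.le_mul_of_pos_left _ (by positivity)
    · change (κ l : ℕ) ≤ _
      refine (hκ l).trans (Nat.mul_le_mul (by norm_num) (Nat.pow_le_pow_right hM0 (by norm_num)))
  · rintro t ⟨i, hi⟩
    refine (ht _).trans (hlogX _ t.pos ?_)
    rw [← hi]
    refine Fin.cases (Nat.zero_le _) (fun l => ?_) i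
    change M ^ 21 + l * M ^ 17 ≤ _
    calc M ^ 21 + l * M ^ 17 ≤ M ^ 24 + (2 ^ 24 * M ^ 7) * M ^ 17 :=
          Nat.add_le_add (Nat.pow_le_pow_right hM0 (by norm_num))
            (Nat.mul_le_mul_right _ l.is_lt.le)
      _ = (2 ^ 24 + 1) * M ^ 24 := by ring
      _ ≤ _ := Nat.mul_le_mul_right _ (by norm_num)
  have hs0 : switchPrior πm πk πt s ≠ 0 :=
    ((ENNReal.ofReal_pos.2 (Real.exp_pos _)).trans_le hprior).ne'
  have hst : switchPrior πm πk πt s ≠ ∞ := ne_top_of_le_ne_top ENNReal.one_ne_top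
    ((ENNReal.le_tsum s).trans (tsum_switchPrior_le_one πm πk πt))
  have hlog := (Real.le_log_iff_exp_le (ENNReal.toReal_pos hs0 hst)).2
    ((ENNReal.ofReal_le_iff_le_toReal hst).1 hprior)
  have horacle := sum_realRisk_switchDensity_le (tsum_switchPrior_le_one πm πk πt)
    hP.toHasBoundedDensity n s hs0
  have hfirst := hP.sum_realRisk_histogram_le hc₂ (k := M ^ 7)
    (Nat.one_le_pow _ _ hM0) (M ^ 21)
  have hsj : (s.j : ℝ) = 2 ^ 24 * (M : ℝ) ^ 7 := by
    have : s.j = 2 ^ 24 * M ^ 7 := rfl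
    rw [this]; push_cast; ring
  rw [hsj] at hlog
  push_cast at hfirst hsum
  rw [Real.log_pow] at hfirst
  push_cast at hfirst
  have he1 : (M : ℝ) ^ 21 * (c₂ ^ 2 / c₀ / ((M : ℝ) ^ 7) ^ 2) = c₂ ^ 2 / c₀ * (M : ℝ) ^ 7 := by
    field_simp
  have he2 : (16777216 : ℝ) * (M : ℝ) ^ 7 * ((M : ℝ) ^ 17 * ((2 / c₀ + 1) *
      (256 * (M : ℝ) ^ 8 / ((M : ℝ) ^ 21) ^ 2) * (M : ℝ) ^ 17)) =
      2 ^ 32 * (2 / c₀ + 1) * (M : ℝ) ^ 7 := by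
    field_simp
    ring
  rw [he1] at hfirst
  rw [he2] at hsum
  have hA : 0 ≤ c₂ ^ 2 / c₀ := by positivity
  have hC : 0 ≤ 2 / c₀ + 1 := by positivity
  have hM7 : 1 ≤ (M : ℝ) ^ 7 := one_le_pow₀ hM1
  change _ ≤ _ + ∑ i ∈ Finset.range (M ^ 21), realRisk P f (histogram (M ^ 7)) i + _ at hsum
  set ℓ := Real.log M
  set m := (M : ℝ) ^ 7
  have hmℓ : 0 ≤ m * ℓ := by positivity
  have h1 : c₂ ^ 2 / c₀ * m + m * (1 + 21 * ℓ) ≤ (c₂ ^ 2 / c₀ + 21) * (m * (1 + ℓ)) := by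
    nlinarith [mul_nonneg hA hmℓ]
  have h2 : 2 ^ 32 * (2 / c₀ + 1) * m ≤ 2 ^ 32 * (2 / c₀ + 1) * (m * (1 + ℓ)) := by
    nlinarith [mul_nonneg hC hmℓ]
  have h3 : D * (2 ^ 26 * m) + D * (26 * (1 + ℓ)) + 2 ^ 24 * m *
      (D * (26 * (1 + ℓ)) + D * (26 * (1 + ℓ))) ≤ 2 ^ 31 * D * (m * (1 + ℓ)) := by
    have e : 2 ^ 26 * m + 26 * (1 + ℓ) + 2 ^ 24 * m * (26 * (1 + ℓ) + 26 * (1 + ℓ)) ≤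
        2 ^ 31 * (m * (1 + ℓ)) := by
      nlinarith [mul_nonneg (by linarith : 0 ≤ m - 1) (by linarith : 0 ≤ 1 + ℓ)]
    have := mul_le_mul_of_nonneg_left e hD
    linarith
  linarith

end Comparison

/-! ### Asymptotic comparison of worst-case risks -/

theorem exists_pow_le_lt (n : ℕ) : ∃ M : ℕ, M ^ 24 ≤ n ∧ n < (M + 1) ^ 24 := by
  refine ⟨Nat.findGreatest (fun M => M ^ 24 ≤ n) n,
    Nat.findGreatest_spec (P := fun M => M ^ 24 ≤ n) (Nat.zero_le n) (by simp), ?_⟩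
  by_contra h
  have h := not_lt.1 h
  have hle := (Nat.le_self_pow (by norm_num : 24 ≠ 0) _).trans h
  have := Nat.le_findGreatest (P := fun M => M ^ 24 ≤ n) hle h
  omega

theorem pow_eight_le {M n : ℕ} (h : M ^ 24 ≤ n) : (M : ℝ) ^ 8 ≤ (n : ℝ) ^ (1 / 3 : ℝ) := by
  refine le_of_pow_le_pow_left₀ (n := 3) (by norm_num) (Real.rpow_nonneg (Nat.cast_nonneg n) _) ?_
  rw [rpow_one_third_pow (Nat.cast_nonneg n), ← pow_mul]
  exact_mod_cast h

theorem exists_forall_mul_log_le (E : ℝ) {δ : ℝ} (hδ : 0 < δ) :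
    ∃ M₀ : ℕ, ∀ M ≥ M₀, E * (1 + Real.log M) ≤ δ * M := by
  have h1 : (fun x : ℝ => E * (1 + Real.log x)) =o[atTop] (fun x : ℝ => x) :=
    ((isLittleO_const_id_atTop (1 : ℝ)).add Real.isLittleO_log_id_atTop).const_mul_left E
  have h2 := tendsto_natCast_atTop_atTop (R := ℝ) |>.eventually (h1.bound hδ)
  obtain ⟨M₀, hM₀⟩ := eventually_atTop.1 h2
  refine ⟨M₀, fun M hM => (le_abs_self _).trans ?_⟩
  simpa using hM₀ M hM

theorem tsum_switchPrior_ne_zero {πm πk : PMF ℕ+} (πt : PMF ℕ+) (hπm : ∀ m, 0 < πm m)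
    (hπk : ∀ k, 0 < πk k) : ∑' s, switchPrior πm πk πt s ≠ 0 := by
  intro h
  let s : SwitchParam := ⟨0, fun _ => 0, fun _ => 1, rfl, fun a b h => by omega⟩
  have h2 := ENNReal.tsum_eq_zero.1 h s
  have h3 : switchPrior πm πk πt s = πm 1 * πk 1 := by
    rw [switchPrior, Finset.prod_eq_one fun i _ => i.elim0, mul_one]; rfl
  rw [h3] at h2
  exact mul_ne_zero (hπm 1).ne' (hπk 1).ne' h2

section Asymptotic

variable {c₀ c₁ c₂ : ℝ}

/-- The worst-case cumulative risk of the switch distribution exceeds that of the histogram with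
`⌈n^{1/3}⌉` bins by `o(n^{1/3})`. -/
theorem worstCumRisk_switch_le (hc₀ : 0 < c₀) (πm πk πt : PMF ℕ+)
    (hπm : ∀ m, 0 < πm m) (hπk : ∀ k, 0 < πk k) (hπt : ∀ t, 0 < πt t)
    (hm : (fun m : ℕ+ => -Real.log (πm m).toReal) =O[atTop] fun m : ℕ+ => (m : ℝ))
    (hk : (fun k : ℕ+ => -Real.log (πk k).toReal) =O[atTop] fun k : ℕ+ => Real.log (k : ℝ))
    (ht : (fun t : ℕ+ => -Real.log (πt t).toReal) =O[atTop] fun t : ℕ+ => Real.log (t : ℝ))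
    {δ : ℝ≥0} (hδ : 0 < δ) :
    ∃ n₀ : ℕ, ∀ n ≥ n₀, worstCumRisk (smoothClass c₀ c₁ c₂)
      (switchDensity (switchPrior πm πk πt) fun k => histogram k) n ≤
      worstCumRisk (smoothClass c₀ c₁ c₂) cubeRootHistogram n + δ * cubeRoot n := by
  have hlog : ∀ k : ℕ+, 0 ≤ Real.log (k : ℝ) := fun k =>
    Real.log_nonneg (by exact_mod_cast k.pos)
  obtain ⟨D₁, hD₁, hm⟩ := exists_bound_of_isBigO (fun m => Nat.cast_nonneg (m : ℕ)) hm
  obtain ⟨D₂, hD₂, hk⟩ := exists_bound_of_isBigO hlog hk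
  obtain ⟨D₃, hD₃, ht⟩ := exists_bound_of_isBigO hlog ht
  obtain ⟨D, hD, hDm, hDk, hDt⟩ : ∃ D, 0 ≤ D ∧ D₁ ≤ D ∧ D₂ ≤ D ∧ D₃ ≤ D :=
    ⟨D₁ + D₂ + D₃, by positivity, by linarith, by linarith, by linarith⟩
  have hm' : ∀ m : ℕ+, -Real.log (πm m).toReal ≤ D * (1 + m) := fun m =>
    (hm m).trans (mul_le_mul_of_nonneg_right hDm (by positivity))
  have hk' : ∀ k : ℕ+, -Real.log (πk k).toReal ≤ D * (1 + Real.log k) := fun k =>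
    (hk k).trans (mul_le_mul_of_nonneg_right hDk (by linarith [hlog k]))
  have ht' : ∀ t : ℕ+, -Real.log (πt t).toReal ≤ D * (1 + Real.log t) := fun t =>
    (ht t).trans (mul_le_mul_of_nonneg_right hDt (by linarith [hlog t]))
  obtain ⟨E, hEdef⟩ :
      ∃ E, E = c₂ ^ 2 / c₀ + 21 + 2 ^ 32 * (2 / c₀ + 1) + 2 ^ 31 * D := ⟨_, rfl⟩
  obtain ⟨M₀, hM₀⟩ := exists_forall_mul_log_le E (δ := δ) (by exact_mod_cast hδ)
  refine ⟨(M₀ + 1) ^ 24, fun n hn => ?_⟩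
  obtain ⟨M, hM1, hM2⟩ := exists_pow_le_lt n
  have hM : M₀ + 1 ≤ M := by
    by_contra h
    have h2 : M + 1 ≤ M₀ + 1 := by omega
    exact absurd hn (not_le.2 (lt_of_lt_of_le hM2 (Nat.pow_le_pow_left h2 24)))
  have hM3 : n ≤ (2 * M) ^ 24 := by
    have h : M + 1 ≤ 2 * M := by omega
    exact le_trans (le_of_lt hM2) (Nat.pow_le_pow_left h 24)
  have hroot := pow_eight_le hM1
  refine iSup₂_le fun P hP => ?_
  have hc₂ := nonneg_of_mem_smoothClass hP
  obtain ⟨f, hf⟩ := exists_hasLipDensity hc₀ hP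
  have hsum := hf.sum_realRisk_switch_le hD hπm hπk hπt hm' hk' ht' hc₂ (M := M) (by omega) hM1 hM3
  rw [← hEdef] at hsum
  have hE : E * ((M : ℝ) ^ 7 * (1 + Real.log M)) ≤ δ * (n : ℝ) ^ (1 / 3 : ℝ) := by
    have h1 := hM₀ M (by omega)
    calc E * ((M : ℝ) ^ 7 * (1 + Real.log M)) = (M : ℝ) ^ 7 * (E * (1 + Real.log M)) := by ring
      _ ≤ (M : ℝ) ^ 7 * (δ * M) := mul_le_mul_of_nonneg_left h1
          (pow_nonneg (Nat.cast_nonneg M) 7)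
      _ = δ * (M : ℝ) ^ 8 := by ring
      _ ≤ _ := mul_le_mul_of_nonneg_left hroot δ.2
  have hne := tsum_switchPrior_ne_zero πt hπm hπk
  rw [(isBoundedStrategy_switchDensity (tsum_switchPrior_le_one πm πk πt) hne).cumRisk_eq
    hf.toHasBoundedDensity]
  calc _ ≤ ENNReal.ofReal (∑ i ∈ Finset.range n, realRisk P f cubeRootHistogram i +
        δ * (n : ℝ) ^ (1 / 3 : ℝ)) := ENNReal.ofReal_le_ofReal (by linarith)
    _ ≤ ENNReal.ofReal (∑ i ∈ Finset.range n, realRisk P f cubeRootHistogram i) +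
        ENNReal.ofReal (δ * (n : ℝ) ^ (1 / 3 : ℝ)) := ENNReal.ofReal_add_le
    _ = cumRisk P cubeRootHistogram n + δ * cubeRoot n := by
        rw [isBoundedStrategy_cubeRootHistogram.cumRisk_eq hf.toHasBoundedDensity,
          ENNReal.ofReal_mul (NNReal.coe_nonneg δ), ENNReal.ofReal_coe_nnreal, cubeRoot]
    _ ≤ _ := add_le_add (le_iSup₂ (f := fun P (_ : P ∈ smoothClass c₀ c₁ c₂) =>
        cumRisk P cubeRootHistogram n) P hP) le_rfl

theorem worstCumRisk_cubeRootHistogram_le (hc₀ : 0 < c₀) (n : ℕ) :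
    worstCumRisk (smoothClass c₀ c₁ c₂) cubeRootHistogram n ≤
      ENNReal.ofReal (3 * (c₂ ^ 2 / c₀ + 1)) * cubeRoot n := by
  refine iSup₂_le fun P hP => ?_
  obtain ⟨f, hf⟩ := exists_hasLipDensity hc₀ hP
  rw [isBoundedStrategy_cubeRootHistogram.cumRisk_eq hf.toHasBoundedDensity, cubeRoot,
    ← ENNReal.ofReal_mul (by positivity)]
  exact ENNReal.ofReal_le_ofReal
    (hf.sum_realRisk_cubeRootHistogram_le (nonneg_of_mem_smoothClass hP) n)

theorem volume_mem_smoothClass (hc₀ : c₀ ≤ 1) (hc₁ : 1 ≤ c₁) (hc₂ : 0 ≤ c₂) :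
    (volume : Measure I) ∈ smoothClass c₀ c₁ c₂ :=
  ⟨inferInstance, fun _ => 1, by simp, fun x _ =>
    ⟨hc₀, hc₁, differentiableWithinAt_const _, by simpa using hc₂⟩⟩

/-- The second prediction of the histogram estimator has positive risk, even for the uniform law. -/
theorem worstCumRisk_cubeRootHistogram_pos (hc₀ : c₀ ≤ 1) (hc₁ : 1 ≤ c₁)
    (hc₂ : 0 ≤ c₂) {n : ℕ} (hn : 2 ≤ n) :
    0 < worstCumRisk (smoothClass c₀ c₁ c₂) cubeRootHistogram n := by
  have hP : HasBoundedDensity (volume : Measure I) (fun _ => 1) 1 1 :=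
    ⟨inferInstance, by simp, measurable_const, one_pos, fun _ => le_rfl, fun _ => le_rfl⟩
  have hbins : cubeRootBins 1 = 2 := by
    refine le_antisymm (cubeRootBins_le (by norm_num)) ?_
    rw [cubeRootBins, Nat.succ_le_iff, Nat.lt_ceil]
    have : (1 : ℝ) < (((1 : ℕ) : ℝ) + 1) ^ (1 / 3 : ℝ) :=
      Real.one_lt_rpow (by norm_num) (by norm_num)
    simpa using this
  have hrisk : realRisk volume (fun _ => 1) cubeRootHistogram 1 =
      Real.log 3 - Real.log 2 - 1 / 2 * Real.log 2 := by
    change realRisk volume (fun _ => 1) (histogram (cubeRootBins 1)) 1 = _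
    rw [hbins, realRisk_histogram hP (by norm_num)]
    have : ∀ y : I, binomLog (binProb volume 2 y) 1 = 1 / 2 * Real.log 2 := by
      intro y
      rw [binProb, volume_real_bin_eq (by norm_num)]
      simp [binomLog, binomMean]
      norm_num
    simp only [this]
    simp
    norm_num
  have hpos : 0 < Real.log 3 - Real.log 2 - 1 / 2 * Real.log 2 := by
    have h : Real.log (2 ^ 3) < Real.log (3 ^ 2) := Real.log_lt_log (by norm_num) (by norm_num)
    rw [Real.log_pow, Real.log_pow] at h
    push_cast at h
    linarith
  have hle : cumRisk volume cubeRootHistogram n ≤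
      worstCumRisk (smoothClass c₀ c₁ c₂) cubeRootHistogram n :=
    le_iSup₂ (f := fun P (_ : P ∈ smoothClass c₀ c₁ c₂) => cumRisk P cubeRootHistogram n) _
      (volume_mem_smoothClass hc₀ hc₁ hc₂)
  refine lt_of_lt_of_le ?_ hle
  rw [isBoundedStrategy_cubeRootHistogram.cumRisk_eq hP, ENNReal.ofReal_pos]
  refine lt_of_lt_of_le (hrisk ▸ hpos) (Finset.single_le_sum
    (fun i _ => (isBoundedStrategy_cubeRootHistogram.klRisk_eq hP i).1)
    (Finset.mem_range.2 (by omega)))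

end Asymptotic

/-! ### Perturbations of the uniform density -/

/-- A smooth 1-periodic function with mean zero that vanishes to second order at the integers. -/
def bump (u : ℝ) : ℝ := Real.sin (2 * Real.pi * u) ^ 3

theorem continuous_bump : Continuous bump := by unfold bump; fun_prop

theorem abs_bump_le_one (u : ℝ) : |bump u| ≤ 1 := by
  rw [bump, abs_pow]
  exact pow_le_one₀ (abs_nonneg _) (Real.abs_sin_le_one _)

theorem bump_periodic : Function.Periodic bump 1 := by
  intro u
  rw [bump, bump, mul_add, mul_one, Real.sin_add_two_pi]

theorem hasDerivAt_bump (u : ℝ) : HasDerivAt bump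
    (6 * Real.pi * Real.sin (2 * Real.pi * u) ^ 2 * Real.cos (2 * Real.pi * u)) u := by
  have h1 : HasDerivAt (fun u : ℝ => 2 * Real.pi * u) (2 * Real.pi) u := by
    simpa using (hasDerivAt_id u).const_mul (2 * Real.pi)
  refine (h1.sin.pow 3).congr_deriv ?_
  push_cast
  ring

theorem sin_two_pi_mul_natCast (j : ℕ) : Real.sin (2 * Real.pi * j) = 0 := by
  rw [mul_comm 2, mul_assoc, mul_comm]
  exact_mod_cast Real.sin_nat_mul_pi (2 * j)

theorem bump_natCast (j : ℕ) : bump j = 0 := by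
  rw [bump, sin_two_pi_mul_natCast]; norm_num

theorem integral_comp_two_pi_mul (g : ℝ → ℝ) :
    ∫ u in (0 : ℝ)..1, g (2 * Real.pi * u) = (2 * Real.pi)⁻¹ * ∫ u in 0..(2 * Real.pi), g u := by
  rw [intervalIntegral.integral_comp_mul_left g (by positivity)]
  simp

theorem integral_bump : ∫ u in (0 : ℝ)..1, bump u = 0 := by
  unfold bump
  rw [integral_comp_two_pi_mul fun u => Real.sin u ^ 3, integral_sin_pow (n := 1)]
  simp

theorem integral_bump_sq : ∫ u in (0 : ℝ)..1, bump u ^ 2 = 5 / 16 := by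
  have h : (fun u => bump u ^ 2) = fun u => (fun z => Real.sin z ^ 6) (2 * Real.pi * u) := by
    funext u
    rw [bump, ← pow_mul]
  rw [h, integral_comp_two_pi_mul fun z => Real.sin z ^ 6, integral_sin_pow (n := 4), integral_sin_pow (n := 2),
    integral_sin_pow (n := 0)]
  have := Real.pi_pos.ne'
  simp
  field_simp
  norm_num

/-- Changing the sign of `bump` on the cells between consecutive integers keeps it
differentiable. -/
theorem hasDerivAt_sign_mul_bump {v : ℕ → ℝ} (hv : ∀ j, |v j| ≤ 1) {x : ℝ} (hx : 0 ≤ x) :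
    HasDerivAt (fun y => v ⌊y⌋₊ * bump y)
      (v ⌊x⌋₊ * (6 * Real.pi * Real.sin (2 * Real.pi * x) ^ 2 * Real.cos (2 * Real.pi * x))) x := by
  rcases (Nat.floor_le hx).eq_or_lt with h | h
  · have hs : Real.sin (2 * Real.pi * x) = 0 := by rw [← h, sin_two_pi_mul_natCast]
    have hb : bump x = 0 := by rw [← h, bump_natCast]
    have hd := hasDerivAt_bump x
    rw [hs] at hd ⊢
    rw [hasDerivAt_iff_isLittleO] at hd ⊢
    simp only [hb, sub_zero, mul_zero, ne_eq, OfNat.ofNat_ne_zero, not_false_eq_true, zero_pow,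
      zero_mul, smul_zero] at hd ⊢
    refine IsBigO.trans_isLittleO (IsBigO.of_bound 1 (Eventually.of_forall fun y => ?_)) hd
    rw [norm_mul]
    exact mul_le_mul_of_nonneg_right (hv _) (norm_nonneg _)
  · refine ((hasDerivAt_bump x).const_mul (v ⌊x⌋₊)).congr_of_eventuallyEq ?_
    filter_upwards [Ioo_mem_nhds h (Nat.lt_floor_add_one x)] with y hy
    have : ⌊y⌋₊ = ⌊x⌋₊ := by
      rw [Nat.floor_eq_iff ((Nat.cast_nonneg _).trans hy.1.le)]
      exact ⟨hy.1.le, hy.2⟩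
    rw [this]

/-- The `j`-th of the `m` cells `[j / m, (j + 1) / m)`. -/
def cell (m j : ℕ) : Set I := {x | ⌊(m : ℝ) * (x : ℝ)⌋₊ = j}

theorem measurableSet_cell (m j : ℕ) : MeasurableSet (cell m j) := by
  have h : Measurable fun x : I => ⌊(m : ℝ) * (x : ℝ)⌋₊ :=
    Nat.measurable_floor.comp (measurable_const.mul measurable_subtype_coe)
  exact h (measurableSet_singleton j)

theorem cell_eq_preimage {m j : ℕ} (hj : j < m) :
    cell m j = ((↑) : I → ℝ) ⁻¹' Set.Ico ((j : ℝ) / m) ((j + 1) / m) := by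
  have hm : (0 : ℝ) < m := by exact_mod_cast (Nat.zero_le j).trans_lt hj
  ext x
  have h0 : 0 ≤ (m : ℝ) * (x : ℝ) := mul_nonneg hm.le x.2.1
  rw [cell, Set.mem_ofPred_eq, Nat.floor_eq_iff h0, Set.mem_preimage, Set.mem_Ico,
    div_le_iff₀ hm, lt_div_iff₀ hm, mul_comm]

theorem setIntegral_cell {m j : ℕ} (hj : j < m) {h : ℝ → ℝ} (hp : Function.Periodic h 1) :
    ∫ x in cell m j, h (m * x) = (∫ u in (0 : ℝ)..1, h u) / m := by
  have hm : (0 : ℝ) < m := by exact_mod_cast (Nat.zero_le j).trans_lt hj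
  have hjm : ((j : ℝ) + 1) ≤ m := by exact_mod_cast hj
  rw [cell_eq_preimage hj, unitInterval.measurePreserving_coe.setIntegral_preimage_emb
    (MeasurableEmbedding.subtype_coe measurableSet_Icc) (fun y : ℝ => h (m * y)),
    Measure.restrict_restrict measurableSet_Ico, Set.inter_eq_left.2, integral_Ico_eq_integral_Ioc,
    ← intervalIntegral.integral_of_le (by gcongr; linarith),
    intervalIntegral.integral_comp_mul_left h hm.ne', mul_div_cancel₀ _ hm.ne',
    mul_div_cancel₀ _ hm.ne', hp.intervalIntegral_add_eq (j : ℝ) 0, zero_add, smul_eq_mul]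
  · ring
  · intro y hy
    have h1 : (0 : ℝ) ≤ (j : ℝ) / m := by positivity
    have h2 : ((j : ℝ) + 1) / m ≤ 1 := (div_le_one hm).2 hjm
    exact ⟨h1.trans hy.1, hy.2.le.trans h2⟩

theorem pairwiseDisjoint_cell (m : ℕ) (s : Set ℕ) : s.PairwiseDisjoint (cell m) := by
  intro i _ j _ hij
  refine Set.disjoint_left.2 fun x hi hj => hij ?_
  exact hi.symm.trans hj

theorem ae_mem_iUnion_cell {m : ℕ} (hm : 1 ≤ m) :
    ∀ᵐ x : I, x ∈ ⋃ j ∈ Finset.range m, cell m j := by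
  have h1 : ∀ᵐ x : I, x ≠ 1 := by
    simp [ae_iff]
  filter_upwards [h1] with x hx
  simp only [Finset.mem_range, Set.mem_iUnion, exists_prop]
  refine ⟨⌊(m : ℝ) * (x : ℝ)⌋₊, ?_, rfl⟩
  have hx1 : (x : ℝ) < 1 := lt_of_le_of_ne x.2.2 fun h => hx (Subtype.ext h)
  have hm' : (0 : ℝ) < m := by exact_mod_cast hm
  rw [Nat.floor_lt (mul_nonneg hm'.le x.2.1)]
  nlinarith

/-- The signs of the perturbation: positive on the cells in `w`. -/
def cellSign (w : Finset ℕ) (j : ℕ) : ℝ := if j ∈ w then 1 else -1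

theorem abs_cellSign (w : Finset ℕ) (j : ℕ) : |cellSign w j| = 1 := by
  rw [cellSign]; split_ifs <;> simp

/-- The perturbation of the uniform density that adds `± (a / m) bump` on each of `m` cells, with
positive sign on the cells in `w`. -/
def perturbed (a : ℝ) (m : ℕ) (w : Finset ℕ) (x : ℝ) : ℝ :=
  1 + a / m * (cellSign w ⌊(m : ℝ) * x⌋₊ * bump (m * x))

theorem abs_perturbed_sub_one_le {a : ℝ} (ha : 0 ≤ a) {m : ℕ} (hm : 1 ≤ m) (w : Finset ℕ) (x : ℝ) :
    |perturbed a m w x - 1| ≤ a := by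
  have hm' : (1 : ℝ) ≤ m := by exact_mod_cast hm
  rw [perturbed, add_sub_cancel_left, abs_mul, abs_mul, abs_cellSign, one_mul,
    abs_of_nonneg (by positivity)]
  calc a / m * |bump (m * x)| ≤ a / m * 1 :=
        mul_le_mul_of_nonneg_left (abs_bump_le_one _) (by positivity)
    _ ≤ a := by rw [mul_one]; exact div_le_self ha hm'

theorem measurable_perturbed (a : ℝ) (m : ℕ) (w : Finset ℕ) :
    Measurable fun x : I => perturbed a m w x := by
  have h1 : Measurable fun x : I => ⌊(m : ℝ) * (x : ℝ)⌋₊ :=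
    Nat.measurable_floor.comp (measurable_const.mul measurable_subtype_coe)
  have h2 : Measurable fun x : I => cellSign w ⌊(m : ℝ) * (x : ℝ)⌋₊ :=
    (measurable_from_nat (f := cellSign w)).comp h1
  have h3 : Measurable fun x : I => bump (m * x) :=
    continuous_bump.measurable.comp (measurable_const.mul measurable_subtype_coe)
  exact measurable_const.add (measurable_const.mul (h2.mul h3))

theorem integrable_perturbed {a : ℝ} (ha : 0 ≤ a) {m : ℕ} (hm : 1 ≤ m) (w : Finset ℕ) :
    Integrable (fun x : I => perturbed a m w x) := by
  refine Integrable.of_bound (measurable_perturbed a m w).aestronglyMeasurable (1 + a)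
    (ae_of_all _ fun x => ?_)
  have := abs_le.1 (abs_perturbed_sub_one_le ha hm w x)
  rw [Real.norm_eq_abs, abs_le]
  constructor <;> linarith

theorem hasDerivAt_perturbed (a : ℝ) {m : ℕ} (hm : 1 ≤ m) (w : Finset ℕ) {x : ℝ} (hx : 0 ≤ x) :
    ∃ d, HasDerivAt (perturbed a m w) d x ∧ |d| ≤ |a| * (6 * Real.pi) := by
  have hm' : (0 : ℝ) < m := by exact_mod_cast hm
  have h1 := hasDerivAt_sign_mul_bump (v := cellSign w) (fun j => (abs_cellSign w j).le)
    (mul_nonneg hm'.le hx)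
  have h2 : HasDerivAt (fun x : ℝ => (m : ℝ) * x) m x := by
    simpa using (hasDerivAt_id x).const_mul (m : ℝ)
  have h3 := ((h1.comp x h2).const_mul (a / m)).const_add 1
  refine ⟨_, h3, ?_⟩
  have h4 : ∀ s c θ : ℝ, |θ| = 1 → |s| ≤ 1 → |c| ≤ 1 →
      |a / m * (θ * (6 * Real.pi * s ^ 2 * c) * m)| ≤ |a| * (6 * Real.pi) := by
    intro s c θ hθ hs hc
    have e : a / m * (θ * (6 * Real.pi * s ^ 2 * c) * m) = a * (6 * Real.pi) * (θ * (s ^ 2 * c)) := by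
      field_simp
    have h5 : |θ * (s ^ 2 * c)| ≤ 1 := by
      rw [abs_mul, hθ, one_mul, abs_mul, abs_pow]
      exact mul_le_one₀ (pow_le_one₀ (abs_nonneg _) hs) (abs_nonneg _) hc
    rw [e, abs_mul, abs_mul, abs_of_pos (by positivity : 0 < 6 * Real.pi)]
    exact mul_le_of_le_one_right (by positivity) h5
  exact h4 _ _ _ (abs_cellSign _ _) (Real.abs_sin_le_one _) (Real.abs_cos_le_one _)

theorem integral_perturbed (a : ℝ) {m : ℕ} (hm : 1 ≤ m) (w : Finset ℕ) :
    ∫ x : I, perturbed a m w x = 1 := by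
  have hI : Integrable fun x : I => cellSign w ⌊(m : ℝ) * (x : ℝ)⌋₊ * bump (m * x) := by
    have := (integrable_perturbed zero_le_one hm w).sub (integrable_const 1) |>.const_mul (m : ℝ)
    refine this.congr (ae_of_all _ fun x => ?_)
    have hm' : (m : ℝ) ≠ 0 := by exact_mod_cast (by omega : m ≠ 0)
    simp only [Pi.sub_apply, perturbed]
    field_simp
    ring
  have h0 : ∫ x : I, cellSign w ⌊(m : ℝ) * (x : ℝ)⌋₊ * bump (m * x) = 0 := by
    rw [← Measure.restrict_eq_self_of_ae_mem (ae_mem_iUnion_cell hm),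
      integral_biUnion_finset _ (fun j _ => measurableSet_cell m j)
        (pairwiseDisjoint_cell m _) fun j _ => hI.integrableOn]
    refine Finset.sum_eq_zero fun j hj => ?_
    have h1 : ∫ x in cell m j, cellSign w ⌊(m : ℝ) * (x : ℝ)⌋₊ * bump (m * x) =
        ∫ x in cell m j, cellSign w j * bump (m * x) :=
      setIntegral_congr_fun (measurableSet_cell m j) fun x hx => by
        have hx' : ⌊(m : ℝ) * (x : ℝ)⌋₊ = j := hx
        simp only [hx']
    rw [h1, integral_const_mul, setIntegral_cell (Finset.mem_range.1 hj) bump_periodic,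
      integral_bump]
    simp
  simp only [perturbed]
  rw [integral_add (integrable_const _) (hI.const_mul _), integral_const_mul, h0]
  simp

/-- The law with density `perturbed a m w`. -/
def perturbedLaw (a : ℝ) (m : ℕ) (w : Finset ℕ) : Measure I :=
  volume.withDensity fun x => ENNReal.ofReal (perturbed a m w x)

theorem hasBoundedDensity_perturbed {a : ℝ} (ha : 0 ≤ a) (ha1 : a ≤ 1 / 4) {m : ℕ} (hm : 1 ≤ m)
    (w : Finset ℕ) :
    HasBoundedDensity (perturbedLaw a m w) (fun x => perturbed a m w x) (3 / 4) (5 / 4) := by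
  have hb := fun x : I => abs_le.1 (abs_perturbed_sub_one_le ha hm w x)
  refine ⟨⟨?_⟩, rfl, measurable_perturbed a m w, by norm_num, fun x => by linarith [(hb x).1],
    fun x => by linarith [(hb x).2]⟩
  rw [perturbedLaw, withDensity_apply _ MeasurableSet.univ, setLIntegral_univ,
    ← ofReal_integral_eq_lintegral_ofReal (integrable_perturbed ha hm w)
      (ae_of_all _ fun x => by simp only [Pi.zero_apply]; linarith [(hb x).1]),
    integral_perturbed a hm w, ENNReal.ofReal_one]

theorem perturbedLaw_mem_smoothClass {c₀ c₁ c₂ a : ℝ} (ha : 0 ≤ a) (ha1 : a ≤ 1 / 4)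
    (h0 : a ≤ 1 - c₀) (h1 : a ≤ c₁ - 1) (h2 : a * (6 * Real.pi) ≤ c₂) {m : ℕ} (hm : 1 ≤ m)
    (w : Finset ℕ) : perturbedLaw a m w ∈ smoothClass c₀ c₁ c₂ := by
  refine ⟨(hasBoundedDensity_perturbed ha ha1 hm w).prob, perturbed a m w, rfl, fun x hx => ?_⟩
  have hb := abs_le.1 (abs_perturbed_sub_one_le ha hm w x)
  obtain ⟨d, hd, hd'⟩ := hasDerivAt_perturbed a hm w hx.1
  rw [abs_of_nonneg ha] at hd'
  refine ⟨by linarith, by linarith, hd.differentiableAt.differentiableWithinAt, ?_⟩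
  rw [hd.hasDerivWithinAt.derivWithin (uniqueDiffOn_Icc zero_lt_one x hx)]
  exact hd'.trans h2

/-- Changing the sign on one cell. -/
theorem perturbed_flip (a : ℝ) (m j : ℕ) (w : Finset ℕ) (x : I) :
    (perturbed a m w x - perturbed a m (symmDiff w {j}) x) ^ 2 =
      (cell m j).indicator (fun x => (2 * a / m) ^ 2 * bump (m * x) ^ 2) x := by
  by_cases hx : x ∈ cell m j
  · have hx' : ⌊(m : ℝ) * (x : ℝ)⌋₊ = j := hx
    rw [Set.indicator_of_mem hx, perturbed, perturbed, hx']
    have : cellSign (symmDiff w {j}) j = -cellSign w j := by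
      simp only [cellSign, Finset.mem_symmDiff, Finset.mem_singleton]
      by_cases h : j ∈ w <;> simp [h]
    have hs : cellSign w j ^ 2 = 1 := by rw [← sq_abs, abs_cellSign, one_pow]
    rw [this]
    linear_combination (2 * a / m) ^ 2 * bump (m * x) ^ 2 * hs
  · have hx' : ⌊(m : ℝ) * (x : ℝ)⌋₊ ≠ j := hx
    have : cellSign (symmDiff w {j}) ⌊(m : ℝ) * (x : ℝ)⌋₊ = cellSign w ⌊(m : ℝ) * (x : ℝ)⌋₊ := by
      simp [cellSign, Finset.mem_symmDiff, hx']
    rw [Set.indicator_of_notMem hx, perturbed, perturbed, this]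
    ring

theorem integral_perturbed_flip_sq (a : ℝ) {m j : ℕ} (hj : j < m) (w : Finset ℕ) :
    ∫ x : I, (perturbed a m w x - perturbed a m (symmDiff w {j}) x) ^ 2 =
      5 * a ^ 2 / (4 * m ^ 3) := by
  have hm : (0 : ℝ) < m := by exact_mod_cast (Nat.zero_le j).trans_lt hj
  have hp : Function.Periodic (fun u => (2 * a / m) ^ 2 * bump u ^ 2) 1 := fun u => by
    simp only [bump_periodic u]
  simp only [perturbed_flip]
  rw [integral_indicator (measurableSet_cell m j), setIntegral_cell hj hp,
    intervalIntegral.integral_const_mul, integral_bump_sq]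
  field_simp
  ring

/-! ### Hellinger lower bound for the Kullback–Leibler divergence -/

theorem sq_sqrt_sub_sqrt_le_mul_klFun {f q : ℝ} (hf : 0 < f) (hq : 0 < q) :
    (Real.sqrt f - Real.sqrt q) ^ 2 ≤ q * InformationTheory.klFun (f / q) := by
  have hsf := Real.sqrt_pos.2 hf
  have hsq := Real.sqrt_pos.2 hq
  have h1 := Real.log_le_sub_one_of_pos (div_pos hsq hsf)
  rw [Real.log_div hsq.ne' hsf.ne', Real.log_sqrt hq.le, Real.log_sqrt hf.le] at h1
  have e1 : q * InformationTheory.klFun (f / q) = f * (Real.log f - Real.log q) + q - f := by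
    rw [InformationTheory.klFun_apply, Real.log_div hf.ne' hq.ne']
    field_simp
  have e2 : f * (Real.sqrt q / Real.sqrt f - 1) = Real.sqrt f * Real.sqrt q - f := by
    have : f = Real.sqrt f ^ 2 := (Real.sq_sqrt hf.le).symm
    rw [mul_sub, mul_one]
    congr 1
    nth_rewrite 1 [this]
    field_simp
  rw [e1]
  have h2 := mul_le_mul_of_nonneg_left h1 hf.le
  rw [e2] at h2
  nlinarith [Real.sq_sqrt hf.le, Real.sq_sqrt hq.le]

/-- The Kullback–Leibler divergence is at least the squared Hellinger distance. -/
theorem lintegral_sq_sqrt_sub_le_klDiv {P : Measure I} {f : I → ℝ} {c₀ c₁ : ℝ}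
    (hP : HasBoundedDensity P f c₀ c₁) {q : I → ℝ≥0∞} (hq : Measurable q)
    (hq1 : ∫⁻ x, q x = 1) :
    ∫⁻ x, ENNReal.ofReal ((Real.sqrt (f x) - Real.sqrt (q x).toReal) ^ 2) ≤
      InformationTheory.klDiv P (volume.withDensity q) := by
  by_cases hac : P ≪ volume.withDensity q
  swap
  · rw [InformationTheory.klDiv_of_not_ac hac]; exact le_top
  have := hP.prob
  have := isProbabilityMeasure_withDensity_of_lintegral_eq_one hq1
  have hqt : ∀ᵐ x, q x ≠ ∞ := (ae_lt_top hq (by simp [hq1])).mono fun x hx => hx.ne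
  have hvol : (volume : Measure I) ≪ P := by
    rw [hP.eq_withDensity]
    refine withDensity_absolutelyContinuous' hP.measurable.ennreal_ofReal.aemeasurable
      (ae_of_all _ fun x => ?_)
    exact (ENNReal.ofReal_pos.2 (hP.f_pos x)).ne'
  have hq0 : ∀ᵐ x, q x ≠ 0 := by
    have h1 : ∀ᵐ x ∂(volume.withDensity q), q x ≠ 0 := by
      rw [ae_withDensity_iff hq]
      exact ae_of_all _ fun x hx => hx
    exact (hvol.trans hac).ae_le h1
  rw [InformationTheory.klDiv_eq_lintegral_klFun_of_ac hac]
  have hrn := rnDeriv_withDensity_div hP hq hq1 hq0 hqt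
  rw [lintegral_congr_ae (hrn.mono fun x hx => by rw [hx])]
  have hm : Measurable fun x => ENNReal.ofReal
      (InformationTheory.klFun ((ENNReal.ofReal (f x) / q x).toReal)) :=
    (InformationTheory.measurable_klFun.comp
      (hP.measurable.ennreal_ofReal.div hq).ennreal_toReal).ennreal_ofReal
  rw [lintegral_withDensity_eq_lintegral_mul _ hq hm]
  refine lintegral_mono_ae ?_
  filter_upwards [hq0, hqt] with x h0 ht
  have hqp := ENNReal.toReal_pos h0 ht
  rw [Pi.mul_apply, ENNReal.toReal_div, ENNReal.toReal_ofReal (hP.f_pos x).le]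
  nth_rewrite 2 [← ENNReal.ofReal_toReal ht]
  rw [← ENNReal.ofReal_mul hqp.le]
  exact ENNReal.ofReal_le_ofReal (sq_sqrt_sub_sqrt_le_mul_klFun (hP.f_pos x) hqp)

/-! ### Affinity of product laws -/

theorem pi_withDensity {n : ℕ} {g : I → ℝ≥0∞} (hg : Measurable g)
    (hg1 : ∫⁻ x, g x = 1) :
    (Measure.pi fun _ : Fin n => (volume : Measure I).withDensity g) =
      (Measure.pi fun _ : Fin n => (volume : Measure I)).withDensity fun x => ∏ i, g (x i) := by
  have := isProbabilityMeasure_withDensity_of_lintegral_eq_one hg1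
  refine (Measure.pi_eq fun s hs => ?_)
  rw [withDensity_apply _ (MeasurableSet.univ_pi hs),
    ← lintegral_indicator (MeasurableSet.univ_pi hs)]
  have h1 : (Set.univ.pi s).indicator (fun x : Fin n → I => ∏ i, g (x i)) =
      fun x => ∏ i, (s i).indicator g (x i) := by
    funext x
    by_cases hx : x ∈ Set.univ.pi s
    · rw [Set.indicator_of_mem hx]
      exact Finset.prod_congr rfl fun i _ => (Set.indicator_of_mem (hx i trivial) g).symm
    · rw [Set.indicator_of_notMem hx]
      simp only [Set.mem_pi, Set.mem_univ, true_imp_iff, not_forall] at hx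
      obtain ⟨i, hi⟩ := hx
      exact (Finset.prod_eq_zero (Finset.mem_univ i) (Set.indicator_of_notMem hi g)).symm
  have hm : ∀ i, Measurable ((s i).indicator g) := fun i => hg.indicator (hs i)
  have hind := ProbabilityTheory.iIndepFun_pi (μ := fun _ : Fin n => (volume : Measure I))
    (X := fun i => (s i).indicator g) fun i => (hm i).aemeasurable
  rw [h1, ProbabilityTheory.lintegral_prod_eq_prod_lintegral_of_indepFun Finset.univ
    (fun i (x : Fin n → I) => (s i).indicator g (x i)) hind
    fun i => (hm i).comp (measurable_pi_apply i)]
  refine Finset.prod_congr rfl fun i _ => ?_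
  rw [(measurePreserving_eval (fun _ : Fin n => (volume : Measure I)) i).lintegral_comp (hm i),
    lintegral_indicator (hs i), withDensity_apply _ (hs i)]

theorem HasBoundedDensity.lintegral_eq_one {P : Measure I} {f : I → ℝ} {c₀ c₁ : ℝ}
    (hP : HasBoundedDensity P f c₀ c₁) : ∫⁻ x, ENNReal.ofReal (f x) = 1 := by
  rw [← ofReal_integral_eq_lintegral_ofReal hP.integrable (ae_of_all _ fun x => (hP.f_pos x).le),
    hP.integral_eq_one, ENNReal.ofReal_one]

theorem HasBoundedDensity.pi_eq {P : Measure I} {f : I → ℝ} {c₀ c₁ : ℝ}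
    (hP : HasBoundedDensity P f c₀ c₁) (n : ℕ) : (Measure.pi fun _ : Fin n => P) =
      (Measure.pi fun _ : Fin n => (volume : Measure I)).withDensity
        fun x => ENNReal.ofReal (∏ i, f (x i)) := by
  conv_lhs => rw [hP.eq_withDensity]
  rw [pi_withDensity hP.measurable.ennreal_ofReal hP.lintegral_eq_one]
  congr 1
  funext x
  rw [ENNReal.ofReal_prod_of_nonneg fun i _ => (hP.f_pos _).le]

theorem sqrt_mul_le_min {x y : ℝ} (hx : 0 ≤ x) (hy : 0 ≤ y) :
    Real.sqrt (x * y) ≤ 3 / 4 * min x y + (x + y) / 4 := by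
  have hm : 0 ≤ min x y := le_min hx hy
  rw [Real.sqrt_le_left (by positivity)]
  rcases le_total x y with h | h
  · rw [min_eq_left h]; nlinarith [sq_nonneg (x - y / 4)]
  · rw [min_eq_right h]; nlinarith [sq_nonneg (y - x / 4)]

theorem le_sqrt_mul {x y : ℝ} (hx : 3 / 4 ≤ x) (hy : 3 / 4 ≤ y) :
    (x + y) / 2 - (x - y) ^ 2 / 4 ≤ Real.sqrt (x * y) := by
  have h1 := Real.sqrt_nonneg x
  have h2 := Real.sqrt_nonneg y
  have h3 := Real.sq_sqrt (by linarith : 0 ≤ x)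
  have h4 := Real.sq_sqrt (by linarith : 0 ≤ y)
  rw [Real.sqrt_mul (by linarith)]
  set s := Real.sqrt x
  set t := Real.sqrt y
  have h5 : (x - y) ^ 2 = (s - t) ^ 2 * (s + t) ^ 2 := by rw [← h3, ← h4]; ring
  have h7 : 2 ≤ (s + t) ^ 2 := by
    have hst : 3 / 4 ≤ s * t := by
      have : (3 / 4 : ℝ) ^ 2 ≤ (s * t) ^ 2 := by
        rw [mul_pow, h3, h4]; nlinarith
      exact le_of_pow_le_pow_left₀ (by norm_num) (by positivity) this
    nlinarith
  nlinarith [mul_nonneg (sq_nonneg (s - t)) (by linarith : 0 ≤ (s + t) ^ 2 - 2)]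

/-- Two product laws whose marginal densities are `L²`-close overlap substantially. -/
theorem half_le_lintegral_min {P P' : Measure I} {f f' : I → ℝ} {c₁ c₁' : ℝ}
    (hP : HasBoundedDensity P f (3 / 4) c₁) (hP' : HasBoundedDensity P' f' (3 / 4) c₁') (n : ℕ)
    (hn : n * ∫ x, (f x - f' x) ^ 2 ≤ 1 / 2) :
    ENNReal.ofReal (1 / 2) ≤ ∫⁻ x : Fin n → I, min (ENNReal.ofReal (∏ i, f (x i)))
      (ENNReal.ofReal (∏ i, f' (x i))) ∂(Measure.pi fun _ => volume) := by
  set μ : Measure (Fin n → I) := Measure.pi fun _ => volume with hμ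
  have hF0 : ∀ x : Fin n → I, 0 ≤ ∏ i, f (x i) := fun x =>
    Finset.prod_nonneg fun i _ => (hP.f_pos _).le
  have hF0' : ∀ x : Fin n → I, 0 ≤ ∏ i, f' (x i) := fun x =>
    Finset.prod_nonneg fun i _ => (hP'.f_pos _).le
  have hFi : Integrable (fun x : Fin n → I => ∏ i, f (x i)) μ :=
    Integrable.fintype_prod fun _ => hP.integrable
  have hFi' : Integrable (fun x : Fin n → I => ∏ i, f' (x i)) μ :=
    Integrable.fintype_prod fun _ => hP'.integrable
  have hF1 : ∫ x : Fin n → I, ∏ i, f (x i) ∂μ = 1 := by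
    rw [hμ, integral_fintype_prod_eq_pow, hP.integral_eq_one, one_pow]
  have hF1' : ∫ x : Fin n → I, ∏ i, f' (x i) ∂μ = 1 := by
    rw [hμ, integral_fintype_prod_eq_pow, hP'.integral_eq_one, one_pow]
  have hmin : Integrable (fun x : Fin n → I => min (∏ i, f (x i)) (∏ i, f' (x i))) μ :=
    hFi.inf hFi'
  -- the affinity `∫ √(f f')` of the marginals is close to one
  have hsm : Measurable fun x => Real.sqrt (f x * f' x) := (hP.measurable.mul hP'.measurable).sqrt
  have hle : ∀ x, Real.sqrt (f x * f' x) ≤ (f x + f' x) / 2 := fun x => by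
    have h1 := hP.f_pos x
    have h2 := hP'.f_pos x
    rw [Real.sqrt_le_left (by positivity)]
    nlinarith [sq_nonneg (f x - f' x)]
  have hsum : Integrable (fun x => (f x + f' x) / 2) volume :=
    (hP.integrable.add hP'.integrable).div_const 2
  have hsi : Integrable (fun x => Real.sqrt (f x * f' x)) volume :=
    hsum.mono' hsm.aestronglyMeasurable (ae_of_all _ fun x => by
      rw [Real.norm_of_nonneg (Real.sqrt_nonneg _)]; exact hle x)
  have hsq : Integrable (fun x => (f x - f' x) ^ 2) volume := by
    refine Integrable.of_bound ((hP.measurable.sub hP'.measurable).pow_const 2).aestronglyMeasurable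
      ((c₁ + c₁') ^ 2) (ae_of_all _ fun x => ?_)
    have h1 := hP.f_pos x
    have h2 := hP'.f_pos x
    have h3 := hP.upper x
    have h4 := hP'.upper x
    rw [Real.norm_of_nonneg (sq_nonneg _)]
    nlinarith
  set h := ∫ x, (f x - f' x) ^ 2 with hh
  have hh0 : 0 ≤ h := integral_nonneg fun x => sq_nonneg _
  have hs1 : 1 - h / 4 ≤ ∫ x, Real.sqrt (f x * f' x) := by
    have hA : Integrable (fun x => (f x + f' x) / 2 - (f x - f' x) ^ 2 / 4) volume :=
      hsum.sub (hsq.div_const 4)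
    have h1 := integral_mono hA hsi fun x =>
      le_sqrt_mul (hP.lower x) (hP'.lower x)
    rw [integral_sub hsum (hsq.div_const 4), integral_div, integral_div,
      integral_add hP.integrable hP'.integrable, hP.integral_eq_one, hP'.integral_eq_one] at h1
    linarith
  have hsprod : ∀ x : Fin n → I, Real.sqrt ((∏ i, f (x i)) * ∏ i, f' (x i)) =
      ∏ i, Real.sqrt (f (x i) * f' (x i)) := by
    intro x
    rw [← Finset.prod_mul_distrib,
      Real.sqrt_prod _ fun i _ => mul_nonneg (hP.f_pos _).le (hP'.f_pos _).le]
  have hBC : 7 / 8 ≤ ∫ x : Fin n → I, Real.sqrt ((∏ i, f (x i)) * ∏ i, f' (x i)) ∂μ := by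
    simp only [hsprod]
    rw [hμ, integral_fintype_prod_eq_pow (fun x => Real.sqrt (f x * f' x)), Fintype.card_fin]
    rcases Nat.eq_zero_or_pos n with rfl | hnpos
    · norm_num
    have hn1 : (1 : ℝ) ≤ n := by exact_mod_cast hnpos
    have h1 : h ≤ 1 / 2 := by nlinarith
    have h2 := one_add_mul_le_pow (a := -(h / 4)) (by linarith) n
    calc (7 / 8 : ℝ) ≤ 1 + n * -(h / 4) := by nlinarith
      _ ≤ (1 + -(h / 4)) ^ n := h2
      _ ≤ _ := pow_le_pow_left₀ (by linarith) (by linarith) n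
  have hsI : Integrable (fun x : Fin n → I => Real.sqrt ((∏ i, f (x i)) * ∏ i, f' (x i))) μ := by
    simp only [hsprod]
    exact Integrable.fintype_prod fun _ => hsi
  have hfin : 1 / 2 ≤ ∫ x : Fin n → I, min (∏ i, f (x i)) (∏ i, f' (x i)) ∂μ := by
    have hS : Integrable (fun x : Fin n → I => (∏ i, f (x i) + ∏ i, f' (x i)) / 4) μ :=
      (hFi.add hFi').div_const 4
    have hA : Integrable (fun x : Fin n → I => 3 / 4 * min (∏ i, f (x i)) (∏ i, f' (x i)) +
        (∏ i, f (x i) + ∏ i, f' (x i)) / 4) μ := (hmin.const_mul (3 / 4)).add hS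
    have h1 := integral_mono hsI hA fun x => sqrt_mul_le_min (hF0 x) (hF0' x)
    rw [integral_add (hmin.const_mul (3 / 4)) hS, integral_const_mul,
      integral_div, integral_add hFi hFi', hF1, hF1'] at h1
    linarith
  refine (ENNReal.ofReal_le_ofReal hfin).trans ?_
  rw [ofReal_integral_eq_lintegral_ofReal hmin (ae_of_all _ fun x => le_min (hF0 x) (hF0' x))]
  refine lintegral_mono fun x => ?_
  rw [ENNReal.ofReal_min]

/-! ### The minimax lower bound -/

/-- The contribution of the `j`-th cell to the squared Hellinger distance between the perturbed law
and the density `q`. -/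
def cellLoss (a : ℝ) (m : ℕ) (w : Finset ℕ) (j : ℕ) (q : I → ℝ≥0∞) : ℝ≥0∞ :=
  ∫⁻ y in cell m j, ENNReal.ofReal ((Real.sqrt (perturbed a m w y) - Real.sqrt (q y).toReal) ^ 2)

theorem sq_sub_div_le {x y c : ℝ} (hx : 0 ≤ x) (hy : 0 ≤ y) (hx2 : x ≤ 2) (hy2 : y ≤ 2) :
    (x - y) ^ 2 / 16 ≤ (Real.sqrt x - c) ^ 2 + (Real.sqrt y - c) ^ 2 := by
  have h3 := Real.sq_sqrt hx
  have h4 := Real.sq_sqrt hy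
  set s := Real.sqrt x
  set t := Real.sqrt y
  have h5 : (x - y) ^ 2 = (s - t) ^ 2 * (s + t) ^ 2 := by rw [← h3, ← h4]; ring
  have h6 : (s + t) ^ 2 ≤ 8 := by nlinarith [sq_nonneg (s - t)]
  have h7 : (x - y) ^ 2 ≤ (s - t) ^ 2 * 8 := by
    rw [h5]; exact mul_le_mul_of_nonneg_left h6 (sq_nonneg _)
  nlinarith [sq_nonneg (s + t - 2 * c)]

section Assouad

variable {a : ℝ} {m : ℕ}

/-- No predictive density is close, on a cell, to both of two laws that differ there in sign. -/
theorem le_cellLoss_add_cellLoss (ha : 0 ≤ a) (ha1 : a ≤ 1 / 4) {j : ℕ} (hj : j < m)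
    (w : Finset ℕ) {q : I → ℝ≥0∞} (hq : Measurable q) :
    ENNReal.ofReal (5 * a ^ 2 / (64 * m ^ 3)) ≤
      cellLoss a m w j q + cellLoss a m (symmDiff w {j}) j q := by
  have hm : 1 ≤ m := by omega
  have hm' : (0 : ℝ) < m := by exact_mod_cast hm
  have hd := hasBoundedDensity_perturbed ha ha1 hm w
  have hd' := hasBoundedDensity_perturbed ha ha1 hm (symmDiff w {j})
  have hmeas : Measurable fun y : I => ENNReal.ofReal
      ((Real.sqrt (perturbed a m w y) - Real.sqrt (q y).toReal) ^ 2) :=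
    ((hd.measurable.sqrt.sub hq.ennreal_toReal.sqrt).pow_const 2).ennreal_ofReal
  have hp : Function.Periodic (fun u => (2 * a / m) ^ 2 * bump u ^ 2) 1 := fun u => by
    simp only [bump_periodic u]
  have hint : ∫ y : I, (perturbed a m w y - perturbed a m (symmDiff w {j}) y) ^ 2 / 16 =
      5 * a ^ 2 / (64 * m ^ 3) := by
    rw [integral_div, integral_perturbed_flip_sq a hj]
    field_simp
    ring
  have hI : Integrable fun y : I =>
      (perturbed a m w y - perturbed a m (symmDiff w {j}) y) ^ 2 / 16 := by
    refine Integrable.of_bound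
      (((hd.measurable.sub hd'.measurable).pow_const 2).div_const 16).aestronglyMeasurable 1
      (ae_of_all _ fun y => ?_)
    have h1 := hd.lower y
    have h2 := hd.upper y
    have h3 := hd'.lower y
    have h4 := hd'.upper y
    rw [Real.norm_of_nonneg (by positivity)]
    nlinarith
  rw [cellLoss, cellLoss, ← lintegral_add_left hmeas, ← hint,
    ofReal_integral_eq_lintegral_ofReal hI (ae_of_all _ fun y => by positivity),
    ← lintegral_indicator (measurableSet_cell m j)]
  refine lintegral_mono fun y => ?_
  by_cases hy : y ∈ cell m j
  · rw [Set.indicator_of_mem hy, ← ENNReal.ofReal_add (sq_nonneg _) (sq_nonneg _)]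
    exact ENNReal.ofReal_le_ofReal (sq_sub_div_le (hd.f_pos y).le (hd'.f_pos y).le
      ((hd.upper y).trans (by norm_num)) ((hd'.upper y).trans (by norm_num)))
  · simp [perturbed_flip, hy]

theorem measurable_cellLoss (a : ℝ) (m : ℕ) (w : Finset ℕ) (j : ℕ) {p : CondDensity}
    (hp : IsStrategy p) (n : ℕ) :
    Measurable fun x : Fin n → I => cellLoss a m w j (p n x) := by
  have h1 : Measurable fun z : (Fin n → I) × I => perturbed a m w z.2 :=
    (measurable_perturbed a m w).comp measurable_snd
  have h2 : Measurable fun z : (Fin n → I) × I => (p n z.1 z.2).toReal :=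
    (hp.measurable n).ennreal_toReal
  have h3 : Measurable fun z : (Fin n → I) × I => ENNReal.ofReal
      ((Real.sqrt (perturbed a m w z.2) - Real.sqrt (p n z.1 z.2).toReal) ^ 2) :=
    ((h1.sqrt.sub h2.sqrt).pow_const 2).ennreal_ofReal
  exact h3.lintegral_prod_right'

/-- The two-point bound: from at most `m ^ 3` outcomes the sign on a cell cannot be determined. -/
theorem le_lintegral_cellLoss_add (ha : 0 ≤ a) (ha1 : a ≤ 1 / 4) {j : ℕ} (hj : j < m)
    (w : Finset ℕ) {p : CondDensity} (hp : IsStrategy p) {n : ℕ} (hn : n ≤ m ^ 3) :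
    ENNReal.ofReal (5 * a ^ 2 / (128 * m ^ 3)) ≤
      ∫⁻ x : Fin n → I, cellLoss a m w j (p n x) ∂(Measure.pi fun _ => perturbedLaw a m w) +
      ∫⁻ x : Fin n → I, cellLoss a m (symmDiff w {j}) j (p n x)
        ∂(Measure.pi fun _ => perturbedLaw a m (symmDiff w {j})) := by
  have hm : 1 ≤ m := by omega
  have hm' : (0 : ℝ) < m := by exact_mod_cast hm
  have hd := hasBoundedDensity_perturbed ha ha1 hm w
  have hd' := hasBoundedDensity_perturbed ha ha1 hm (symmDiff w {j})
  have hF : ∀ w : Finset ℕ, Measurable fun x : Fin n → I =>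
      ENNReal.ofReal (∏ i, perturbed a m w (x i)) := fun w =>
    (Finset.measurable_fun_prod _ fun i _ =>
      (measurable_perturbed a m w).comp (measurable_pi_apply i)).ennreal_ofReal
  have hL := fun w => measurable_cellLoss a m w j hp n
  have hhalf := half_le_lintegral_min hd hd' n (by
    rw [integral_perturbed_flip_sq a hj]
    have h1 : (n : ℝ) ≤ (m : ℝ) ^ 3 := by exact_mod_cast hn
    have h2 : 0 ≤ 5 * a ^ 2 / (4 * (m : ℝ) ^ 3) := by positivity
    calc (n : ℝ) * (5 * a ^ 2 / (4 * m ^ 3)) ≤ m ^ 3 * (5 * a ^ 2 / (4 * m ^ 3)) :=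
          mul_le_mul_of_nonneg_right h1 h2
      _ = 5 / 4 * a ^ 2 := by field_simp
      _ ≤ 1 / 2 := by nlinarith)
  rw [hd.pi_eq n, hd'.pi_eq n, lintegral_withDensity_eq_lintegral_mul _ (hF w) (hL w),
    lintegral_withDensity_eq_lintegral_mul _ (hF _) (hL _),
    ← lintegral_add_left ((hF w).mul (hL w))]
  calc ENNReal.ofReal (5 * a ^ 2 / (128 * m ^ 3)) =
        ENNReal.ofReal (1 / 2) * ENNReal.ofReal (5 * a ^ 2 / (64 * m ^ 3)) := by
        rw [← ENNReal.ofReal_mul (by norm_num)]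
        congr 1
        field_simp
        ring
    _ ≤ (∫⁻ x : Fin n → I, min (ENNReal.ofReal (∏ i, perturbed a m w (x i)))
          (ENNReal.ofReal (∏ i, perturbed a m (symmDiff w {j}) (x i)))
            ∂(Measure.pi fun _ => volume)) * ENNReal.ofReal (5 * a ^ 2 / (64 * m ^ 3)) :=
        mul_le_mul_left hhalf _
    _ = ∫⁻ x : Fin n → I, min (ENNReal.ofReal (∏ i, perturbed a m w (x i)))
          (ENNReal.ofReal (∏ i, perturbed a m (symmDiff w {j}) (x i))) *
            ENNReal.ofReal (5 * a ^ 2 / (64 * m ^ 3)) ∂(Measure.pi fun _ => volume) :=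
        (lintegral_mul_const _ ((hF w).min (hF _))).symm
    _ ≤ _ := lintegral_mono fun x => by
        simp only [Pi.mul_apply]
        calc _ ≤ _ := mul_le_mul_right
              (le_cellLoss_add_cellLoss ha ha1 hj w (hp.measurable_right n x)) _
          _ ≤ _ := by
              rw [mul_add]
              exact add_le_add (mul_le_mul_left (min_le_left _ _) _)
                (mul_le_mul_left (min_le_right _ _) _)

theorem sum_cellLoss_le_klRisk (ha : 0 ≤ a) (ha1 : a ≤ 1 / 4) (hm : 1 ≤ m)
    (w : Finset ℕ) {p : CondDensity} (hp : IsStrategy p) (n : ℕ) :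
    ∑ j ∈ Finset.range m,
      ∫⁻ x : Fin n → I, cellLoss a m w j (p n x) ∂(Measure.pi fun _ => perturbedLaw a m w) ≤
      klRisk (perturbedLaw a m w) p n := by
  rw [← lintegral_finsetSum _ fun j _ => measurable_cellLoss a m w j hp n, klRisk]
  refine lintegral_mono fun x => ?_
  refine le_trans ?_ (lintegral_sq_sqrt_sub_le_klDiv (hasBoundedDensity_perturbed ha ha1 hm w)
    (hp.measurable_right n x) (hp.lintegral_eq_one n x))
  simp only [cellLoss]
  rw [← lintegral_biUnion_finset (pairwiseDisjoint_cell m _) fun j _ => measurableSet_cell m j]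
  exact setLIntegral_le_lintegral _ _

theorem sum_powerset_symmDiff {j : ℕ} (hj : j < m) (g : Finset ℕ → ℝ≥0∞) :
    ∑ w ∈ (Finset.range m).powerset, g (symmDiff w {j}) =
      ∑ w ∈ (Finset.range m).powerset, g w := by
  have hmem : ∀ w ∈ (Finset.range m).powerset, symmDiff w {j} ∈ (Finset.range m).powerset := by
    intro w hw
    rw [Finset.mem_powerset] at hw ⊢
    intro i hi
    rcases Finset.mem_symmDiff.1 hi with h | h
    · exact hw h.1
    · rw [Finset.mem_singleton.1 h.1]; exact Finset.mem_range.2 hj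
  exact Finset.sum_nbij' (fun w => symmDiff w {j}) (fun w => symmDiff w {j}) hmem hmem
    (fun w _ => symmDiff_symmDiff_cancel_right _ _) (fun w _ => symmDiff_symmDiff_cancel_right _ _)
    fun w _ => rfl

/-- Assouad's lemma: on average over the signs, each of the `m` cells contributes to the risk. -/
theorem le_sum_klRisk (ha : 0 ≤ a) (ha1 : a ≤ 1 / 4) (hm : 1 ≤ m)
    {p : CondDensity} (hp : IsStrategy p) {n : ℕ} (hn : n ≤ m ^ 3) :
    (2 ^ m : ℕ) * ENNReal.ofReal (5 * a ^ 2 / (256 * m ^ 2)) ≤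
      ∑ w ∈ (Finset.range m).powerset, klRisk (perturbedLaw a m w) p n := by
  have hm' : (0 : ℝ) < m := by exact_mod_cast hm
  set A : Finset ℕ → ℕ → ℝ≥0∞ := fun w j =>
    ∫⁻ x : Fin n → I, cellLoss a m w j (p n x) ∂(Measure.pi fun _ => perturbedLaw a m w) with hA
  have h1 : ∀ j ∈ Finset.range m, (2 ^ m : ℕ) * ENNReal.ofReal (5 * a ^ 2 / (256 * m ^ 3)) ≤
      ∑ w ∈ (Finset.range m).powerset, A w j := by
    intro j hj
    have hj' := Finset.mem_range.1 hj
    have h2 : (2 ^ m : ℕ) * ENNReal.ofReal (5 * a ^ 2 / (128 * m ^ 3)) ≤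
        ∑ w ∈ (Finset.range m).powerset, (A w j + A (symmDiff w {j}) j) := by
      have := Finset.card_nsmul_le_sum (Finset.range m).powerset
        (fun w => A w j + A (symmDiff w {j}) j) _
        fun w _ => le_lintegral_cellLoss_add ha ha1 hj' w hp hn
      rwa [Finset.card_powerset, Finset.card_range, nsmul_eq_mul] at this
    rw [Finset.sum_add_distrib, sum_powerset_symmDiff hj' (fun w => A w j), ← two_mul] at h2
    have h3 : ENNReal.ofReal (5 * a ^ 2 / (128 * m ^ 3)) =
        2 * ENNReal.ofReal (5 * a ^ 2 / (256 * m ^ 3)) := by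
      rw [← ENNReal.ofReal_ofNat, ← ENNReal.ofReal_mul (by norm_num)]
      congr 1
      field_simp
      ring
    rw [h3, mul_left_comm] at h2
    exact (ENNReal.mul_le_mul_iff_right (by norm_num) (by norm_num)).1 h2
  calc (2 ^ m : ℕ) * ENNReal.ofReal (5 * a ^ 2 / (256 * m ^ 2))
      = ∑ _j ∈ Finset.range m, (2 ^ m : ℕ) * ENNReal.ofReal (5 * a ^ 2 / (256 * m ^ 3)) := by
        rw [Finset.sum_const, Finset.card_range, nsmul_eq_mul, mul_left_comm,
          ← ENNReal.ofReal_natCast m, ← ENNReal.ofReal_mul hm'.le]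
        congr 2
        field_simp
    _ ≤ ∑ j ∈ Finset.range m, ∑ w ∈ (Finset.range m).powerset, A w j := Finset.sum_le_sum h1
    _ = ∑ w ∈ (Finset.range m).powerset, ∑ j ∈ Finset.range m, A w j := Finset.sum_comm
    _ ≤ _ := Finset.sum_le_sum fun w _ => sum_cellLoss_le_klRisk ha ha1 hm w hp n

theorem le_worstCumRisk {c₀ c₁ c₂ : ℝ} (ha : 0 ≤ a) (ha1 : a ≤ 1 / 4)
    (h0 : a ≤ 1 - c₀) (h1 : a ≤ c₁ - 1) (h2 : a * (6 * Real.pi) ≤ c₂) (hm : 1 ≤ m)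
    {p : CondDensity} (hp : IsStrategy p) {n : ℕ} (hn : n ≤ m ^ 3) :
    ENNReal.ofReal (n * (5 * a ^ 2 / (256 * m ^ 2))) ≤
      worstCumRisk (smoothClass c₀ c₁ c₂) p n := by
  have hpow : ((2 ^ m : ℕ) : ℝ≥0∞) ≠ 0 := by exact_mod_cast (pow_pos two_pos m).ne'
  have hsum : (2 ^ m : ℕ) * ENNReal.ofReal (n * (5 * a ^ 2 / (256 * m ^ 2))) ≤
      ∑ w ∈ (Finset.range m).powerset, cumRisk (perturbedLaw a m w) p n := by
    simp only [cumRisk]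
    rw [Finset.sum_comm]
    have h3 := Finset.card_nsmul_le_sum (Finset.range n)
      (fun i => ∑ w ∈ (Finset.range m).powerset, klRisk (perturbedLaw a m w) p i) _
      fun i hi => le_sum_klRisk ha ha1 hm hp ((Finset.mem_range.1 hi).le.trans hn)
    refine le_trans (le_of_eq ?_) h3
    rw [Finset.card_range, nsmul_eq_mul, mul_left_comm, ENNReal.ofReal_mul (Nat.cast_nonneg n),
      ENNReal.ofReal_natCast]
  have hle : ∑ w ∈ (Finset.range m).powerset, cumRisk (perturbedLaw a m w) p n ≤
      (2 ^ m : ℕ) * worstCumRisk (smoothClass c₀ c₁ c₂) p n := by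
    have h3 := Finset.sum_le_card_nsmul (Finset.range m).powerset
      (fun w => cumRisk (perturbedLaw a m w) p n) (worstCumRisk (smoothClass c₀ c₁ c₂) p n)
      fun w _ => le_iSup₂ (f := fun P (_ : P ∈ smoothClass c₀ c₁ c₂) => cumRisk P p n) _
        (perturbedLaw_mem_smoothClass ha ha1 h0 h1 h2 hm w)
    rwa [Finset.card_powerset, Finset.card_range, nsmul_eq_mul] at h3
  exact (ENNReal.mul_le_mul_iff_right hpow (ENNReal.natCast_ne_top _)).1 (hsum.trans hle)

end Assouad

theorem exists_cubeRoot_le_minimaxCumRisk {c₀ c₁ c₂ : ℝ} (hc₀ : c₀ < 1) (hc₁ : 1 < c₁)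
    (hc₂ : 0 < c₂) : ∃ C : ℝ≥0, 0 < C ∧ ∀ n ≥ 1,
      cubeRoot n ≤ C * minimaxCumRisk (smoothClass c₀ c₁ c₂) n := by
  have hpi := Real.pi_pos
  obtain ⟨a, ha, ha1, h0, h1, h2⟩ : ∃ a : ℝ, 0 < a ∧ a ≤ 1 / 4 ∧ a ≤ 1 - c₀ ∧ a ≤ c₁ - 1 ∧
      a * (6 * Real.pi) ≤ c₂ := by
    refine ⟨min (min (1 / 4) (1 - c₀)) (min (c₁ - 1) (c₂ / (6 * Real.pi))), ?_,
      (min_le_left _ _).trans (min_le_left _ _), (min_le_left _ _).trans (min_le_right _ _),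
      (min_le_right _ _).trans (min_le_left _ _), ?_⟩
    · refine lt_min (lt_min (by norm_num) (by linarith)) (lt_min (by linarith) (by positivity))
    · rw [← le_div_iff₀ (by positivity)]
      exact (min_le_right _ _).trans (min_le_right _ _)
  have hC : 0 < 1024 / (5 * a ^ 2) := by positivity
  refine ⟨(1024 / (5 * a ^ 2)).toNNReal, Real.toNNReal_pos.2 hC, fun n hn => ?_⟩
  have hn' : (1 : ℝ) ≤ n := by exact_mod_cast hn
  set u := (n : ℝ) ^ (1 / 3 : ℝ) with hu
  have hu3 : u ^ 3 = n := rpow_one_third_pow (by positivity)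
  have hu1 : 1 ≤ u := Real.one_le_rpow hn' (by norm_num)
  have hm1 : 1 ≤ ⌈u⌉₊ := Nat.one_le_ceil_iff.2 (by linarith)
  have hmu : u ≤ ⌈u⌉₊ := Nat.le_ceil u
  have hmu2 : (⌈u⌉₊ : ℝ) ≤ 2 * u := by
    have := Nat.ceil_lt_add_one (by linarith : 0 ≤ u)
    linarith
  have hnm : n ≤ ⌈u⌉₊ ^ 3 := by
    have : (n : ℝ) ≤ (⌈u⌉₊ : ℝ) ^ 3 := by
      rw [← hu3]; exact pow_le_pow_left₀ (by linarith) hmu 3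
    exact_mod_cast this
  have hmain : ENNReal.ofReal (5 * a ^ 2 / 1024 * u) ≤
      minimaxCumRisk (smoothClass c₀ c₁ c₂) n := by
    refine le_iInf₂ fun p hp => ?_
    refine le_trans (ENNReal.ofReal_le_ofReal ?_) (le_worstCumRisk ha.le ha1 h0 h1 h2 hm1 hp hnm)
    have hmpos : (0 : ℝ) < ⌈u⌉₊ := by linarith
    calc 5 * a ^ 2 / 1024 * u = n * (5 * a ^ 2 / (256 * (2 * u) ^ 2)) := by
          rw [← hu3]; field_simp; norm_num
      _ ≤ n * (5 * a ^ 2 / (256 * (⌈u⌉₊ : ℝ) ^ 2)) := by gcongr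
  have hscale : cubeRoot n =
      (1024 / (5 * a ^ 2)).toNNReal * ENNReal.ofReal (5 * a ^ 2 / 1024 * u) := by
    change ENNReal.ofReal u = ENNReal.ofReal _ * _
    rw [← ENNReal.ofReal_mul hC.le]
    congr 1
    field_simp
  rw [hscale]
  exact mul_le_mul_right hmain _

/-! ### Asymptotic ordering -/

theorem asympLE_of_eventually_le {c : ℝ≥0} {g h : ℕ → ℝ≥0∞} {n₀ : ℕ}
    (H : ∀ n ≥ n₀, g n ≤ c * h n) : AsympLE g h := by
  refine ⟨c + 1, by positivity, fun ε _ => ⟨n₀, fun n hn => (H n hn).trans ?_⟩⟩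
  refine mul_le_mul_left ?_ _
  calc (c : ℝ≥0∞) ≤ ((c + 1 : ℝ≥0) : ℝ≥0∞) := by exact_mod_cast le_self_add
    _ ≤ (1 + ε) * ((c + 1 : ℝ≥0) : ℝ≥0∞) := le_mul_of_one_le_left' le_self_add

/-- Adding a term of lower order does not change the multiplicative constant. -/
theorem AsympLEWith.of_le_add {A : ℝ≥0} (hA : 0 < A) {g g' h : ℕ → ℝ≥0∞}
    (hg' : AsympLEWith A g' h)
    (H : ∀ δ : ℝ≥0, 0 < δ → ∃ n₀ : ℕ, ∀ n ≥ n₀, g n ≤ g' n + δ * h n) : AsympLEWith A g h := by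
  intro ε hε
  obtain ⟨n₁, h1⟩ := hg' (ε / 2) (by positivity)
  obtain ⟨n₂, h2⟩ := H (ε / 2 * A) (by positivity)
  refine ⟨max n₁ n₂, fun n hn => ?_⟩
  calc g n ≤ g' n + (ε / 2 * A : ℝ≥0) * h n := h2 n ((le_max_right _ _).trans hn)
    _ ≤ (1 + (ε / 2 : ℝ≥0)) * A * h n + (ε / 2 * A : ℝ≥0) * h n :=
        add_le_add (h1 n ((le_max_left _ _).trans hn)) le_rfl
    _ = (1 + (ε / 2 + ε / 2 : ℝ≥0)) * A * h n := by push_cast; ring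
    _ = (1 + ε) * A * h n := by rw [add_halves]

end SwitchHist

end

theorem theorem2 (c₀ c₁ c₂ : ℝ) (hc₀ : 0 < c₀) (hc₀' : c₀ < 1) (hc₁ : 1 < c₁)
    (πm πk πt : PMF ℕ+)
    (hπm : ∀ m, 0 < πm m) (hπk : ∀ k, 0 < πk k) (hπt : ∀ t, 0 < πt t)
    (hm : (fun m : ℕ+ => -Real.log (πm m).toReal) =O[atTop] fun m : ℕ+ => (m : ℝ))
    (hk : (fun k : ℕ+ => -Real.log (πk k).toReal) =O[atTop] fun k : ℕ+ => Real.log (k : ℝ))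
    (ht : (fun t : ℕ+ => -Real.log (πt t).toReal) =O[atTop] fun t : ℕ+ => Real.log (t : ℝ)) :
    -- the worst-case cumulative risk of the switch distribution is `O(n^{1/3})`
    AsympLE (worstCumRisk (smoothClass c₀ c₁ c₂)
      (switchDensity (switchPrior πm πk πt) fun k => histogram k)) cubeRoot ∧
    -- which is the order of the minimax cumulative risk
    (0 < c₂ →
      AsympEq (minimaxCumRisk (smoothClass c₀ c₁ c₂)) cubeRoot ∧
      AsympLE (worstCumRisk (smoothClass c₀ c₁ c₂)
        (switchDensity (switchPrior πm πk πt) fun k => histogram k))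
        (minimaxCumRisk (smoothClass c₀ c₁ c₂))) ∧
    -- and the constant is no worse than that of the estimator with `⌈n^{1/3}⌉` bins
    (AsympLE (worstCumRisk (smoothClass c₀ c₁ c₂) cubeRootHistogram) cubeRoot ∧
      ∀ A : ℝ≥0,
        AsympLEWith A (worstCumRisk (smoothClass c₀ c₁ c₂) cubeRootHistogram) cubeRoot →
        AsympLEWith A (worstCumRisk (smoothClass c₀ c₁ c₂)
          (switchDensity (switchPrior πm πk πt) fun k => histogram k)) cubeRoot) := by
  set sw := switchDensity (switchPrior πm πk πt) fun k => histogram k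
  have hcomp := fun (δ : ℝ≥0) (hδ : 0 < δ) =>
    worstCumRisk_switch_le (c₁ := c₁) (c₂ := c₂) hc₀ πm πk πt hπm hπk hπt hm hk ht hδ
  set C : ℝ≥0 := (3 * (c₂ ^ 2 / c₀ + 1)).toNNReal
  have hhist : ∀ n, worstCumRisk (smoothClass c₀ c₁ c₂) cubeRootHistogram n ≤ C * cubeRoot n :=
    worstCumRisk_cubeRootHistogram_le hc₀
  obtain ⟨n₀, hsw⟩ : ∃ n₀ : ℕ, ∀ n ≥ n₀,
      worstCumRisk (smoothClass c₀ c₁ c₂) sw n ≤ (C + 1 : ℝ≥0) * cubeRoot n := by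
    obtain ⟨n₀, h⟩ := hcomp 1 one_pos
    refine ⟨n₀, fun n hn => (h n hn).trans ?_⟩
    rw [ENNReal.coe_add, add_mul]
    exact add_le_add (hhist n) le_rfl
  refine ⟨asympLE_of_eventually_le hsw, fun hc₂ => ?_,
    asympLE_of_eventually_le (n₀ := 0) fun n _ => hhist n, fun A hA => ?_⟩
  · obtain ⟨C', -, hC'⟩ := exists_cubeRoot_le_minimaxCumRisk hc₀' hc₁ hc₂
    refine ⟨⟨asympLE_of_eventually_le (c := C) (n₀ := 0) fun n _ => ?_,
      asympLE_of_eventually_le hC'⟩,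
      asympLE_of_eventually_le (c := (C + 1) * C') (n₀ := max n₀ 1) fun n hn => ?_⟩
    · exact (iInf₂_le cubeRootHistogram isBoundedStrategy_cubeRootHistogram.toIsStrategy).trans
        (hhist n)
    · rw [ENNReal.coe_mul, mul_assoc]
      exact (hsw n ((le_max_left _ _).trans hn)).trans
        (mul_le_mul_right (hC' n ((le_max_right _ _).trans hn)) _)
  · rcases eq_or_ne A 0 with rfl | hA0
    · -- the risk of the histogram vanishes eventually only if there are no laws at all
      rcases (smoothClass c₀ c₁ c₂).eq_empty_or_nonempty with hM | ⟨P, hP⟩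
      · exact fun ε _ => ⟨0, fun n _ => by simp [worstCumRisk, hM]⟩
      · obtain ⟨n₁, h1⟩ := hA 1 one_pos
        have h2 := h1 (max n₁ 2) (le_max_left _ _)
        have h3 := worstCumRisk_cubeRootHistogram_pos hc₀'.le hc₁.le
          (nonneg_of_mem_smoothClass hP) (le_max_right n₁ 2)
        simp only [ENNReal.coe_zero, mul_zero, zero_mul] at h2
        exact absurd h2 (not_le.2 h3)
    · exact hA.of_le_add (pos_iff_ne_zero.2 hA0) hcomp
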